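/- Let $n,s$ be natural numbers, $0\le\delta\le\rho\le1$, $\delta<1$. Write $\hat f(\xi)=\int f(y)e^{-iy\cdot\xi}\,dy$ on $\mathbb R^n$. A smooth function $\sigma(x,\xi,\eta)$ on $(\mathbb R^n)^3$ is in $BS^0_{\rho,\delta}$ if for all multi-indices $\alpha,\beta,\gamma$ there is $C_{\alpha\beta\gamma}$ with $$|\partial_x^\alpha\partial_\xi^\beta\partial_\eta^\gamma\sigma(x,\xi,\eta)|\le C_{\alpha\beta\gamma}(1+|\xi|+|\eta|)^{\delta|\alpha|-\rho(|\beta|+|\gamma|)}\quad\text{for all }x,\xi,\eta,$$ and $\|\sigma\|_{(k)}$ denotes the maximum over $|\alpha|,|\beta|,|\gamma|\le k$ of the best constants $C_{\alpha\beta\gamma}$. A smooth function $\tau(x,\xi)$ is in $S^0_{\rho,\delta}$ if for all $\alpha,\beta$ there is $C_{\alpha\beta}$ with $$|\partial_x^\alpha\partial_\xi^\beta\tau(x,\xi)|\le C_{\alpha\beta}(1+|\xi|)^{\delta|\alpha|-\rho|\beta|}\quad\text{for all }x,\xi,\qquad(*)$$ and $|\tau|_k=\max_{|\alpha|,|\beta|\le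 k}\sup_{x,\xi}|\partial_x^\alpha\partial_\xi^\beta\tau(x,\xi)|(1+|\xi|)^{-\delta|\alpha|+\rho|\beta|}$. Let $C_c^s$ be the space of compactly supported functions $\mathbb R^n\to\mathbb C$ with continuous derivatives up to order $s$, and $W_0^{s,\infty}$ its completion in the norm $\|g\|_{W_0^{s,\infty}}=\sup_{|\gamma|\le s}\|\partial^\gamma g\|_{L^\infty}$. Put $$T_\sigma(f,g)(x)=\iint\sigma(x,\xi,\eta)\hat f(\xi)\hat g(\eta)e^{ix\cdot(\xi+\eta)}\,d\xi\,d\eta,\qquad \sigma_g(x,\xi)=\int\sigma(x,\xi,\eta)\hat g(\eta)e^{ix\cdot\eta}\,d\eta .$$ **Theorem.** Assume $s>\dfrac{[n/2]+1}{1-\delta}+n$. 1. For every $\sigma\in BS^0_{\rho,\delta}$, the integral $T_\sigma(f,g)(x)$ converges absolutely for $f\in\mathcal S(\mathbb R^n)$, $g\in C_c^s$, $x\in\mathbb R^n$, and $T_\sigma$ extends uniquely from $\mathcal S(\mathbb R^n)\times C_c^s$ to a bounded bilinear operator $L^2\times W_0^{s,\infty}\to L^2$. 2. For every $\sigma\in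 BS^0_{\rho,\delta}$ and $g\in C_c^s$, the integral $\sigma_g(x,\xi)$ converges absolutely for all $x,\xi$, and $\sigma_g$ satisfies the requirements of $S^0_{\rho,\delta}$ up to order $[n/2]+1$ in $x$: for each $x$, $\sigma_g(x,\cdot)$ is smooth; for each $\beta$ and $\xi$, $\partial_\xi^\beta\sigma_g(\cdot,\xi)$ is of class $C^{[n/2]+1}$; and for all $|\alpha|\le[n/2]+1$ and all $\beta$, the derivative $\partial_x^\alpha\partial_\xi^\beta\sigma_g$ is continuous on $\mathbb R^n\times\mathbb R^n$ and satisfies $(*)$. If $g\in C_c^\infty$, then $\sigma_g\in S^0_{\rho,\delta}$. 3. There is a constant $C$ depending only on $n,s,\rho,\delta$ such that for all $\sigma\in BS^0_{\rho,\delta}$ and $g\in C_c^s$ $$|\sigma_g|_{[n/2]+1}\le C\,\|\sigma\|_{(n+2)}\,\|g\|_{W_0^{s,\infty}} .$$ -/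

import Mathlib

open MeasureTheory
open scoped ContDiff SchwartzMap

noncomputable section

/-- Euclidean space `ℝⁿ`. -/
abbrev RSpace (n : ℕ) : Type := EuclideanSpace ℝ (Fin n)

/-- The order `|α| = α₁ + ⋯ + αₙ` of a multi-index. -/
def order {n : ℕ} (α : Fin n → ℕ) : ℕ := ∑ i, α i

/-- The partial derivative `∂ᵢ f`. -/
def partialD {n : ℕ} (i : Fin n) (f : RSpace n → ℂ) : RSpace n → ℂ :=
  fun x => fderiv ℝ f x (EuclideanSpace.single i 1)

/-- The iterated partial derivative `∂^α f = ∂₁^{α₁} ⋯ ∂ₙ^{αₙ} f`. -/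
def multiD {n : ℕ} (α : Fin n → ℕ) (f : RSpace n → ℂ) : RSpace n → ℂ :=
  (List.finRange n).foldr (fun i h => (partialD i)^[α i] h) f

/-! ### Linear and bilinear Hörmander symbols -/

/-- `∂_x^α ∂_ξ^β τ (x, ξ)`. -/
def symD {n : ℕ} (α β : Fin n → ℕ) (τ : RSpace n → RSpace n → ℂ) (x ξ : RSpace n) : ℂ :=
  multiD α (fun x' => multiD β (fun ξ' => τ x' ξ') ξ) x

/-- `∂_x^α ∂_ξ^β ∂_η^γ σ (x, ξ, η)`. -/
def bisymD {n : ℕ} (α β γ : Fin n → ℕ) (σ : RSpace n → RSpace n → RSpace n → ℂ)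
    (x ξ η : RSpace n) : ℂ :=
  multiD α (fun x' => multiD β (fun ξ' => multiD γ (fun η' => σ x' ξ' η') η) ξ) x

/-- The linear Hörmander class `S^m_{ρ,δ}`. -/
structure IsSymbol {n : ℕ} (m ρ δ : ℝ) (τ : RSpace n → RSpace n → ℂ) : Prop where
  smooth : ContDiff ℝ ∞ (fun p : RSpace n × RSpace n => τ p.1 p.2)
  bound : ∀ α β : Fin n → ℕ, ∃ C : ℝ, ∀ x ξ : RSpace n,
    ‖symD α β τ x ξ‖ ≤ C * (1 + ‖ξ‖) ^ (m + δ * order α - ρ * order β)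

/-- Symbols which satisfy the requirements of `S^m_{ρ,δ}` up to order `k` in `x`: the derivatives
`∂_x^α ∂_ξ^β τ` with `|α| ≤ k` and arbitrary `β` exist, are continuous on `ℝⁿ × ℝⁿ`, and
satisfy the `S^m_{ρ,δ}` estimates. -/
structure IsSymbolUpTo {n : ℕ} (m ρ δ : ℝ) (k : ℕ) (τ : RSpace n → RSpace n → ℂ) : Prop where
  smooth_freq : ∀ x, ContDiff ℝ ∞ (fun ξ => τ x ξ)
  smooth_space : ∀ (β : Fin n → ℕ) (ξ : RSpace n),
    ContDiff ℝ k (fun x => multiD β (fun ξ' => τ x ξ') ξ)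
  continuous : ∀ α β : Fin n → ℕ, order α ≤ k →
    Continuous (fun p : RSpace n × RSpace n => symD α β τ p.1 p.2)
  bound : ∀ α β : Fin n → ℕ, order α ≤ k → ∃ C : ℝ, ∀ x ξ : RSpace n,
    ‖symD α β τ x ξ‖ ≤ C * (1 + ‖ξ‖) ^ (m + δ * order α - ρ * order β)

/-- The bilinear Hörmander class `BS^m_{ρ,δ}`. -/
structure IsBiSymbol {n : ℕ} (m ρ δ : ℝ) (σ : RSpace n → RSpace n → RSpace n → ℂ) : Prop where
  smooth : ContDiff ℝ ∞
    (fun p : RSpace n × RSpace n × RSpace n => σ p.1 p.2.1 p.2.2)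
  bound : ∀ α β γ : Fin n → ℕ, ∃ C : ℝ, ∀ x ξ η : RSpace n,
    ‖bisymD α β γ σ x ξ η‖ ≤
      C * (1 + ‖ξ‖ + ‖η‖) ^ (m + δ * order α - ρ * (order β + order γ))

/-- Multi-indices of order at most `k`. -/
abbrev MultiIdx (n k : ℕ) : Type := {α : Fin n → ℕ // order α ≤ k}

/-- The seminorm `|τ|_k`: the maximum over `|α|, |β| ≤ k` of the suprema over `x, ξ` of
`|∂_x^α ∂_ξ^β τ (x, ξ)| (1 + |ξ|)^{-δ|α| + ρ|β|}`. -/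
def symbolNorm {n : ℕ} (ρ δ : ℝ) (k : ℕ) (τ : RSpace n → RSpace n → ℂ) : ℝ :=
  ⨆ p : (MultiIdx n k × MultiIdx n k) × (RSpace n × RSpace n),
    ‖symD p.1.1.1 p.1.2.1 τ p.2.1 p.2.2‖ *
      (1 + ‖p.2.2‖) ^ (-δ * order p.1.1.1 + ρ * order p.1.2.1)

/-- The `BS^0_{ρ,δ}`-norm of order `k`: the maximum over `|α|, |β|, |γ| ≤ k` of the suprema over
`x, ξ, η` of `|∂_x^α ∂_ξ^β ∂_η^γ σ (x, ξ, η)| (1 + |ξ| + |η|)^{-δ|α| + ρ(|β| + |γ|)}`. -/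
def biSymbolNorm {n : ℕ} (ρ δ : ℝ) (k : ℕ) (σ : RSpace n → RSpace n → RSpace n → ℂ) : ℝ :=
  ⨆ p : (MultiIdx n k × MultiIdx n k × MultiIdx n k) × (RSpace n × RSpace n × RSpace n),
    ‖bisymD p.1.1.1 p.1.2.1.1 p.1.2.2.1 σ p.2.1 p.2.2.1 p.2.2.2‖ *
      (1 + ‖p.2.2.1‖ + ‖p.2.2.2‖) ^
        (-δ * order p.1.1.1 + ρ * (order p.1.2.1.1 + order p.1.2.2.1))

/-! ### The operators -/

/-- The character `e^{i x·ξ}`. -/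
def expi {n : ℕ} (x ξ : RSpace n) : ℂ := Complex.exp (Complex.I * (inner ℝ x ξ : ℝ))

/-- The Fourier transform `f̂(ξ) = ∫ f(y) e^{-i y·ξ} dy`. -/
def fourierHat {n : ℕ} (f : RSpace n → ℂ) (ξ : RSpace n) : ℂ :=
  ∫ y, f y * expi (-y) ξ

/-- The integrand of the bilinear operator `T_σ`. -/
def biOpIntegrand {n : ℕ} (σ : RSpace n → RSpace n → RSpace n → ℂ) (f g : RSpace n → ℂ)
    (x ξ η : RSpace n) : ℂ :=
  σ x ξ η * fourierHat f ξ * fourierHat g η * expi x (ξ + η)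

/-- `T_σ(f, g)(x) = ∫ ∫ σ(x, ξ, η) f̂(ξ) ĝ(η) e^{i x·(ξ + η)} dξ dη`. -/
def biOp {n : ℕ} (σ : RSpace n → RSpace n → RSpace n → ℂ) (f g : RSpace n → ℂ)
    (x : RSpace n) : ℂ :=
  ∫ p : RSpace n × RSpace n, biOpIntegrand σ f g x p.1 p.2

/-- The integrand of the frozen symbol. -/
def frozenIntegrand {n : ℕ} (σ : RSpace n → RSpace n → RSpace n → ℂ) (g : RSpace n → ℂ)
    (x ξ η : RSpace n) : ℂ :=
  σ x ξ η * fourierHat g η * expi x η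

/-- The frozen symbol `σ_g(x, ξ) = ∫ σ(x, ξ, η) ĝ(η) e^{i x·η} dη`. -/
def frozenSymbol {n : ℕ} (σ : RSpace n → RSpace n → RSpace n → ℂ) (g : RSpace n → ℂ)
    (x ξ : RSpace n) : ℂ :=
  ∫ η, frozenIntegrand σ g x ξ η

/-! ### The space `W_0^{s,∞}` -/

/-- `C_c^s` as a space of functions. -/
def ccSubmodule (n s : ℕ) : Submodule ℂ (RSpace n → ℂ) where
  carrier := {g | ContDiff ℝ s g ∧ HasCompactSupport g}
  add_mem' ha hb := ⟨ha.1.add hb.1, ha.2.add hb.2⟩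
  zero_mem' := ⟨contDiff_const, HasCompactSupport.zero⟩
  smul_mem' c _ hg := ⟨hg.1.const_smul c, hg.2.smul_left (f := fun _ => c)⟩

/-- `C_c^s`, the compactly supported functions with continuous derivatives up to order `s`. It is a
type of its own, so that its topology is the one of the norm below. -/
def CcS (n s : ℕ) : Type := ↥(ccSubmodule n s)

instance (n s : ℕ) : AddCommGroup (CcS n s) := inferInstanceAs (AddCommGroup ↥(ccSubmodule n s))

instance (n s : ℕ) : Module ℂ (CcS n s) := inferInstanceAs (Module ℂ ↥(ccSubmodule n s))

instance (n s : ℕ) : CoeFun (CcS n s) (fun _ => RSpace n → ℂ) := ⟨fun g => g.1⟩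

/-- `‖g‖ = sup_{|γ| ≤ s} ‖∂^γ g‖_∞`. -/
instance (n s : ℕ) : Norm (CcS n s) :=
  ⟨fun g => ⨆ p : MultiIdx n s × RSpace n, ‖multiD p.1.1 g p.2‖⟩

theorem CcS.norm_def {n s : ℕ} (g : CcS n s) :
    ‖g‖ = ⨆ p : MultiIdx n s × RSpace n, ‖multiD p.1.1 g p.2‖ := rfl

theorem CcS.add_coe {n s : ℕ} (f g : CcS n s) : ((f + g : CcS n s) : RSpace n → ℂ) = f + g := rfl

theorem CcS.smul_coe {n s : ℕ} (c : ℂ) (g : CcS n s) :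
    ((c • g : CcS n s) : RSpace n → ℂ) = c • (g : RSpace n → ℂ) := rfl

theorem partialD_contDiff {n k : ℕ} (i : Fin n) {f : RSpace n → ℂ}
    (hf : ContDiff ℝ (k + 1 : ℕ) f) : ContDiff ℝ k (partialD i f) :=
  (hf.fderiv_right (m := k) (by norm_cast)).clm_apply contDiff_const

theorem partialD_add {n k : ℕ} (i : Fin n) {f g : RSpace n → ℂ}
    (hf : ContDiff ℝ (k + 1 : ℕ) f) (hg : ContDiff ℝ (k + 1 : ℕ) g) :
    partialD i (f + g) = partialD i f + partialD i g := by
  funext x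
  have h1 : DifferentiableAt ℝ f x := (hf.differentiable (by norm_cast)) x
  have h2 : DifferentiableAt ℝ g x := (hg.differentiable (by norm_cast)) x
  simp [partialD, fderiv_add h1 h2]

theorem partialD_smul {n k : ℕ} (i : Fin n) {f : RSpace n → ℂ} (c : ℂ)
    (hf : ContDiff ℝ (k + 1 : ℕ) f) : partialD i (c • f) = c • partialD i f := by
  funext x
  have h1 : DifferentiableAt ℝ f x := (hf.differentiable (by norm_cast)) x
  simp [partialD, fderiv_const_smul h1 c]

theorem partialD_hasCompactSupport {n : ℕ} (i : Fin n) {f : RSpace n → ℂ}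
    (hf : HasCompactSupport f) : HasCompactSupport (partialD i f) :=
  hf.fderiv_apply (𝕜 := ℝ) _

/-- Properties, of an operator of order `a`, that the norm axioms need. -/
def GoodOp {n : ℕ} (a : ℕ) (P : (RSpace n → ℂ) → (RSpace n → ℂ)) : Prop :=
  (∀ k f, ContDiff ℝ (k + a : ℕ) f → ContDiff ℝ k (P f)) ∧
  (∀ f g, ContDiff ℝ a f → ContDiff ℝ a g → P (f + g) = P f + P g) ∧
  (∀ (c : ℂ) f, ContDiff ℝ a f → P (c • f) = c • P f) ∧
  (∀ f, HasCompactSupport f → HasCompactSupport (P f))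

theorem GoodOp.comp {n a b : ℕ} {P Q : (RSpace n → ℂ) → (RSpace n → ℂ)}
    (hP : GoodOp a P) (hQ : GoodOp b Q) : GoodOp (a + b) (fun f => P (Q f)) := by
  refine ⟨fun k f hf => hP.1 k _ (hQ.1 _ _ (by rwa [add_assoc])), fun f g hf hg => ?_,
    fun c f hf => ?_, fun f hf => hP.2.2.2 _ (hQ.2.2.2 _ hf)⟩
  · have hle : ((b : ℕ) : WithTop ℕ∞) ≤ ((a + b : ℕ) : WithTop ℕ∞) := by
      exact_mod_cast Nat.le_add_left b a
    simp only [hQ.2.1 f g (hf.of_le hle) (hg.of_le hle),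
      hP.2.1 _ _ (hQ.1 a f hf) (hQ.1 a g hg)]
  · have hle : ((b : ℕ) : WithTop ℕ∞) ≤ ((a + b : ℕ) : WithTop ℕ∞) := by
      exact_mod_cast Nat.le_add_left b a
    simp only [hQ.2.2.1 c f (hf.of_le hle), hP.2.2.1 c _ (hQ.1 a f hf)]

theorem goodOp_id {n : ℕ} : GoodOp (n := n) 0 (fun f => f) :=
  ⟨fun _ _ hf => hf, fun _ _ _ _ => rfl, fun _ _ _ => rfl, fun _ hf => hf⟩

theorem goodOp_partialD {n : ℕ} (i : Fin n) : GoodOp 1 (partialD i) :=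
  ⟨fun _ _ hf => partialD_contDiff i hf, fun _ _ hf hg => partialD_add (k := 0) i hf hg,
    fun c _ hf => partialD_smul (k := 0) i c hf, fun _ hf => partialD_hasCompactSupport i hf⟩

theorem goodOp_iterate {n : ℕ} (i : Fin n) (a : ℕ) : GoodOp a (fun f => (partialD i)^[a] f) := by
  induction a with
  | zero => exact goodOp_id
  | succ a ih =>
    have := ih.comp (goodOp_partialD i)
    simpa only [Function.iterate_succ_apply] using this

theorem goodOp_foldr {n : ℕ} (α : Fin n → ℕ) (l : List (Fin n)) :
    GoodOp (l.map α).sum (fun f => l.foldr (fun i h => (partialD i)^[α i] h) f) := by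
  induction l with
  | nil => exact goodOp_id
  | cons i l ih =>
    have := (goodOp_iterate i (α i)).comp ih
    simpa only [List.map_cons, List.sum_cons, List.foldr_cons] using this

theorem goodOp_multiD {n : ℕ} (α : Fin n → ℕ) : GoodOp (order α) (multiD α) := by
  have h := goodOp_foldr α (List.finRange n)
  rwa [show ((List.finRange n).map α).sum = order α by
    rw [order, ← List.ofFn_eq_map, List.sum_ofFn]] at h

theorem multiD_zero {n : ℕ} (f : RSpace n → ℂ) : multiD (0 : Fin n → ℕ) f = f := by
  have : ∀ l : List (Fin n),
      l.foldr (fun i h => (partialD i)^[(0 : Fin n → ℕ) i] h) f = f := by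
    intro l
    induction l with
    | nil => rfl
    | cons i l ih => simpa using ih
  exact this _

theorem CcS.contDiff_of_le {n s k : ℕ} (g : CcS n s) (h : k ≤ s) : ContDiff ℝ k g :=
  g.2.1.of_le (by exact_mod_cast h)

theorem CcS.bdd {n s : ℕ} (g : CcS n s) :
    BddAbove (Set.range fun p : MultiIdx n s × RSpace n => ‖multiD p.1.1 g p.2‖) := by
  have hfin : Finite (MultiIdx n s) := by
    refine Set.Finite.subset (Set.Finite.pi' (fun _ : Fin n => Set.finite_Iic s)) ?_
    intro α hα i
    exact (Finset.single_le_sum (f := α) (fun _ _ => Nat.zero_le _) (Finset.mem_univ i)).trans hα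
  have hb : ∀ α : MultiIdx n s, ∃ C : ℝ, ∀ x, ‖multiD α.1 g x‖ ≤ C := by
    intro α
    have hG := goodOp_multiD α.1
    have hc : Continuous (multiD α.1 g) :=
      (hG.1 0 g (by simpa using g.contDiff_of_le α.2)).continuous
    exact hc.bounded_above_of_compact_support (hG.2.2.2 _ g.2.2)
  choose C hC using hb
  obtain ⟨M, hM⟩ := Set.finite_range C |>.bddAbove
  refine ⟨M, ?_⟩
  rintro _ ⟨p, rfl⟩
  exact (hC p.1 p.2).trans (hM ⟨p.1, rfl⟩)

theorem CcS.le_norm {n s : ℕ} (g : CcS n s) (α : Fin n → ℕ) (hα : order α ≤ s) (x : RSpace n) :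
    ‖multiD α g x‖ ≤ ‖g‖ :=
  le_ciSup g.bdd (⟨α, hα⟩, x)

theorem CcS.norm_le {n s : ℕ} (g : CcS n s) {M : ℝ}
    (h : ∀ α : Fin n → ℕ, order α ≤ s → ∀ x, ‖multiD α g x‖ ≤ M) : ‖g‖ ≤ M := by
  have : Nonempty (MultiIdx n s) := ⟨⟨0, by simp [order]⟩⟩
  exact ciSup_le fun p => h p.1.1 p.1.2 p.2

theorem CcS.norm_nonneg' {n s : ℕ} (g : CcS n s) : 0 ≤ ‖g‖ :=
  Real.iSup_nonneg fun _ => norm_nonneg _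

theorem CcS.norm_smul_le' {n s : ℕ} (c : ℂ) (g : CcS n s) : ‖c • g‖ ≤ ‖c‖ * ‖g‖ := by
  refine CcS.norm_le _ fun α hα x => ?_
  rw [CcS.smul_coe, (goodOp_multiD α).2.2.1 c _ (g.contDiff_of_le hα), Pi.smul_apply, norm_smul]
  exact mul_le_mul_of_nonneg_left (g.le_norm α hα x) (norm_nonneg _)

theorem CcS.core (n s : ℕ) : NormedSpace.Core ℂ (CcS n s) where
  norm_nonneg := CcS.norm_nonneg'
  norm_smul c g := by
    refine le_antisymm (CcS.norm_smul_le' c g) ?_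
    by_cases hc : c = 0
    · simpa [hc] using CcS.norm_nonneg' ((0 : ℂ) • g)
    · have h := CcS.norm_smul_le' c⁻¹ (c • g)
      rw [smul_smul, inv_mul_cancel₀ hc, one_smul, norm_inv] at h
      rwa [← div_eq_inv_mul, le_div_iff₀' (norm_pos_iff.mpr hc)] at h
  norm_triangle f g := by
    refine CcS.norm_le _ fun α hα x => ?_
    rw [CcS.add_coe, (goodOp_multiD α).2.1 _ _ (f.contDiff_of_le hα) (g.contDiff_of_le hα)]
    exact (norm_add_le _ _).trans (add_le_add (f.le_norm α hα x) (g.le_norm α hα x))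
  norm_eq_zero_iff g := by
    constructor
    · intro h
      refine Subtype.ext (funext fun x => ?_)
      have hx := g.le_norm 0 (by simp [order]) x
      rw [h, multiD_zero] at hx
      exact norm_le_zero_iff.mp hx
    · rintro rfl
      refine le_antisymm ?_ (CcS.norm_nonneg' _)
      simpa using CcS.norm_smul_le' (n := n) (s := s) 0 0

instance (n s : ℕ) : NormedAddCommGroup (CcS n s) := NormedAddCommGroup.ofCore (CcS.core n s)

instance (n s : ℕ) : NormedSpace ℂ (CcS n s) := NormedSpace.ofCore (CcS.core n s)

/-- `W_0^{s,∞}`, the completion of `C_c^s` in the norm `sup_{|γ| ≤ s} ‖∂^γ g‖_∞`. -/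
abbrev W0 (n s : ℕ) : Type := UniformSpace.Completion (CcS n s)

/-- The Hilbert space `L²(ℝⁿ)` of complex-valued functions. -/
abbrev LTwo (n : ℕ) : Type := Lp ℂ 2 (volume : Measure (RSpace n))

end

/-! The frozen symbol. The factor `ĝ(η) e^{i x·η}` is the Fourier transform of `z ↦ g(x - z)`. With
`ψ(z) = 1 / (1 + ∑ z_j^{2M})`, the identity `1 = ψ + ∑ z_j^{2M} ψ` writes this function as a
weighted part plus monomials times the weighted part. Under the transform the monomials are
derivatives in `η`, and integration by parts moves them onto `σ`. They cost nothing there because `ρ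
≥ 0`. What is left of `g` is the transform of `ψ(z) g(x - z)` (`locTransform`). For `2M > n` the
weight is integrable, so this transform is at most a constant times `‖g‖ (1 + |η|)^{-s}`, uniformly
in `x` and whatever the support of `g` (`locTransform_decay`, `integral_mul_fourierHat`). With `2M ≤
n + 2` this accounts for the order `n + 2` of the norm of `σ` in the third claim.

Each derivative in `x` obeys `∂_j σ_g = (∂_j σ)_g + σ_{∂_j g}`: it raises the order of the symbol by
`δ ≤ 1` or uses one derivative of `g`. A derivative in `ξ` only acts on `σ`. Since `(1 + |ξ| +
|η|)^{δd - ρb}` is at most `(1 + |ξ|)^{δd - ρb} (1 + |η|)^{δd}`, the integral in `η` converges as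
soon as `g` has `n + 1 + |α|` derivatives (`multiD_frozenSymbol_bound`).

The bilinear operator. The same integration by parts gives `T_σ(f, g)(x) = ∫ E(x, η) L(x, η) dη`,
where `L` is the localised transform of `g` and `E(·, η)` is a signed sum of linear operators with
symbols `σ(·, ·, η)` and `∂_{η_j}^{2M} σ(·, ·, η)` applied to `f` (`biOp_eq`). If these are bounded
on `L²` uniformly in `η`, then Cauchy–Schwarz in `η` with the integrable weight `(1 + |η|)^{-s}`
bounds `T_σ` on Schwartz functions times `C_c^s` (`exists_biOp_eLpNorm_le`), and density gives the
extension.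

The uniform `L²` bound is a theorem of Calderón–Vaillancourt type for `δ ≤ ρ`, `δ < 1`, proved
directly (`exists_form_bound`). Put `R = |η|` and let `w(ξ)` be a small multiple of `(1 + R +
|ξ|)^δ`. A Taylor formula over a cube of side `w(ζ)` writes the symbol at `ζ` as an average over
nearby `ξ` of its mixed derivatives of order at most one in each variable. The operator becomes a
superposition over `ξ` of multiplications by functions of `x` whose `p`-th derivatives grow like
`w(ξ)^p`, acting on pieces of `f` with frequency within about `w(ξ)` of `ξ`. After pairing with a
test function, integration by parts in `x` with the weight dilated by `w(ξ)` localises the frequency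
of the test function to the same scale. The inequality `2PQ ≤ w^n P² + w^{-n} Q²` and Plancherel's
theorem leave two quadratic forms in the transforms, with positive kernels whose integrals in `ξ`
are bounded (`exists_schur_locKernel`, `exists_schur_wgt`). Away from the diagonal this needs `2M(1
- δ) ≥ n + 1`, which can be arranged because `δ < 1`. Scaling the two functions against each other
and duality finish the bound. -/

noncomputable section

/-! ### Jets of line derivatives and integration by parts -/

/-- `f i` is, for `i ≤ m`, the `i`-th derivative of `f 0` in the direction of the `j`-th basis
vector. -/
def IsJet {n : ℕ} (j : Fin n) (m : ℕ) (f : ℕ → RSpace n → ℂ) : Prop :=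
  ∀ i < m, ∀ x, HasLineDerivAt ℝ (f i) (f (i + 1) x) x (EuclideanSpace.single j 1)

theorem IsJet.mono {n : ℕ} {j : Fin n} {m k : ℕ} {f : ℕ → RSpace n → ℂ} (h : IsJet j m f)
    (hk : k ≤ m) : IsJet j k f := fun i hi x => h i (hi.trans_le hk) x

theorem IsJet.shift {n : ℕ} {j : Fin n} {m : ℕ} {f : ℕ → RSpace n → ℂ} (h : IsJet j (m + 1) f) :
    IsJet j m (fun i => f (i + 1)) := fun i hi x => h (i + 1) (by omega) x

/-- Integration by parts `m` times along one axis. Integrability of every mixed product of total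
order at most `m` takes the place of vanishing boundary terms. -/
theorem IsJet.integral_mul {n : ℕ} {j : Fin n} {m : ℕ} {a G : ℕ → RSpace n → ℂ}
    (ha : IsJet j m a) (hG : IsJet j m G)
    (hint : ∀ p q, p + q ≤ m → Integrable (fun x => a p x * G q x)) :
    ∫ x, a 0 x * G m x = (-1) ^ m * ∫ x, a m x * G 0 x := by
  induction m generalizing a with
  | zero => simp
  | succ m ih =>
    have h1 : ∫ x, a 0 x * G (m + 1) x = - ∫ x, a 1 x * G m x :=
      integral_bilinear_hasLineDerivAt_right_eq_neg_left_of_integrable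
        (B := ContinuousLinearMap.mul ℝ ℂ) (hint 1 m (by omega)) (hint 0 (m + 1) (by omega))
        (hint 0 m (by omega)) (fun x _ => ha 0 (by omega) x) (fun x _ => hG m (by omega) x)
    rw [h1, ih ha.shift (hG.mono (by omega)) fun p q hpq => hint (p + 1) q (by omega)]
    ring

/-- The derivatives of a product, by the Leibniz rule. -/
def jetMul {n : ℕ} (f g : ℕ → RSpace n → ℂ) (i : ℕ) (x : RSpace n) : ℂ :=
  ∑ p ∈ Finset.HasAntidiagonal.antidiagonal i, (i.choose p.1 : ℂ) * (f p.1 x * g p.2 x)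

theorem HasLineDerivAt.mul' {n : ℕ} {f g : RSpace n → ℂ} {f' g' : ℂ} {x v : RSpace n}
    (hf : HasLineDerivAt ℝ f f' x v) (hg : HasLineDerivAt ℝ g g' x v) :
    HasLineDerivAt ℝ (fun y => f y * g y) (f' * g x + f x * g') x v := by
  have h : HasDerivAt (fun t : ℝ => f (x + t • v) * g (x + t • v))
      (f' * g (x + (0 : ℝ) • v) + f (x + (0 : ℝ) • v) * g') 0 := HasDerivAt.fun_mul hf hg
  rw [zero_smul, add_zero] at h
  exact h

theorem IsJet.jetMul {n : ℕ} {j : Fin n} {m : ℕ} {f g : ℕ → RSpace n → ℂ}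
    (hf : IsJet j m f) (hg : IsJet j m g) : IsJet j m (jetMul f g) := by
  intro i hi x
  have h : HasDerivAt (fun t : ℝ => ∑ p ∈ Finset.HasAntidiagonal.antidiagonal i, (i.choose p.1 : ℂ) *
        (f p.1 (x + t • EuclideanSpace.single j 1) * g p.2 (x + t • EuclideanSpace.single j 1)))
      (∑ p ∈ Finset.HasAntidiagonal.antidiagonal i, (i.choose p.1 : ℂ) *
        (f (p.1 + 1) x * g p.2 x + f p.1 x * g (p.2 + 1) x)) 0 := by
    refine HasDerivAt.fun_sum fun p hp => HasDerivAt.const_mul _ ?_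
    rw [Finset.HasAntidiagonal.mem_antidiagonal] at hp
    exact (hf p.1 (by omega) x).mul' (hg p.2 (by omega) x)
  -- Pascal's rule in the form of a sum over the antidiagonal.
  have e : _root_.jetMul f g (i + 1) x = ∑ p ∈ Finset.HasAntidiagonal.antidiagonal i, (i.choose p.1 : ℂ) *
        (f (p.1 + 1) x * g p.2 x + f p.1 x * g (p.2 + 1) x) := by
    have := Finset.sum_antidiagonal_choose_succ_mul (fun p q => f p x * g q x) i
    rw [_root_.jetMul, this, ← Finset.sum_add_distrib]
    refine Finset.sum_congr rfl fun p hp => ?_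
    rw [Finset.HasAntidiagonal.mem_antidiagonal] at hp
    rw [← hp, Nat.choose_symm_add]
    ring
  unfold HasLineDerivAt
  rw [e]
  exact h

theorem jetMul_zero {n : ℕ} (f g : ℕ → RSpace n → ℂ) (x : RSpace n) :
    jetMul f g 0 x = f 0 x * g 0 x := by simp [jetMul]

theorem norm_jetMul_le {n : ℕ} {f g : ℕ → RSpace n → ℂ} {i : ℕ} {x : RSpace n} {A B : ℝ}
    (hf : ∀ p ≤ i, ‖f p x‖ ≤ A) (hg : ∀ p ≤ i, ‖g p x‖ ≤ B) :
    ‖jetMul f g i x‖ ≤ 2 ^ i * (A * B) := by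
  have hA : 0 ≤ A := (norm_nonneg _).trans (hf 0 (Nat.zero_le _))
  refine (norm_sum_le _ _).trans ?_
  have : ∀ p ∈ Finset.HasAntidiagonal.antidiagonal i, ‖(i.choose p.1 : ℂ) * (f p.1 x * g p.2 x)‖ ≤
      (i.choose p.1 : ℝ) * (A * B) := by
    intro p hp
    rw [Finset.HasAntidiagonal.mem_antidiagonal] at hp
    rw [norm_mul, norm_mul, Complex.norm_natCast]
    exact mul_le_mul_of_nonneg_left (mul_le_mul (hf _ (by omega)) (hg _ (by omega))
      (norm_nonneg _) hA) (Nat.cast_nonneg _)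
  refine (Finset.sum_le_sum this).trans ?_
  rw [← Finset.sum_mul, Finset.Nat.sum_antidiagonal_eq_sum_range_succ_mk]
  have := Nat.sum_range_choose i
  exact le_of_eq (by rw [← Nat.cast_sum, this]; push_cast; ring)

/-! ### Oscillatory integrals -/

theorem norm_expi {n : ℕ} (x ξ : RSpace n) : ‖expi x ξ‖ = 1 := by
  rw [expi, mul_comm, Complex.norm_exp_ofReal_mul_I]

theorem expi_comm {n : ℕ} (x ξ : RSpace n) : expi x ξ = expi ξ x := by
  simp [expi, real_inner_comm]

theorem expi_add_right {n : ℕ} (x ξ η : RSpace n) : expi x (ξ + η) = expi x ξ * expi x η := by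
  simp [expi, inner_add_right, mul_add, Complex.exp_add]

theorem expi_neg_right {n : ℕ} (x ξ : RSpace n) : expi x (-ξ) = expi (-x) ξ := by
  simp [expi]

theorem contDiff_expi {n : ℕ} {k : WithTop ℕ∞} :
    ContDiff ℝ k (fun p : RSpace n × RSpace n => expi p.1 p.2) := by
  unfold expi
  have : ContDiff ℝ k (fun p : RSpace n × RSpace n => (inner ℝ p.1 p.2 : ℝ)) :=
    contDiff_fst.inner ℝ contDiff_snd
  exact (contDiff_const.mul (Complex.ofRealCLM.contDiff.comp this)).cexp

@[fun_prop]
theorem Continuous.expi {α : Type*} [TopologicalSpace α] {n : ℕ} {f g : α → RSpace n}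
    (hf : Continuous f) (hg : Continuous g) : Continuous (fun a => expi (f a) (g a)) :=
  (contDiff_expi (k := 0)).continuous.comp (hf.prodMk hg)

theorem hasDerivAt_expi_line {n : ℕ} (x ζ : RSpace n) (j : Fin n) (t : ℝ) :
    HasDerivAt (fun t : ℝ => expi (x + t • EuclideanSpace.single j 1) ζ)
      (Complex.I * (ζ j : ℂ) * expi (x + t • EuclideanSpace.single j 1) ζ) t := by
  unfold expi
  have h : ∀ t : ℝ, (inner ℝ (x + t • EuclideanSpace.single j (1 : ℝ)) ζ : ℝ) =
      inner ℝ x ζ + t * ζ j := by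
    intro t
    rw [inner_add_left, real_inner_smul_left, EuclideanSpace.inner_single_left]
    simp
  simp_rw [h]
  have h1 : HasDerivAt (fun t : ℝ => (inner ℝ x ζ : ℝ) + t * ζ j) (ζ j) t := by
    simpa using ((hasDerivAt_id t).mul_const (ζ j)).const_add (inner ℝ x ζ : ℝ)
  have h2 := (h1.ofReal_comp.const_mul Complex.I).cexp
  rwa [mul_comm] at h2

theorem hasLineDerivAt_expi {n : ℕ} (x ζ : RSpace n) (j : Fin n) :
    HasLineDerivAt ℝ (fun y => expi y ζ) (Complex.I * (ζ j : ℂ) * expi x ζ) x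
      (EuclideanSpace.single j 1) := by
  have h := hasDerivAt_expi_line x ζ j 0
  rw [zero_smul, add_zero] at h
  exact h

/-- The oscillatory integral `∫ e^{i x·ζ} φ(ζ) dζ`. -/
def osc {n : ℕ} (φ : RSpace n → ℂ) (x : RSpace n) : ℂ := ∫ ζ, expi x ζ * φ ζ

theorem integrable_expi_mul {n : ℕ} {φ : RSpace n → ℂ} (h : Integrable φ) (x : RSpace n) :
    Integrable (fun ζ => expi x ζ * φ ζ) := by
  refine h.bdd_mul (c := 1) ?_ (Filter.Eventually.of_forall fun ζ => (norm_expi x ζ).le)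
  exact (by fun_prop : Continuous fun ζ => expi x ζ).aestronglyMeasurable

theorem norm_osc_le {n : ℕ} (φ : RSpace n → ℂ) (x : RSpace n) : ‖osc φ x‖ ≤ ∫ ζ, ‖φ ζ‖ := by
  refine (norm_integral_le_integral_norm _).trans (le_of_eq ?_)
  simp [norm_expi]

theorem fourierHat_eq_osc {n : ℕ} (f : RSpace n → ℂ) (ξ : RSpace n) :
    fourierHat f ξ = osc f (-ξ) := by
  unfold fourierHat osc
  refine integral_congr_ae (Filter.Eventually.of_forall fun y => ?_)
  simp only
  rw [mul_comm, ← expi_neg_right, expi_comm]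

theorem continuous_osc {n : ℕ} {φ : RSpace n → ℂ} (h : Integrable φ) : Continuous (osc φ) := by
  refine continuous_of_dominated (bound := fun ζ => ‖φ ζ‖)
    (fun x => (integrable_expi_mul h x).aestronglyMeasurable)
    (fun x => Filter.Eventually.of_forall fun ζ => by simp [norm_expi]) h.norm
    (Filter.Eventually.of_forall fun ζ => by fun_prop)

theorem osc_add {n : ℕ} {φ ψ : RSpace n → ℂ} (hφ : Integrable φ) (hψ : Integrable ψ)
    (x : RSpace n) : osc (fun ζ => φ ζ + ψ ζ) x = osc φ x + osc ψ x := by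
  unfold osc
  rw [← integral_add (integrable_expi_mul hφ x) (integrable_expi_mul hψ x)]
  simp only [mul_add]

theorem osc_const_mul {n : ℕ} (φ : RSpace n → ℂ) (c : ℂ) (x : RSpace n) :
    osc (fun ζ => c * φ ζ) x = c * osc φ x := by
  unfold osc
  rw [← integral_const_mul]
  refine integral_congr_ae (Filter.Eventually.of_forall fun y => ?_)
  simp only
  ring

theorem osc_sum {n : ℕ} {ι : Type*} (s : Finset ι) {φ : ι → RSpace n → ℂ}
    (hφ : ∀ i ∈ s, Integrable (φ i)) (x : RSpace n) :
    osc (fun ζ => ∑ i ∈ s, φ i ζ) x = ∑ i ∈ s, osc (φ i) x := by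
  unfold osc
  rw [← integral_finsetSum s fun i hi => integrable_expi_mul (hφ i hi) x]
  simp only [Finset.mul_sum]

theorem norm_coord_le {n : ℕ} (x : RSpace n) (j : Fin n) : |x j| ≤ ‖x‖ := by
  simpa using PiLp.norm_apply_le x j

/-- Differentiation under the integral: a derivative in direction `j` multiplies the density by `i
ζ_j`, and the modulus of the new density dominates since `|e^{i x·ζ}| = 1`. -/
theorem isJet_osc {n : ℕ} (j : Fin n) (m : ℕ) {φ : RSpace n → ℂ}
    (h : ∀ i ≤ m, Integrable (fun ζ : RSpace n => (Complex.I * (ζ j : ℂ)) ^ i * φ ζ)) :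
    IsJet j m (fun i => osc (fun ζ => (Complex.I * (ζ j : ℂ)) ^ i * φ ζ)) := by
  intro i hi x
  set P : RSpace n → ℂ := fun ζ => (Complex.I * (ζ j : ℂ)) ^ i * φ ζ with hP
  set Q : RSpace n → ℂ := fun ζ => (Complex.I * (ζ j : ℂ)) ^ (i + 1) * φ ζ with hQ
  have hPi : Integrable P := h i hi.le
  have hQi : Integrable Q := h (i + 1) hi
  have hd : ∀ ζ : RSpace n, ∀ t : ℝ, HasDerivAt
      (fun t : ℝ => expi (x + t • EuclideanSpace.single j 1) ζ * P ζ)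
      (expi (x + t • EuclideanSpace.single j 1) ζ * Q ζ) t := by
    intro ζ t
    have h2 := (hasDerivAt_expi_line x ζ j t).mul_const (P ζ)
    rwa [show Complex.I * (ζ j : ℂ) * expi (x + t • EuclideanSpace.single j 1) ζ * P ζ =
      expi (x + t • EuclideanSpace.single j 1) ζ * Q ζ by
        simp only [hP, hQ]; rw [pow_succ]; ring] at h2
  have m1 : ∀ᶠ t : ℝ in nhds 0, AEStronglyMeasurable
      (fun ζ => expi (x + t • EuclideanSpace.single j 1) ζ * P ζ) volume :=
    Filter.Eventually.of_forall fun t => (integrable_expi_mul hPi _).aestronglyMeasurable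
  have m2 : ∀ᵐ ζ, ∀ t ∈ (Set.univ : Set ℝ),
      ‖expi (x + t • EuclideanSpace.single j 1) ζ * Q ζ‖ ≤ ‖Q ζ‖ :=
    Filter.Eventually.of_forall fun ζ t _ => by rw [norm_mul, norm_expi, one_mul]
  have h1 := (hasDerivAt_integral_of_dominated_loc_of_deriv_le Filter.univ_mem m1
    (integrable_expi_mul hPi _) (integrable_expi_mul hQi _).aestronglyMeasurable m2
    hQi.norm (Filter.Eventually.of_forall fun ζ t _ => hd ζ t)).2
  rw [zero_smul, add_zero] at h1
  exact h1

theorem isJet_expi {n : ℕ} (j : Fin n) (m : ℕ) (x : RSpace n) :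
    IsJet j m (fun i ζ => (Complex.I * (x j : ℂ)) ^ i * expi x ζ) := by
  intro i _ ζ
  have := HasDerivAt.const_mul ((Complex.I * (x j : ℂ)) ^ i) (hasLineDerivAt_expi ζ x j)
  unfold HasLineDerivAt
  simp only [expi_comm x]
  rw [pow_succ, mul_assoc]
  exact this

/-- The factor `(i x_j)^m e^{i x·ζ}` is an `m`-th derivative in `ζ_j`, which passes to the density
by parts. Smoothness of the density thus becomes decay in `x`. -/
theorem osc_jet {n : ℕ} {j : Fin n} {m : ℕ} {φ : ℕ → RSpace n → ℂ} (hφ : IsJet j m φ)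
    (hint : ∀ i ≤ m, Integrable (φ i)) (x : RSpace n) :
    (Complex.I * (x j : ℂ)) ^ m * osc (φ 0) x = (-1) ^ m * osc (φ m) x := by
  have h1 := hφ.integral_mul (isJet_expi j m x) fun p q hpq => by
    have := (integrable_expi_mul (hint p (by omega)) x).const_mul ((Complex.I * (x j : ℂ)) ^ q)
    refine this.congr (Filter.Eventually.of_forall fun ζ => ?_)
    simp only
    ring
  unfold osc
  rw [← integral_const_mul]
  rw [← integral_const_mul] at h1 ⊢
  refine Eq.trans (integral_congr_ae (Filter.Eventually.of_forall fun ζ => ?_)) (h1.trans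
    (integral_congr_ae (Filter.Eventually.of_forall fun ζ => ?_)))
  · simp only; ring
  · simp only [pow_zero]; ring

theorem norm_osc_jet_le {n : ℕ} {j : Fin n} {m : ℕ} {φ : ℕ → RSpace n → ℂ} (hφ : IsJet j m φ)
    (hint : ∀ i ≤ m, Integrable (φ i)) (x : RSpace n) :
    |x j| ^ m * ‖osc (φ 0) x‖ ≤ ∫ ζ, ‖φ m ζ‖ := by
  have h := congrArg norm (osc_jet hφ hint x)
  simp only [norm_mul, norm_pow, Complex.norm_I, Complex.norm_real, norm_neg, norm_one, one_pow,
    one_mul, Real.norm_eq_abs] at h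
  rw [h]
  exact norm_osc_le _ _

theorem one_add_norm_pow_mul_le {n : ℕ} (x : RSpace n) (m : ℕ) {y B : ℝ} (hy : 0 ≤ y)
    (h0 : y ≤ B) (h : ∀ j, |x j| ^ m * y ≤ B) :
    (1 + ‖x‖) ^ m * y ≤ ((n : ℝ) + 1) ^ m * B := by
  have hsum : ‖x‖ ≤ ∑ j, |x j| := by
    conv_lhs => rw [← (EuclideanSpace.basisFun (Fin n) ℝ).sum_repr x]
    refine (norm_sum_le _ _).trans (Finset.sum_le_sum fun j _ => ?_)
    rw [norm_smul]
    simp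
  -- `M` is the larger of `1` and the greatest `|x_j|`: the first value is covered by `h0`, the
  -- second by `h`. Then `1 + ‖x‖ ≤ (n + 1) M`, whence the constant.
  obtain ⟨M, hM1, hMx, hM⟩ : ∃ M : ℝ, 1 ≤ M ∧ (∀ j, |x j| ≤ M) ∧ M ^ m * y ≤ B := by
    by_cases hc : ∃ j, 1 ≤ |x j|
    · have : Nonempty (Fin n) := ⟨hc.choose⟩
      obtain ⟨i, hi⟩ := Finite.exists_max fun j => |x j|
      obtain ⟨j, hj⟩ := hc
      exact ⟨|x i|, hj.trans (hi j), hi, h i⟩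
    · push Not at hc
      exact ⟨1, le_rfl, fun j => (hc j).le, by simpa using h0⟩
  have h1 : 1 + ‖x‖ ≤ (n + 1) * M := by
    have : ∑ j, |x j| ≤ n * M := by
      refine (Finset.sum_le_sum fun j _ => hMx j).trans ?_
      simp
    linarith
  calc (1 + ‖x‖) ^ m * y ≤ ((n + 1) * M) ^ m * y := by gcongr
    _ = (n + 1) ^ m * (M ^ m * y) := by rw [mul_pow]; ring
    _ ≤ _ := by gcongr

/-- Decay of the oscillatory integral of a function with `m` integrable pure derivatives. -/
theorem osc_decay {n m : ℕ} {φ : RSpace n → ℂ} {B : ℝ} (h0 : ∫ ζ, ‖φ ζ‖ ≤ B)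
    (h : ∀ j, ∃ F : ℕ → RSpace n → ℂ, F 0 = φ ∧ IsJet j m F ∧ (∀ i ≤ m, Integrable (F i)) ∧
      ∫ ζ, ‖F m ζ‖ ≤ B) (x : RSpace n) :
    (1 + ‖x‖) ^ m * ‖osc φ x‖ ≤ ((n : ℝ) + 1) ^ m * B := by
  refine one_add_norm_pow_mul_le x m (norm_nonneg _) ((norm_osc_le _ _).trans h0) fun j => ?_
  obtain ⟨F, rfl, hF, hint, hB⟩ := h j
  exact (norm_osc_jet_le hF hint x).trans hB

/-! ### Iterated directional derivatives -/

/-- The directional derivative. -/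
def dirD {E : Type*} [NormedAddCommGroup E] [NormedSpace ℝ E] (v : E) (F : E → ℂ) : E → ℂ :=
  fun p => fderiv ℝ F p v

/-- Iterated directional derivatives along a finite family of directions. -/
def mulD {E : Type*} [NormedAddCommGroup E] [NormedSpace ℝ E] {n : ℕ} (v : Fin n → E)
    (α : Fin n → ℕ) (F : E → ℂ) : E → ℂ :=
  (List.finRange n).foldr (fun i h => (dirD (v i))^[α i] h) F

theorem multiD_eq_mulD {n : ℕ} (α : Fin n → ℕ) (f : RSpace n → ℂ) :
    multiD α f = mulD (fun i => EuclideanSpace.single i 1) α f := rfl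

theorem partialD_eq_dirD {n : ℕ} (i : Fin n) (f : RSpace n → ℂ) :
    partialD i f = dirD (EuclideanSpace.single i 1) f := rfl

theorem sum_map_finRange {n : ℕ} (α : Fin n → ℕ) : ((List.finRange n).map α).sum = order α := by
  rw [order, ← List.ofFn_eq_map, List.sum_ofFn]

theorem order_add {n : ℕ} (α β : Fin n → ℕ) : order (α + β) = order α + order β := by
  simp [order, Finset.sum_add_distrib]

theorem order_single {n : ℕ} (j : Fin n) (k : ℕ) : order (Pi.single j k : Fin n → ℕ) = k := by
  simp [order]

theorem order_zero {n : ℕ} : order (0 : Fin n → ℕ) = 0 := by simp [order]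

theorem finite_multiIdx (n k : ℕ) : Finite (MultiIdx n k) := by
  refine Set.Finite.subset (Set.Finite.pi' (fun _ : Fin n => Set.finite_Iic k)) ?_
  intro α hα i
  exact (Finset.single_le_sum (f := α) (fun _ _ => Nat.zero_le _) (Finset.mem_univ i)).trans hα

section Directional

variable {E : Type*} [NormedAddCommGroup E] [NormedSpace ℝ E]

theorem dirD_contDiff {k : ℕ} (v : E) {F : E → ℂ} (hF : ContDiff ℝ (k + 1 : ℕ) F) :
    ContDiff ℝ k (dirD v F) :=
  (hF.fderiv_right (m := k) (by norm_cast)).clm_apply contDiff_const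

theorem dirD_smooth (v : E) {F : E → ℂ} (hF : ContDiff ℝ ∞ F) : ContDiff ℝ ∞ (dirD v F) :=
  (hF.fderiv_right (m := ∞) (by simp)).clm_apply contDiff_const

theorem ContDiff.smooth_nat {F : E → ℂ} (hF : ContDiff ℝ ∞ F) (k : ℕ) : ContDiff ℝ k F :=
  hF.of_le (by exact_mod_cast le_top)

theorem dirD_comm (v w : E) {F : E → ℂ} (hF : ContDiff ℝ 2 F) :
    dirD v (dirD w F) = dirD w (dirD v F) := by
  have h1 : Differentiable ℝ (fderiv ℝ F) :=
    (hF.fderiv_right (m := 1) (by norm_num)).differentiable (by norm_num)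
  funext p
  have h : ∀ a b : E, dirD a (dirD b F) p = fderiv ℝ (fderiv ℝ F) p a b := by
    intro a b
    unfold dirD
    rw [fderiv_clm_apply (h1 p) (differentiableAt_const b)]
    simp
  rw [h, h]
  exact (hF.contDiffAt.isSymmSndFDerivAt (by simp)).eq v w

theorem dirD_iterate_contDiff {k : ℕ} (v : E) (a : ℕ) {F : E → ℂ}
    (hF : ContDiff ℝ (k + a : ℕ) F) : ContDiff ℝ k ((dirD v)^[a] F) := by
  induction a generalizing k with
  | zero => exact hF
  | succ a ih =>
    rw [Function.iterate_succ_apply']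
    exact dirD_contDiff v (ih (by rwa [add_assoc, add_comm 1 a]))

theorem dirD_iterate_comm (v w : E) (a : ℕ) {F : E → ℂ} (hF : ContDiff ℝ (a + 1 : ℕ) F) :
    dirD w ((dirD v)^[a] F) = (dirD v)^[a] (dirD w F) := by
  induction a with
  | zero => rfl
  | succ a ih =>
    rw [Function.iterate_succ_apply', Function.iterate_succ_apply',
      ← ih (hF.of_le (by exact_mod_cast Nat.le_succ _)), dirD_comm]
    exact dirD_iterate_contDiff (k := 2) v a (by rwa [show 2 + a = a + 1 + 1 by omega])

variable {n : ℕ} (v : Fin n → E)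

theorem foldr_contDiff (α : Fin n → ℕ) (l : List (Fin n)) {k : ℕ} {F : E → ℂ}
    (hF : ContDiff ℝ (k + (l.map α).sum : ℕ) F) :
    ContDiff ℝ k (l.foldr (fun i h => (dirD (v i))^[α i] h) F) := by
  induction l generalizing k with
  | nil => exact hF
  | cons i l ih =>
    rw [List.map_cons, List.sum_cons, ← add_assoc] at hF
    exact dirD_iterate_contDiff _ _ (ih hF)

theorem mulD_contDiff (α : Fin n → ℕ) {k : ℕ} {F : E → ℂ}
    (hF : ContDiff ℝ (k + order α : ℕ) F) : ContDiff ℝ k (mulD v α F) :=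
  foldr_contDiff v α _ (by rwa [sum_map_finRange])

theorem mulD_smooth (α : Fin n → ℕ) {F : E → ℂ} (hF : ContDiff ℝ ∞ F) :
    ContDiff ℝ ∞ (mulD v α F) := by
  rw [contDiff_infty]
  exact fun k => mulD_contDiff v α (hF.smooth_nat _)

theorem foldr_dirD_comm (w : E) (α : Fin n → ℕ) (l : List (Fin n)) {F : E → ℂ}
    (hF : ContDiff ℝ ((l.map α).sum + 1 : ℕ) F) :
    dirD w (l.foldr (fun i h => (dirD (v i))^[α i] h) F) =
      l.foldr (fun i h => (dirD (v i))^[α i] h) (dirD w F) := by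
  induction l with
  | nil => rfl
  | cons i l ih =>
    rw [List.map_cons, List.sum_cons] at hF
    rw [List.foldr_cons, List.foldr_cons, dirD_iterate_comm,
      ih (hF.of_le (by norm_cast; omega))]
    exact foldr_contDiff v α l (hF.of_le (by norm_cast; omega))

theorem dirD_mulD (w : E) (α : Fin n → ℕ) {F : E → ℂ} (hF : ContDiff ℝ (order α + 1 : ℕ) F) :
    dirD w (mulD v α F) = mulD v α (dirD w F) :=
  foldr_dirD_comm v w α _ (by rwa [sum_map_finRange])

theorem foldr_congr (α β : Fin n → ℕ) (l : List (Fin n)) (h : ∀ i ∈ l, α i = β i) (F : E → ℂ) :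
    l.foldr (fun i h => (dirD (v i))^[α i] h) F =
      l.foldr (fun i h => (dirD (v i))^[β i] h) F := by
  induction l with
  | nil => rfl
  | cons i l ih =>
    rw [List.foldr_cons, List.foldr_cons, ih fun k hk => h k (List.mem_cons_of_mem _ hk),
      h i List.mem_cons_self]

/-- The extra derivative commutes inwards past the derivatives that precede it in the fold, by
symmetry of second derivatives. -/
theorem foldr_add_single (α : Fin n → ℕ) (j : Fin n) (l : List (Fin n)) (hl : l.Nodup)
    (hj : j ∈ l) {F : E → ℂ} (hF : ContDiff ℝ ((l.map α).sum + 1 : ℕ) F) :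
    l.foldr (fun i h => (dirD (v i))^[(α + Pi.single j 1 : Fin n → ℕ) i] h) F =
      l.foldr (fun i h => (dirD (v i))^[α i] h) (dirD (v j) F) := by
  induction l with
  | nil => simp at hj
  | cons i l ih =>
    rw [List.map_cons, List.sum_cons] at hF
    rw [List.nodup_cons] at hl
    rw [List.foldr_cons, List.foldr_cons]
    by_cases hij : j = i
    · subst hij
      rw [foldr_congr v (α + Pi.single j 1) α l, ← foldr_dirD_comm]
      · simp
      · exact hF.of_le (by norm_cast; omega)
      · intro k hk
        have : k ≠ j := fun h => hl.1 (h ▸ hk)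
        simp [this]
    · rw [ih hl.2 ((List.mem_cons.mp hj).resolve_left hij) (hF.of_le (by norm_cast; omega))]
      simp [Ne.symm hij]

theorem mulD_add_single (α : Fin n → ℕ) (j : Fin n) {F : E → ℂ}
    (hF : ContDiff ℝ (order α + 1 : ℕ) F) :
    mulD v (α + Pi.single j 1) F = mulD v α (dirD (v j) F) :=
  foldr_add_single v α j _ (List.nodup_finRange n) (List.mem_finRange j)
    (by rwa [sum_map_finRange])

theorem mulD_zero (F : E → ℂ) : mulD v 0 F = F := by
  have : ∀ l : List (Fin n),
      l.foldr (fun i h => (dirD (v i))^[(0 : Fin n → ℕ) i] h) F = F := by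
    intro l
    induction l with
    | nil => rfl
    | cons i l ih => simp
  exact this _

theorem mulD_single (j : Fin n) (k : ℕ) {F : E → ℂ} (hF : ContDiff ℝ k F) :
    mulD v (Pi.single j k) F = (dirD (v j))^[k] F := by
  induction k generalizing F with
  | zero => simp [mulD_zero]
  | succ k ih =>
    have h : (Pi.single j (k + 1) : Fin n → ℕ) = Pi.single j k + Pi.single j 1 := by
      rw [← Pi.single_add]
    rw [h, mulD_add_single, ih (dirD_contDiff _ hF), Function.iterate_succ_apply]
    rwa [order_single]

/-- The fold applies first the derivative of the last index with a nonzero entry. One derivative in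
that direction comes off by unfolding the iteration, with nothing to commute. This allows inductions
on the order for functions, such as frozen symbols, whose smoothness is still to be shown. -/
theorem foldr_peel (α : Fin n → ℕ) (l : List (Fin n)) (hl : l.Nodup) :
    (∀ i ∈ l, α i = 0) ∨ ∃ j ∈ l, ∃ β : Fin n → ℕ, α = β + Pi.single j 1 ∧ ∀ F : E → ℂ,
      l.foldr (fun i h => (dirD (v i))^[α i] h) F =
        l.foldr (fun i h => (dirD (v i))^[β i] h) (dirD (v j) F) := by
  induction l with
  | nil => simp
  | cons i l ih =>
    rw [List.nodup_cons] at hl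
    rcases ih hl.2 with h0 | ⟨j, hj, β, hβ, hF⟩
    · by_cases hi : α i = 0
      · left
        simpa [hi] using h0
      · right
        obtain ⟨a, ha⟩ := Nat.exists_eq_succ_of_ne_zero hi
        refine ⟨i, List.mem_cons_self, Function.update α i a, ?_, fun F => ?_⟩
        · funext k
          by_cases hk : k = i
          · subst hk; simp [ha]
          · simp [hk]
        · have h2 : ∀ G : E → ℂ, l.foldr (fun i h => (dirD (v i))^[α i] h) G = G := by
            intro G
            have hz : ∀ k ∈ l, α k = (0 : Fin n → ℕ) k := h0
            rw [foldr_congr v α 0 l hz]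
            clear h0 hz ih hl
            induction l with
            | nil => rfl
            | cons i l ih => simp
          have h3 : ∀ G : E → ℂ,
              l.foldr (fun k h => (dirD (v k))^[Function.update α i a k] h) G = G := by
            intro G
            rw [foldr_congr v _ α l, h2]
            intro k hk
            have : k ≠ i := fun h => hl.1 (h ▸ hk)
            simp [this]
          rw [List.foldr_cons, List.foldr_cons, h2, h3, ha]
          simp
    · right
      refine ⟨j, List.mem_cons_of_mem _ hj, β, hβ, fun F => ?_⟩
      rw [List.foldr_cons, List.foldr_cons, hF]
      have hij : i ≠ j := fun h => hl.1 (h ▸ hj)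
      simp [hβ, hij]

/-- The innermost derivative can be split off without any smoothness. -/
theorem exists_mulD_peel (α : Fin n → ℕ) (h : α ≠ 0) :
    ∃ (j : Fin n) (β : Fin n → ℕ), α = β + Pi.single j 1 ∧
      ∀ F : E → ℂ, mulD v α F = mulD v β (dirD (v j) F) := by
  rcases foldr_peel v α (List.finRange n) (List.nodup_finRange n) with h0 | ⟨j, -, β, hβ, hF⟩
  · exact absurd (funext fun i => h0 i (List.mem_finRange i)) h
  · exact ⟨j, β, hβ, hF⟩

theorem dirD_comp_affine {E' : Type*} [NormedAddCommGroup E'] [NormedSpace ℝ E']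
    (ι : E →L[ℝ] E') (p : E') (w : E) {F : E' → ℂ} (hF : Differentiable ℝ F) :
    dirD w (fun x => F (p + ι x)) = fun x => dirD (ι w) F (p + ι x) := by
  funext x
  unfold dirD
  have h1 : HasFDerivAt (fun x => p + ι x) ι x := ι.hasFDerivAt.const_add p
  have := ((hF (p + ι x)).hasFDerivAt.comp x h1).fderiv
  simp only [Function.comp_def] at this
  rw [this]
  rfl

theorem mulD_comp_affine {E' : Type*} [NormedAddCommGroup E'] [NormedSpace ℝ E']
    (ι : E →L[ℝ] E') (p : E') (α : Fin n → ℕ) {F : E' → ℂ} (hF : ContDiff ℝ ∞ F) :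
    mulD v α (fun x => F (p + ι x)) = fun x => mulD (fun i => ι (v i)) α F (p + ι x) := by
  have hit : ∀ (w : E) (a : ℕ) {G : E' → ℂ}, ContDiff ℝ ∞ G →
      (dirD w)^[a] (fun x => G (p + ι x)) = fun x => (dirD (ι w))^[a] G (p + ι x) := by
    intro w a
    induction a with
    | zero => intros; rfl
    | succ a ih =>
      intro G hG
      rw [Function.iterate_succ_apply, dirD_comp_affine ι p w (hG.differentiable (by simp)),
        ih (dirD_smooth _ hG)]
      rfl
  unfold mulD
  generalize List.finRange n = l
  induction l with
  | nil => rfl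
  | cons i l ih =>
    rw [List.foldr_cons, ih, hit]
    · rfl
    · rw [contDiff_infty]
      exact fun k => foldr_contDiff (fun i => ι (v i)) α l (hF.smooth_nat _)

end Directional

/-! ### Derivatives of symbols -/

/-- A symbol as a function on the product. -/
def unc {n : ℕ} (σ : RSpace n → RSpace n → RSpace n → ℂ) (p : RSpace n × RSpace n × RSpace n) : ℂ :=
  σ p.1 p.2.1 p.2.2

/-- The `i`-th direction of the space variable. -/
def eX {n : ℕ} (i : Fin n) : RSpace n × RSpace n × RSpace n := (EuclideanSpace.single i 1, 0, 0)

/-- The `i`-th direction of the first frequency variable. -/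
def eXi {n : ℕ} (i : Fin n) : RSpace n × RSpace n × RSpace n := (0, EuclideanSpace.single i 1, 0)

/-- The `i`-th direction of the second frequency variable. -/
def eEta {n : ℕ} (i : Fin n) : RSpace n × RSpace n × RSpace n := (0, 0, EuclideanSpace.single i 1)

/-- The derivative of a symbol in a direction. -/
def symDir {n : ℕ} (v : RSpace n × RSpace n × RSpace n) (σ : RSpace n → RSpace n → RSpace n → ℂ) :
    RSpace n → RSpace n → RSpace n → ℂ := fun x ξ η => dirD v (unc σ) (x, ξ, η)

theorem unc_symDir {n : ℕ} (v : RSpace n × RSpace n × RSpace n)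
    (σ : RSpace n → RSpace n → RSpace n → ℂ) : unc (symDir v σ) = dirD v (unc σ) := rfl

/-- Derivatives in one variable with the others held fixed are directional derivatives on the
product space, where derivatives in different slots commute. -/
theorem mulD_slot_x {n : ℕ} (α : Fin n → ℕ) {F : RSpace n × RSpace n × RSpace n → ℂ}
    (hF : ContDiff ℝ ∞ F) (x ξ η : RSpace n) :
    multiD α (fun x' => F (x', ξ, η)) x = mulD eX α F (x, ξ, η) := by
  have := congrFun (mulD_comp_affine (fun i : Fin n => EuclideanSpace.single i (1 : ℝ))
    (ContinuousLinearMap.inl ℝ (RSpace n) (RSpace n × RSpace n)) (0, ξ, η) α hF) x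
  have e : (eX : Fin n → _) = fun i => (EuclideanSpace.single i (1 : ℝ), (0 : RSpace n × RSpace n)) :=
    rfl
  rw [e]
  simpa [multiD_eq_mulD] using this

theorem mulD_slot_xi {n : ℕ} (α : Fin n → ℕ) {F : RSpace n × RSpace n × RSpace n → ℂ}
    (hF : ContDiff ℝ ∞ F) (x ξ η : RSpace n) :
    multiD α (fun ξ' => F (x, ξ', η)) ξ = mulD eXi α F (x, ξ, η) := by
  have := congrFun (mulD_comp_affine (fun i : Fin n => EuclideanSpace.single i (1 : ℝ))
    ((ContinuousLinearMap.inr ℝ (RSpace n) (RSpace n × RSpace n)).comp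
      (ContinuousLinearMap.inl ℝ (RSpace n) (RSpace n))) (x, 0, η) α hF) ξ
  have e : (eXi : Fin n → _) = fun i => ((0 : RSpace n), EuclideanSpace.single i (1 : ℝ), (0 : RSpace n)) :=
    rfl
  rw [e]
  simpa [multiD_eq_mulD] using this

theorem mulD_slot_eta {n : ℕ} (α : Fin n → ℕ) {F : RSpace n × RSpace n × RSpace n → ℂ}
    (hF : ContDiff ℝ ∞ F) (x ξ η : RSpace n) :
    multiD α (fun η' => F (x, ξ, η')) η = mulD eEta α F (x, ξ, η) := by
  have := congrFun (mulD_comp_affine (fun i : Fin n => EuclideanSpace.single i (1 : ℝ))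
    ((ContinuousLinearMap.inr ℝ (RSpace n) (RSpace n × RSpace n)).comp
      (ContinuousLinearMap.inr ℝ (RSpace n) (RSpace n))) (x, ξ, 0) α hF) η
  have e : (eEta : Fin n → _) = fun i => ((0 : RSpace n), (0 : RSpace n), EuclideanSpace.single i (1 : ℝ)) :=
    rfl
  rw [e]
  simpa [multiD_eq_mulD] using this

theorem bisymD_eq {n : ℕ} (α β γ : Fin n → ℕ) {σ : RSpace n → RSpace n → RSpace n → ℂ}
    (hσ : ContDiff ℝ ∞ (unc σ)) (x ξ η : RSpace n) :
    bisymD α β γ σ x ξ η = mulD eX α (mulD eXi β (mulD eEta γ (unc σ))) (x, ξ, η) := by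
  unfold bisymD
  rw [← mulD_slot_x α (mulD_smooth _ β (mulD_smooth _ γ hσ))]
  congr 1
  funext x'
  rw [← mulD_slot_xi β (mulD_smooth _ γ hσ)]
  congr 1
  funext ξ'
  rw [← mulD_slot_eta γ hσ]
  rfl

theorem symDir_smooth {n : ℕ} (v : RSpace n × RSpace n × RSpace n)
    {σ : RSpace n → RSpace n → RSpace n → ℂ} (hσ : ContDiff ℝ ∞ (unc σ)) :
    ContDiff ℝ ∞ (unc (symDir v σ)) := dirD_smooth v hσ

/-- The derivatives in `x` are the outermost ones, so the new one, which acts first, has to be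
commuted past those in `η` and `ξ`. -/
theorem bisymD_symDir_eX {n : ℕ} (α β γ : Fin n → ℕ) (j : Fin n)
    {σ : RSpace n → RSpace n → RSpace n → ℂ} (hσ : ContDiff ℝ ∞ (unc σ)) (x ξ η : RSpace n) :
    bisymD α β γ (symDir (eX j) σ) x ξ η = bisymD (α + Pi.single j 1) β γ σ x ξ η := by
  rw [bisymD_eq _ _ _ (symDir_smooth _ hσ), bisymD_eq _ _ _ hσ, unc_symDir,
    ← dirD_mulD _ _ γ (hσ.smooth_nat _), ← dirD_mulD _ _ β ((mulD_smooth _ γ hσ).smooth_nat _),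
    mulD_add_single _ _ _ ((mulD_smooth _ β (mulD_smooth _ γ hσ)).smooth_nat _)]

theorem bisymD_symDir_eXi {n : ℕ} (α β γ : Fin n → ℕ) (j : Fin n)
    {σ : RSpace n → RSpace n → RSpace n → ℂ} (hσ : ContDiff ℝ ∞ (unc σ)) (x ξ η : RSpace n) :
    bisymD α β γ (symDir (eXi j) σ) x ξ η = bisymD α (β + Pi.single j 1) γ σ x ξ η := by
  rw [bisymD_eq _ _ _ (symDir_smooth _ hσ), bisymD_eq _ _ _ hσ, unc_symDir,
    ← dirD_mulD _ _ γ (hσ.smooth_nat _),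
    mulD_add_single _ _ _ ((mulD_smooth _ γ hσ).smooth_nat _)]

theorem bisymD_symDir_eEta {n : ℕ} (α β γ : Fin n → ℕ) (j : Fin n)
    {σ : RSpace n → RSpace n → RSpace n → ℂ} (hσ : ContDiff ℝ ∞ (unc σ)) (x ξ η : RSpace n) :
    bisymD α β γ (symDir (eEta j) σ) x ξ η = bisymD α β (γ + Pi.single j 1) σ x ξ η := by
  rw [bisymD_eq _ _ _ (symDir_smooth _ hσ), bisymD_eq _ _ _ hσ, unc_symDir,
    mulD_add_single _ _ _ (hσ.smooth_nat _)]

section Classes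

variable {n : ℕ} {m ρ δ : ℝ} {σ : RSpace n → RSpace n → RSpace n → ℂ}

theorem IsBiSymbol.smooth_unc (hσ : IsBiSymbol m ρ δ σ) : ContDiff ℝ ∞ (unc σ) := hσ.smooth

theorem IsBiSymbol.symDir_eX (hσ : IsBiSymbol m ρ δ σ) (j : Fin n) :
    IsBiSymbol (m + δ) ρ δ (symDir (eX j) σ) := by
  refine ⟨symDir_smooth _ hσ.smooth_unc, fun α β γ => ?_⟩
  obtain ⟨C, hC⟩ := hσ.bound (α + Pi.single j 1) β γ
  refine ⟨C, fun x ξ η => ?_⟩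
  rw [bisymD_symDir_eX _ _ _ _ hσ.smooth_unc]
  refine (hC x ξ η).trans_eq ?_
  rw [order_add, order_single]
  push_cast
  ring_nf

theorem IsBiSymbol.symDir_eXi (hσ : IsBiSymbol m ρ δ σ) (j : Fin n) :
    IsBiSymbol (m - ρ) ρ δ (symDir (eXi j) σ) := by
  refine ⟨symDir_smooth _ hσ.smooth_unc, fun α β γ => ?_⟩
  obtain ⟨C, hC⟩ := hσ.bound α (β + Pi.single j 1) γ
  refine ⟨C, fun x ξ η => ?_⟩
  rw [bisymD_symDir_eXi _ _ _ _ hσ.smooth_unc]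
  refine (hC x ξ η).trans_eq ?_
  rw [order_add, order_single]
  push_cast
  ring_nf

theorem IsBiSymbol.symDir_eEta (hσ : IsBiSymbol m ρ δ σ) (j : Fin n) :
    IsBiSymbol (m - ρ) ρ δ (symDir (eEta j) σ) := by
  refine ⟨symDir_smooth _ hσ.smooth_unc, fun α β γ => ?_⟩
  obtain ⟨C, hC⟩ := hσ.bound α β (γ + Pi.single j 1)
  refine ⟨C, fun x ξ η => ?_⟩
  rw [bisymD_symDir_eEta _ _ _ _ hσ.smooth_unc]
  refine (hC x ξ η).trans_eq ?_
  rw [order_add, order_single]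
  push_cast
  ring_nf

theorem IsBiSymbol.mono {m' : ℝ} (hσ : IsBiSymbol m ρ δ σ) (h : m ≤ m') :
    IsBiSymbol m' ρ δ σ := by
  refine ⟨hσ.smooth, fun α β γ => ?_⟩
  obtain ⟨C, hC⟩ := hσ.bound α β γ
  refine ⟨|C|, fun x ξ η => (hC x ξ η).trans ?_⟩
  have h1 : (1 : ℝ) ≤ 1 + ‖ξ‖ + ‖η‖ := by
    have := norm_nonneg ξ; have := norm_nonneg η; linarith
  exact mul_le_mul (le_abs_self C) (Real.rpow_le_rpow_of_exponent_le h1 (by linarith))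
    (Real.rpow_nonneg (by linarith) _) (abs_nonneg _)

end Classes

/-! ### A smooth weight -/

/-- The weight `1 / (1 + ∑ⱼ (c zⱼ)^{2M})`. -/
def wgt {n : ℕ} (M : ℕ) (c : ℝ) (z : RSpace n) : ℝ := (1 + ∑ j, (c * z j) ^ (2 * M))⁻¹

section Weight

variable {n : ℕ} (M : ℕ) {c : ℝ}

theorem wgt_den_pos (c : ℝ) (z : RSpace n) : 1 ≤ 1 + ∑ j, (c * z j) ^ (2 * M) := by
  have : 0 ≤ ∑ j, (c * z j) ^ (2 * M) :=
    Finset.sum_nonneg fun j _ => (even_two_mul M).pow_nonneg _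
  linarith

theorem wgt_pos (c : ℝ) (z : RSpace n) : 0 < wgt M c z :=
  inv_pos.mpr (by linarith [wgt_den_pos M c z])

theorem wgt_le_one (c : ℝ) (z : RSpace n) : wgt M c z ≤ 1 := inv_le_one_of_one_le₀ (wgt_den_pos M c z)

/-- Read as `1 = ψ + ∑ (c z_j)^{2M} ψ`, this splits a function into its weighted version and
monomials times it; the monomials turn into derivatives under the transform. -/
theorem wgt_mul_den (c : ℝ) (z : RSpace n) :
    wgt M c z * (1 + ∑ j, (c * z j) ^ (2 * M)) = 1 :=
  inv_mul_cancel₀ (by linarith [wgt_den_pos M c z])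

theorem coord_pow_mul_wgt_le (c : ℝ) (z : RSpace n) (j : Fin n) :
    |c * z j| ^ (2 * M) * wgt M c z ≤ 1 := by
  have h1 : |c * z j| ^ (2 * M) ≤ 1 + ∑ j, (c * z j) ^ (2 * M) := by
    rw [(even_two_mul M).pow_abs]
    have := Finset.single_le_sum (f := fun j => (c * z j) ^ (2 * M))
      (fun j _ => (even_two_mul M).pow_nonneg _) (Finset.mem_univ j)
    simp only at this
    linarith
  calc _ ≤ (1 + ∑ j, (c * z j) ^ (2 * M)) * wgt M c z :=
        mul_le_mul_of_nonneg_right h1 (wgt_pos M c z).le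
    _ = 1 := by rw [mul_comm, wgt_mul_den]

theorem wgt_one_decay (z : RSpace n) : (1 + ‖z‖) ^ (2 * M) * wgt M 1 z ≤ ((n : ℝ) + 1) ^ (2 * M) := by
  have := one_add_norm_pow_mul_le z (2 * M) (B := 1) (wgt_pos M 1 z).le (wgt_le_one M 1 z)
    fun j => by simpa using coord_pow_mul_wgt_le M 1 z j
  simpa using this

theorem wgt_eq_smul (c : ℝ) (z : RSpace n) : wgt M c z = wgt M 1 (c • z) := by
  simp [wgt]

theorem wgt_decay (hc : 0 ≤ c) (z : RSpace n) :
    (1 + c * ‖z‖) ^ (2 * M) * wgt M c z ≤ ((n : ℝ) + 1) ^ (2 * M) := by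
  have := wgt_one_decay M (c • z)
  rwa [← wgt_eq_smul, norm_smul, Real.norm_of_nonneg hc] at this

@[fun_prop]
theorem continuous_wgt (c : ℝ) : Continuous (wgt (n := n) M c) := by
  unfold wgt
  exact Continuous.inv₀ (by fun_prop) fun z => by linarith [wgt_den_pos M c z]

theorem integrable_wgt (hM : n < 2 * M) (hc : 0 < c) : Integrable (wgt (n := n) M c) := by
  have h1 : Integrable (wgt (n := n) M 1) := by
    have h := (integrable_one_add_norm (E := RSpace n) (μ := volume) (r := (2 * M : ℕ))
      (by simpa using (by exact_mod_cast hM : (n : ℝ) < (2 * M : ℕ)))).const_mul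
      (((n : ℝ) + 1) ^ (2 * M))
    refine h.mono' (by fun_prop : Continuous (wgt (n := n) M 1)).aestronglyMeasurable
      (Filter.Eventually.of_forall fun z => ?_)
    rw [Real.norm_of_nonneg (wgt_pos M 1 z).le, Real.rpow_neg (by positivity), Real.rpow_natCast,
      ← div_eq_mul_inv, le_div_iff₀ (by positivity), mul_comm]
    exact wgt_one_decay M z
  have h2 := h1.comp_smul hc.ne'
  refine h2.congr (Filter.Eventually.of_forall fun z => ?_)
  simp only [← wgt_eq_smul]

theorem hasLineDerivAt_coord (z : RSpace n) (j : Fin n) :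
    HasLineDerivAt ℝ (fun z : RSpace n => ((z j : ℝ) : ℂ)) 1 z (EuclideanSpace.single j 1) := by
  unfold HasLineDerivAt
  have h1 : HasDerivAt (fun t : ℝ => z j + t) 1 0 := (hasDerivAt_id (0 : ℝ)).const_add (z j)
  simpa using h1.ofReal_comp

theorem hasLineDerivAt_wgt (c : ℝ) (z : RSpace n) (j : Fin n) :
    HasLineDerivAt ℝ (fun z : RSpace n => ((wgt M c z : ℝ) : ℂ))
      (-(2 * M * c ^ (2 * M)) * (z j : ℂ) ^ (2 * M - 1) * (wgt M c z : ℂ) ^ 2) z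
      (EuclideanSpace.single j 1) := by
  unfold HasLineDerivAt
  have h0 : ∀ i, HasDerivAt (fun t : ℝ => (c * (z + t • EuclideanSpace.single j (1 : ℝ)) i) ^ (2 * M))
      (if i = j then 2 * M * c ^ (2 * M) * (z j) ^ (2 * M - 1) else 0) 0 := by
    intro i
    by_cases hi : i = j
    · subst hi
      have h1 : HasDerivAt (fun t : ℝ => c * (z i + t)) c 0 := by
        simpa using ((hasDerivAt_id (0 : ℝ)).const_add (z i)).const_mul c
      have h2 := h1.fun_pow (2 * M)
      have hf : (fun t : ℝ => (c * (z + t • EuclideanSpace.single i (1 : ℝ)) i) ^ (2 * M)) =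
          fun t : ℝ => (c * (z i + t)) ^ (2 * M) := by funext t; simp
      rw [hf]
      refine h2.congr_deriv ?_
      simp only [if_true, add_zero]
      rcases Nat.eq_zero_or_pos M with rfl | hM
      · simp
      · obtain ⟨k, hk⟩ : ∃ k, 2 * M = k + 1 := ⟨2 * M - 1, by omega⟩
        push_cast
        rw [hk, Nat.add_sub_cancel, mul_pow, pow_succ]
        ring
    · simp only [hi, if_false]
      simpa [hi] using hasDerivAt_const (0 : ℝ) ((c * z i) ^ (2 * M))
  have h3 := ((HasDerivAt.fun_sum fun i (_ : i ∈ Finset.univ) => h0 i).const_add 1).inv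
    (by
      have := wgt_den_pos M c (z + (0 : ℝ) • EuclideanSpace.single j (1 : ℝ))
      linarith)
  have h4 := h3.ofReal_comp
  refine h4.congr_deriv ?_
  rw [zero_smul, add_zero, Finset.sum_ite_eq' Finset.univ j]
  simp only [Finset.mem_univ, if_true, wgt]
  push_cast
  rw [inv_pow, div_eq_mul_inv]
  ring

/-- The functions `zⱼ^p ψ^q` which occur in the derivatives of the weight `ψ`. -/
def wgtSpan (n M : ℕ) (c : ℝ) (j : Fin n) : Submodule ℂ (RSpace n → ℂ) :=
  Submodule.span ℂ {f | ∃ p q : ℕ, p ≤ 2 * M * q ∧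
    f = fun z => (z j : ℂ) ^ p * (wgt M c z : ℂ) ^ (q + 1)}

/-- Since `∂_j ψ = -2M c^{2M} z_j^{2M-1} ψ²`, the derivative of `z_j^p ψ^{q+1}` combines `z_j^{p-1}
ψ^{q+1}` and `z_j^{p+2M-1} ψ^{q+2}`, and both exponents respect `p ≤ 2Mq`. -/
theorem wgtSpan_deriv (j : Fin n) {f : RSpace n → ℂ} (hf : f ∈ wgtSpan n M c j) :
    ∃ g ∈ wgtSpan n M c j, ∀ z, HasLineDerivAt ℝ f (g z) z (EuclideanSpace.single j 1) := by
  induction hf using Submodule.span_induction with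
  | mem f hf =>
    obtain ⟨p, q, hpq, rfl⟩ := hf
    -- For `p = 0` the truncated exponent `p - 1` is harmless, its coefficient being zero.
    refine ⟨(p : ℂ) • (fun z => (z j : ℂ) ^ (p - 1) * (wgt M c z : ℂ) ^ (q + 1)) +
      (-(2 * M * (q + 1) * c ^ (2 * M)) : ℂ) •
        (fun z => (z j : ℂ) ^ (p + (2 * M - 1)) * (wgt M c z : ℂ) ^ (q + 1 + 1)), ?_, fun z => ?_⟩
    · refine add_mem (Submodule.smul_mem _ _ (Submodule.subset_span ⟨p - 1, q, by omega, rfl⟩))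
        (Submodule.smul_mem _ _ (Submodule.subset_span ⟨p + (2 * M - 1), q + 1, ?_, rfl⟩))
      rw [mul_add]; omega
    · have h1 : HasLineDerivAt ℝ (fun z : RSpace n => (z j : ℂ) ^ p) _ z _ :=
        HasDerivAt.fun_pow (hasLineDerivAt_coord z j) p
      have h2 : HasLineDerivAt ℝ (fun z : RSpace n => (wgt M c z : ℂ) ^ (q + 1)) _ z _ :=
        HasDerivAt.fun_pow (hasLineDerivAt_wgt M c z j) (q + 1)
      have h3 := h1.mul' h2
      refine HasDerivAt.congr_deriv h3 ?_
      simp only [zero_smul, add_zero, Pi.add_apply, Pi.smul_apply, smul_eq_mul,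
        Nat.add_sub_cancel, mul_one]
      push_cast
      ring
  | zero => exact ⟨0, zero_mem _, fun z => hasDerivAt_const _ _⟩
  | add f g _ _ hf hg =>
    obtain ⟨f', hf', hf⟩ := hf
    obtain ⟨g', hg', hg⟩ := hg
    exact ⟨f' + g', add_mem hf' hg', fun z => HasDerivAt.fun_add (hf z) (hg z)⟩
  | smul a f _ hf =>
    obtain ⟨f', hf', hf⟩ := hf
    exact ⟨a • f', Submodule.smul_mem _ _ hf', fun z => HasDerivAt.const_mul a (hf z)⟩

theorem wgtSpan_continuous (j : Fin n) {f : RSpace n → ℂ} (hf : f ∈ wgtSpan n M c j) :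
    Continuous f := by
  induction hf using Submodule.span_induction with
  | mem f hf =>
    obtain ⟨p, q, hpq, rfl⟩ := hf
    have := continuous_wgt (n := n) M c
    fun_prop
  | zero => exact continuous_const
  | add f g _ _ hf hg => exact hf.add hg
  | smul a f _ hf => exact hf.const_smul a

/-- One factor `ψ` is kept. The rest, `z_j^p ψ^q` with `p ≤ 2Mq`, is bounded by `c^{-p}`, because `ψ
≤ 1` and `|c z_j|^{2M} ψ ≤ 1`. -/
theorem wgtSpan_bound (hc : 0 < c) (j : Fin n) {f : RSpace n → ℂ} (hf : f ∈ wgtSpan n M c j) :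
    ∃ C : ℝ, ∀ z, ‖f z‖ ≤ C * wgt M c z := by
  induction hf using Submodule.span_induction with
  | mem f hf =>
    obtain ⟨p, q, hpq, rfl⟩ := hf
    refine ⟨(c ^ p)⁻¹, fun z => ?_⟩
    have hw := wgt_pos M c z
    rw [norm_mul, norm_pow, norm_pow, Complex.norm_real, Complex.norm_real, Real.norm_eq_abs,
      Real.norm_of_nonneg hw.le, pow_succ, ← mul_assoc]
    refine mul_le_mul_of_nonneg_right ?_ hw.le
    rw [← one_div, le_div_iff₀ (by positivity)]
    have hy : |z j| ^ p * wgt M c z ^ q * c ^ p = |c * z j| ^ p * wgt M c z ^ q := by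
      rw [abs_mul, abs_of_pos hc, mul_pow]; ring
    rw [hy]
    rcases le_total |c * z j| 1 with h1 | h1
    · exact mul_le_one₀ (pow_le_one₀ (abs_nonneg _) h1) (by positivity)
        (pow_le_one₀ hw.le (wgt_le_one M c z))
    · calc |c * z j| ^ p * wgt M c z ^ q ≤ |c * z j| ^ (2 * M * q) * wgt M c z ^ q := by gcongr
        _ = (|c * z j| ^ (2 * M) * wgt M c z) ^ q := by rw [mul_pow, pow_mul]
        _ ≤ 1 := pow_le_one₀ (by positivity) (coord_pow_mul_wgt_le M c z j)
  | zero => exact ⟨0, fun z => by simp⟩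
  | add f g _ _ hf hg =>
    obtain ⟨C, hC⟩ := hf
    obtain ⟨D, hD⟩ := hg
    refine ⟨C + D, fun z => (norm_add_le _ _).trans ?_⟩
    rw [add_mul]
    exact add_le_add (hC z) (hD z)
  | smul a f _ hf =>
    obtain ⟨C, hC⟩ := hf
    refine ⟨‖a‖ * C, fun z => ?_⟩
    rw [Pi.smul_apply, norm_smul, mul_assoc]
    exact mul_le_mul_of_nonneg_left (hC z) (norm_nonneg a)

/-- The derivatives of the weight are bounded by multiples of the weight. -/
theorem exists_jet_wgt (hc : 0 < c) (j : Fin n) : ∃ Ψ : ℕ → RSpace n → ℂ,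
    (Ψ 0 = fun z => (wgt M c z : ℂ)) ∧ (∀ m, IsJet j m Ψ) ∧ (∀ i, Continuous (Ψ i)) ∧
      ∀ i, ∃ C : ℝ, ∀ z, ‖Ψ i z‖ ≤ C * wgt M c z := by
  choose D hD hD' using fun f : wgtSpan n M c j => wgtSpan_deriv M j f.2
  have h0 : (fun z : RSpace n => (wgt M c z : ℂ)) ∈ wgtSpan n M c j :=
    Submodule.subset_span ⟨0, 0, by simp, by simp⟩
  let Ψ : ℕ → wgtSpan n M c j := fun i => Nat.rec ⟨_, h0⟩ (fun _ f => ⟨D f, hD f⟩) i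
  exact ⟨fun i => (Ψ i).1, rfl, fun m i _ x => hD' (Ψ i) x,
    fun i => wgtSpan_continuous M j (Ψ i).2, fun i => wgtSpan_bound M hc j (Ψ i).2⟩

end Weight

/-! ### Integration by parts with the weight, and decay of weighted transforms -/

section Weighted

variable {n : ℕ} (M : ℕ) {c : ℝ}

theorem IsJet.of_contDiff {m : ℕ} (j : Fin n) {f : RSpace n → ℂ} (hf : ContDiff ℝ m f) :
    IsJet j m (fun i => (partialD j)^[i] f) := by
  intro i hi x
  have h1 : ContDiff ℝ 1 ((partialD j)^[i] f) := by
    have := dirD_iterate_contDiff (k := 1) (EuclideanSpace.single j 1) i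
      (hf.of_le (by exact_mod_cast (by omega : 1 + i ≤ m)))
    exact_mod_cast this
  simp only [Function.iterate_succ_apply']
  exact ((h1.differentiable (by simp)) x).hasFDerivAt.hasLineDerivAt _

/-- Integration by parts against the transform of `h`, with a weight that gains decay. -/
theorem integral_mul_osc_weight {h a₀ : RSpace n → ℂ} {a : Fin n → ℕ → RSpace n → ℂ}
    (ha : ∀ j, IsJet j (2 * M) (a j)) (ha₀ : ∀ j, a j 0 = a₀)
    (hh0 : Integrable (fun z => (wgt M c z : ℂ) * h z))
    (hh : ∀ j, ∀ i ≤ 2 * M,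
      Integrable (fun z : RSpace n => (Complex.I * (z j : ℂ)) ^ i * ((wgt M c z : ℂ) * h z)))
    (hint0 : Integrable (fun η => a₀ η * osc (fun z => (wgt M c z : ℂ) * h z) η))
    (hint : ∀ j p q, p + q ≤ 2 * M → Integrable (fun η => a j p η *
      osc (fun z : RSpace n => (Complex.I * (z j : ℂ)) ^ q * ((wgt M c z : ℂ) * h z)) η)) :
    ∫ η, a₀ η * osc h η = ∫ η, (a₀ η + ∑ j, (-1) ^ M * (c : ℂ) ^ (2 * M) * a j (2 * M) η) *
      osc (fun z => (wgt M c z : ℂ) * h z) η := by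
  set H := fun z => (wgt M c z : ℂ) * h z with hH
  -- The splitting `1 = ψ + ∑ (c z_j)^{2M} ψ`; the sign comes from `(i z_j)^{2M} = (-1)^M z_j^{2M}`.
  have hdec : ∀ z, h z = H z + ∑ j, (-1) ^ M * (c : ℂ) ^ (2 * M) *
      ((Complex.I * (z j : ℂ)) ^ (2 * M) * H z) := by
    intro z
    have h1 := congrArg (fun t : ℝ => (t : ℂ)) (wgt_mul_den M c z)
    simp only [Complex.ofReal_mul, Complex.ofReal_add, Complex.ofReal_one, Complex.ofReal_sum,
      Complex.ofReal_pow] at h1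
    have h2 : ∀ j, (-1) ^ M * (c : ℂ) ^ (2 * M) * ((Complex.I * (z j : ℂ)) ^ (2 * M) * H z) =
        ((c : ℂ) * (z j : ℂ)) ^ (2 * M) * H z := by
      intro j
      have : ((-1 : ℂ)) ^ M * Complex.I ^ (2 * M) = 1 := by
        rw [pow_mul, Complex.I_sq, ← mul_pow]; simp
      rw [mul_pow, mul_pow]
      linear_combination ((c : ℂ) ^ (2 * M) * (z j : ℂ) ^ (2 * M) * H z) * this
    simp only [h2]
    rw [← Finset.sum_mul, hH]
    simp only
    linear_combination (-h z) * h1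
  have hosc : ∀ η, osc h η = osc H η + ∑ j, (-1) ^ M * (c : ℂ) ^ (2 * M) *
      osc (fun z : RSpace n => (Complex.I * (z j : ℂ)) ^ (2 * M) * H z) η := by
    intro η
    conv_lhs => rw [show h = _ from funext hdec]
    rw [osc_add hh0, osc_sum]
    · simp only [osc_const_mul]
    · exact fun j _ => (hh j _ le_rfl).const_mul _
    · exact integrable_finsetSum _ fun j _ => (hh j _ le_rfl).const_mul _
  -- An even number of integrations by parts, so no sign appears.
  have hparts : ∀ j, ∫ η, a₀ η * osc (fun z : RSpace n =>
      (Complex.I * (z j : ℂ)) ^ (2 * M) * H z) η = ∫ η, a j (2 * M) η * osc H η := by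
    intro j
    have := (ha j).integral_mul (isJet_osc j (2 * M) (hh j)) (hint j)
    rw [ha₀, (even_two_mul M).neg_one_pow, one_mul] at this
    simpa using this
  have i1 : ∀ j, Integrable (fun η => a₀ η * osc (fun z : RSpace n =>
      (Complex.I * (z j : ℂ)) ^ (2 * M) * H z) η) := by
    intro j
    have := hint j 0 (2 * M) (by omega)
    rwa [ha₀] at this
  have i2 : ∀ j, Integrable (fun η => a j (2 * M) η * osc H η) := by
    intro j
    simpa using hint j (2 * M) 0 (by omega)
  calc ∫ η, a₀ η * osc h η = ∫ η, (a₀ η * osc H η + ∑ j, (-1) ^ M * (c : ℂ) ^ (2 * M) *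
        (a₀ η * osc (fun z : RSpace n => (Complex.I * (z j : ℂ)) ^ (2 * M) * H z) η)) := by
        refine integral_congr_ae (Filter.Eventually.of_forall fun η => ?_)
        simp only
        rw [hosc, mul_add, Finset.mul_sum]
        congr 1
        exact Finset.sum_congr rfl fun j _ => by ring
    _ = (∫ η, a₀ η * osc H η) + ∑ j, (-1) ^ M * (c : ℂ) ^ (2 * M) *
        ∫ η, a j (2 * M) η * osc H η := by
        rw [integral_add hint0 (integrable_finsetSum _ fun j _ => (i1 j).const_mul _),
          integral_finsetSum _ fun j _ => (i1 j).const_mul _]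
        simp only [integral_const_mul, hparts]
    _ = _ := by
        have : ∀ η, (a₀ η + ∑ j, (-1) ^ M * (c : ℂ) ^ (2 * M) * a j (2 * M) η) * osc H η =
            a₀ η * osc H η + ∑ j, (-1) ^ M * (c : ℂ) ^ (2 * M) * (a j (2 * M) η * osc H η) := by
          intro η
          rw [add_mul, Finset.sum_mul]
          congr 1
          exact Finset.sum_congr rfl fun j _ => by ring
        simp only [this]
        rw [integral_add hint0 (integrable_finsetSum _ fun j _ => (i2 j).const_mul _),
          integral_finsetSum _ fun j _ => (i2 j).const_mul _]
        simp only [integral_const_mul]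

theorem integrable_jetMul {f g : ℕ → RSpace n → ℂ} {i : ℕ}
    (hf : ∀ p ≤ i, Continuous (f p) ∧ ∃ C : ℝ, ∀ z, ‖f p z‖ ≤ C)
    (hg : ∀ p ≤ i, Integrable (g p)) : Integrable (jetMul f g i) := by
  unfold jetMul
  refine integrable_finsetSum _ fun p hp => Integrable.const_mul ?_ _
  rw [Finset.HasAntidiagonal.mem_antidiagonal] at hp
  obtain ⟨h1, C, h2⟩ := hf p.1 (by omega)
  exact (hg p.2 (by omega)).bdd_mul h1.aestronglyMeasurable (Filter.Eventually.of_forall h2)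

/-- Qualitative decay of the transform of a weighted function. -/
theorem exists_osc_weight_decay (hc : 0 < c) {m : ℕ} {S : RSpace n → ℂ}
    (hS : ∀ j, ∃ F : ℕ → RSpace n → ℂ, F 0 = S ∧ IsJet j m F ∧ ∀ i ≤ m, Integrable (F i)) :
    ∃ C : ℝ, ∀ η, (1 + ‖η‖) ^ m * ‖osc (fun z => (wgt M c z : ℂ) * S z) η‖ ≤ C := by
  choose F hF0 hF hFi using hS
  choose Ψ hΨ0 hΨ hΨc hΨb using exists_jet_wgt (n := n) M hc
  have hb : ∀ j i, Continuous (Ψ j i) ∧ ∃ C : ℝ, ∀ z, ‖Ψ j i z‖ ≤ C := by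
    intro j i
    obtain ⟨C, hC⟩ := hΨb j i
    refine ⟨hΨc j i, |C|, fun z => (hC z).trans ?_⟩
    calc C * wgt M c z ≤ |C| * 1 :=
          mul_le_mul (le_abs_self C) (wgt_le_one M c z) (wgt_pos M c z).le (abs_nonneg _)
      _ = _ := mul_one _
  set φ := fun z => (wgt M c z : ℂ) * S z with hφ
  set B : ℝ := (∫ z, ‖φ z‖) + ∑ j, ∫ z, ‖jetMul (Ψ j) (F j) m z‖ with hB
  have hnn : ∀ j, 0 ≤ ∫ z, ‖jetMul (Ψ j) (F j) m z‖ := fun j =>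
    integral_nonneg fun _ => norm_nonneg _
  refine ⟨((n : ℝ) + 1) ^ m * B, fun η => osc_decay (B := B) ?_ (fun j => ?_) η⟩
  · have := Finset.sum_nonneg fun j (_ : j ∈ Finset.univ) => hnn j
    linarith
  · refine ⟨jetMul (Ψ j) (F j), ?_, (hΨ j m).jetMul (hF j), fun i hi => ?_, ?_⟩
    · funext z
      rw [jetMul_zero, hΨ0, hF0]
    · exact integrable_jetMul (fun p _ => hb j p) fun p hp => hFi j p (hp.trans hi)
    · have h1 := Finset.single_le_sum (fun j (_ : j ∈ Finset.univ) => hnn j) (Finset.mem_univ j)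
      have h2 : 0 ≤ ∫ z, ‖φ z‖ := integral_nonneg fun _ => norm_nonneg _
      linarith

/-- Quantitative decay of the transform of a weighted function with bounded derivatives. -/
theorem osc_weight_decay (hM : n < 2 * M) (m : ℕ) : ∃ C : ℝ, 0 ≤ C ∧
    ∀ (S : RSpace n → ℂ) (B : ℝ), Continuous S → (∀ z, ‖S z‖ ≤ B) →
      (∀ j, ∃ F : ℕ → RSpace n → ℂ, F 0 = S ∧ IsJet j m F ∧ ∀ i ≤ m, Continuous (F i) ∧
        ∀ z, ‖F i z‖ ≤ B) →
      ∀ η, (1 + ‖η‖) ^ m * ‖osc (fun z => (wgt M 1 z : ℂ) * S z) η‖ ≤ C * B := by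
  choose Ψ hΨ0 hΨ hΨc hΨb using exists_jet_wgt (n := n) M (c := 1) one_pos
  choose K hK using hΨb
  set K' : ℝ := ∑ j, ∑ i ∈ Finset.range (m + 1), |K j i| with hK'
  have hKK : ∀ j, ∀ i ≤ m, K j i ≤ K' := by
    intro j i hi
    refine (le_abs_self _).trans (le_trans ?_ (Finset.single_le_sum
      (f := fun j => ∑ i ∈ Finset.range (m + 1), |K j i|)
      (fun j _ => Finset.sum_nonneg fun i _ => abs_nonneg _) (Finset.mem_univ j)))
    exact Finset.single_le_sum (f := fun i => |K j i|) (fun i _ => abs_nonneg _)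
      (Finset.mem_range.mpr (by omega))
  have hK0 : 0 ≤ K' := Finset.sum_nonneg fun j _ => Finset.sum_nonneg fun i _ => abs_nonneg _
  have hwi := integrable_wgt (n := n) M hM one_pos
  set W := ∫ z : RSpace n, wgt M 1 z with hW
  have hW0 : 0 ≤ W := integral_nonneg fun z => (wgt_pos M 1 z).le
  refine ⟨((n : ℝ) + 1) ^ m * (W + 2 ^ m * K' * W), by positivity, fun S B hSc hSB hS η => ?_⟩
  have hB : 0 ≤ B := (norm_nonneg _).trans (hSB 0)
  -- For `n < 2M` the weight is integrable, so domination by it replaces any decay of `S`; only sup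
  -- bounds on `S` and its derivatives enter the constant.
  have hdom : ∀ (f : RSpace n → ℂ) (A : ℝ), Continuous f → (∀ z, ‖f z‖ ≤ A * wgt M 1 z) →
      Integrable f ∧ ∫ z, ‖f z‖ ≤ A * W := by
    intro f A hf hA
    have h1 : Integrable f := (hwi.const_mul A).mono' hf.aestronglyMeasurable
      (Filter.Eventually.of_forall hA)
    refine ⟨h1, ?_⟩
    rw [hW, ← integral_const_mul]
    exact integral_mono h1.norm (hwi.const_mul A) hA
  rw [mul_assoc]
  refine osc_decay (B := (W + 2 ^ m * K' * W) * B) ?_ (fun j => ?_) η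
  · have h1 := (hdom (fun z => (wgt M 1 z : ℂ) * S z) B (by
      have := continuous_wgt (n := n) M 1
      fun_prop) fun z => ?_).2
    · refine h1.trans ?_
      have : 0 ≤ 2 ^ m * K' * W * B := by positivity
      linarith
    · rw [norm_mul, Complex.norm_real, Real.norm_of_nonneg (wgt_pos M 1 z).le, mul_comm]
      exact mul_le_mul_of_nonneg_right (hSB z) (wgt_pos M 1 z).le
  · obtain ⟨F, hF0, hF, hFb⟩ := hS j
    have key : ∀ i ≤ m, Integrable (jetMul (Ψ j) F i) ∧
        ∫ z, ‖jetMul (Ψ j) F i z‖ ≤ (2 ^ i * (K' * B)) * W := by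
      intro i hi
      refine hdom _ _ ?_ fun z => ?_
      · unfold jetMul
        refine continuous_finsetSum _ fun p hp => ?_
        rw [Finset.HasAntidiagonal.mem_antidiagonal] at hp
        exact continuous_const.mul ((hΨc j p.1).mul (hFb p.2 (by omega)).1)
      · refine (norm_jetMul_le (A := K' * wgt M 1 z) (B := B) (fun p hp => ?_)
          fun p hp => (hFb p (hp.trans hi)).2 z).trans (le_of_eq (by ring))
        exact (hK j p z).trans
          (mul_le_mul_of_nonneg_right (hKK j p (hp.trans hi)) (wgt_pos M 1 z).le)
    refine ⟨jetMul (Ψ j) F, ?_, (hΨ j m).jetMul hF, fun i hi => (key i hi).1, ?_⟩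
    · funext z
      rw [jetMul_zero, hΨ0, hF0]
    · refine (key m le_rfl).2.trans ?_
      have : 0 ≤ W * B := by positivity
      linarith

end Weighted

/-! ### The frozen symbol as an absolutely convergent localised integral -/

theorem one_add_add_rpow_le {a b κ : ℝ} (ha : 0 ≤ a) (hb : 0 ≤ b) (hκ : 0 ≤ κ) :
    (1 + a + b) ^ κ ≤ (1 + a) ^ κ * (1 + b) ^ κ := by
  rw [← Real.mul_rpow (by positivity) (by positivity)]
  refine Real.rpow_le_rpow (by positivity) ?_ hκ
  nlinarith [mul_nonneg ha hb]

/-- The positive power is submultiplicative, as `1 + a + b ≤ (1 + a)(1 + b)`; the negative power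
only grows when `b` is dropped. The loss in `b` is therefore `p`, whatever `r` is. -/
theorem one_add_add_rpow_sub_le {a b p r : ℝ} (ha : 0 ≤ a) (hb : 0 ≤ b) (hp : 0 ≤ p)
    (hr : 0 ≤ r) : (1 + a + b) ^ (p - r) ≤ (1 + a) ^ (p - r) * (1 + b) ^ p := by
  have h1 := one_add_add_rpow_le ha hb hp
  have h2 : (1 + a + b) ^ (-r) ≤ (1 + a) ^ (-r) :=
    Real.rpow_le_rpow_of_nonpos (by positivity) (by linarith) (by linarith)
  rw [sub_eq_add_neg, Real.rpow_add (by positivity), Real.rpow_add (by positivity)]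
  calc (1 + a + b) ^ p * (1 + a + b) ^ (-r) ≤ ((1 + a) ^ p * (1 + b) ^ p) * (1 + a) ^ (-r) := by
        gcongr
    _ = _ := by ring

theorem integrable_of_decay {n : ℕ} {f : RSpace n → ℂ} {C r : ℝ} (hf : AEStronglyMeasurable f)
    (hr : (n : ℝ) < r) (h : ∀ η, ‖f η‖ ≤ C * (1 + ‖η‖) ^ (-r)) : Integrable f :=
  ((integrable_one_add_norm (E := RSpace n) (μ := volume) (r := r) (by simpa using hr)).const_mul
    C).mono' hf (Filter.Eventually.of_forall h)

section Localised

variable {n : ℕ}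

theorem iterate_partialD_continuous {m i : ℕ} (hi : i ≤ m) (j : Fin n) {f : RSpace n → ℂ}
    (hf : ContDiff ℝ m f) : Continuous ((partialD j)^[i] f) := by
  have := dirD_iterate_contDiff (k := 0) (EuclideanSpace.single j 1) i
    (hf.of_le (by exact_mod_cast (by omega : 0 + i ≤ m)))
  exact this.continuous

theorem iterate_partialD_hasCompactSupport (i : ℕ) (j : Fin n) {f : RSpace n → ℂ}
    (hf : HasCompactSupport f) : HasCompactSupport ((partialD j)^[i] f) := by
  induction i with
  | zero => exact hf
  | succ i ih =>
    rw [Function.iterate_succ_apply']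
    exact partialD_hasCompactSupport j ih

theorem exists_integrable_jet {m : ℕ} {f : RSpace n → ℂ} (hf : ContDiff ℝ m f)
    (hs : HasCompactSupport f) (j : Fin n) :
    ∃ F : ℕ → RSpace n → ℂ, F 0 = f ∧ IsJet j m F ∧ ∀ i ≤ m, Integrable (F i) :=
  ⟨_, rfl, IsJet.of_contDiff j hf, fun i hi =>
    (iterate_partialD_continuous hi j hf).integrable_of_hasCompactSupport
      (iterate_partialD_hasCompactSupport i j hs)⟩

theorem exists_osc_decay {m : ℕ} {g : RSpace n → ℂ} (hg : ContDiff ℝ m g)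
    (hs : HasCompactSupport g) : ∃ C : ℝ, ∀ η, (1 + ‖η‖) ^ m * ‖osc g η‖ ≤ C := by
  choose F hF0 hF hFi using exists_integrable_jet hg hs
  set B : ℝ := (∫ z, ‖g z‖) + ∑ j, ∫ z, ‖F j m z‖ with hB
  have hnn : ∀ j, 0 ≤ ∫ z, ‖F j m z‖ := fun j => integral_nonneg fun _ => norm_nonneg _
  refine ⟨((n : ℝ) + 1) ^ m * B, fun η => osc_decay (B := B) ?_ (fun j => ?_) η⟩
  · have := Finset.sum_nonneg fun j (_ : j ∈ Finset.univ) => hnn j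
    linarith
  · refine ⟨F j, hF0 j, hF j, hFi j, ?_⟩
    have h1 := Finset.single_le_sum (fun j (_ : j ∈ Finset.univ) => hnn j) (Finset.mem_univ j)
    have h2 : 0 ≤ ∫ z, ‖g z‖ := integral_nonneg fun _ => norm_nonneg _
    linarith

theorem le_mul_rpow_neg_of_pow_mul_le {t y C : ℝ} {m : ℕ} (ht : 0 ≤ t)
    (h : (1 + t) ^ m * y ≤ C) : y ≤ C * (1 + t) ^ (-(m : ℝ)) := by
  rw [Real.rpow_neg (by positivity), Real.rpow_natCast, ← div_eq_mul_inv,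
    le_div_iff₀ (by positivity), mul_comm]
  exact h

theorem exists_fourierHat_decay {m : ℕ} {g : RSpace n → ℂ} (hg : ContDiff ℝ m g)
    (hs : HasCompactSupport g) :
    ∃ C : ℝ, ∀ η, ‖fourierHat g η‖ ≤ C * (1 + ‖η‖) ^ (-(m : ℝ)) := by
  obtain ⟨C, hC⟩ := exists_osc_decay hg hs
  refine ⟨C, fun η => ?_⟩
  rw [fourierHat_eq_osc]
  refine le_mul_rpow_neg_of_pow_mul_le (norm_nonneg _) ?_
  simpa using hC (-η)

theorem continuous_fourierHat {g : RSpace n → ℂ} (hg : Integrable g) :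
    Continuous (fourierHat g) := by
  rw [show fourierHat g = fun ξ => osc g (-ξ) from funext (fourierHat_eq_osc g)]
  exact (continuous_osc hg).comp continuous_neg

/-- The substitution `y = x - z`, which moves the point `x` to the origin of `z`, where the weight
is centred. -/
theorem osc_reflect (g : RSpace n → ℂ) (x η : RSpace n) :
    osc (fun z => g (x - z)) η = fourierHat g η * expi x η := by
  unfold osc fourierHat
  rw [← integral_sub_left_eq_self _ volume x, ← integral_mul_const]
  refine integral_congr_ae (Filter.Eventually.of_forall fun y => ?_)
  simp only [sub_sub_cancel]
  rw [sub_eq_add_neg, expi_add_right, expi_comm η x, expi_comm η (-y)]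
  ring

/-- The localised transform of `g` around `x`. -/
def locTransform (M : ℕ) (g : RSpace n → ℂ) (x η : RSpace n) : ℂ :=
  osc (fun z => (wgt M 1 z : ℂ) * g (x - z)) η

theorem hasLineDerivAt_reflect {f : RSpace n → ℂ} {f' : ℂ} {x z v : RSpace n}
    (h : HasLineDerivAt ℝ f f' (x - z) v) :
    HasLineDerivAt ℝ (fun z => f (x - z)) (-f') z v := by
  unfold HasLineDerivAt at h ⊢
  have h0 : HasDerivAt (fun t : ℝ => f (x - z + t • v)) f' (-(0 : ℝ)) := by simpa using h
  have h1 := HasDerivAt.scomp (0 : ℝ) h0 (hasDerivAt_neg (0 : ℝ))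
  rw [neg_one_smul] at h1
  refine h1.congr_of_eventuallyEq (Filter.Eventually.of_forall fun t => ?_)
  simp only [Function.comp_apply]
  congr 1
  rw [neg_smul]
  abel

theorem IsJet.reflect {j : Fin n} {m : ℕ} {F : ℕ → RSpace n → ℂ} (hF : IsJet j m F)
    (x : RSpace n) : IsJet j m (fun i z => (-1) ^ i * F i (x - z)) := by
  intro i hi z
  have h := HasDerivAt.const_mul ((-1 : ℂ) ^ i) (hasLineDerivAt_reflect (hF i hi (x - z)))
  refine HasDerivAt.congr_deriv h ?_
  simp only
  rw [pow_succ]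
  ring

/-- The derivatives of the weight are integrable and those of `z ↦ g(x - z)` are bounded by `B`.
Hence the constant involves neither `x` nor the support of `g`, which is what makes the `W^{s,∞}`
norm sufficient. -/
theorem locTransform_decay (M : ℕ) (hM : n < 2 * M) (m : ℕ) : ∃ C : ℝ, 0 ≤ C ∧
    ∀ (g : RSpace n → ℂ) (B : ℝ), ContDiff ℝ m g → (∀ z, ‖g z‖ ≤ B) →
      (∀ j, ∀ i ≤ m, ∀ z, ‖(partialD j)^[i] g z‖ ≤ B) →
      ∀ x η, ‖locTransform M g x η‖ ≤ C * B * (1 + ‖η‖) ^ (-(m : ℝ)) := by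
  obtain ⟨C, hC0, hC⟩ := osc_weight_decay (n := n) M hM m
  refine ⟨C, hC0, fun g B hg hB hd x η => le_mul_rpow_neg_of_pow_mul_le (norm_nonneg _) ?_⟩
  refine hC (fun z => g (x - z)) B (hg.continuous.comp (by fun_prop)) (fun z => hB _)
    (fun j => ⟨_, ?_, (IsJet.of_contDiff j hg).reflect x, fun i hi => ⟨?_, fun z => ?_⟩⟩) η
  · simp
  · exact continuous_const.mul ((iterate_partialD_continuous hi j hg).comp (by fun_prop))
  · rw [norm_mul, norm_pow, norm_neg, norm_one, one_pow, one_mul]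
    exact hd j i hi _

theorem hasCompactSupport_reflect {g : RSpace n → ℂ} (hs : HasCompactSupport g) (x : RSpace n) :
    HasCompactSupport (fun z => g (x - z)) :=
  hs.comp_homeomorph (Homeomorph.subLeft x)

theorem continuous_locTransform (M : ℕ) {g : RSpace n → ℂ} (hg : Continuous g)
    (hs : HasCompactSupport g) (x : RSpace n) : Continuous (locTransform M g x) := by
  refine continuous_osc (Continuous.integrable_of_hasCompactSupport ?_ ?_)
  · have := continuous_wgt (n := n) M 1
    fun_prop
  · exact (hasCompactSupport_reflect hs x).mul_left

theorem contDiff_coord_pow_mul {m : ℕ} (j : Fin n) (q : ℕ) {g : RSpace n → ℂ}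
    (hg : ContDiff ℝ m g) :
    ContDiff ℝ m (fun z : RSpace n => (Complex.I * (z j : ℂ)) ^ q * g z) := by
  have h1 : ContDiff ℝ m (fun z : RSpace n => (z j : ℂ)) :=
    Complex.ofRealCLM.contDiff.comp (EuclideanSpace.proj (𝕜 := ℝ) j).contDiff
  exact ((contDiff_const.mul h1).pow q).mul hg

/-- The integral defining the frozen symbol, rewritten with the localised transform. -/
theorem integral_mul_fourierHat (M : ℕ) {m : ℕ} {κ : ℝ} (hm : n + κ < m) {a g : RSpace n → ℂ}
    (ha : ContDiff ℝ (2 * M : ℕ) a) (ha0 : ∃ C : ℝ, ∀ η, ‖a η‖ ≤ C * (1 + ‖η‖) ^ κ)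
    (hab : ∀ j, ∀ i ≤ 2 * M, ∃ C : ℝ, ∀ η, ‖(partialD j)^[i] a η‖ ≤ C * (1 + ‖η‖) ^ κ)
    (hg : ContDiff ℝ m g) (hs : HasCompactSupport g) (x : RSpace n) :
    ∫ η, a η * fourierHat g η * expi x η =
      ∫ η, (a η + ∑ j, (-1) ^ M * (partialD j)^[2 * M] a η) * locTransform M g x η := by
  have hgi : Integrable g := hg.continuous.integrable_of_hasCompactSupport hs
  -- All products that the integration by parts meets have growth `κ` against decay `m`, and `m - κ
  -- > n`. The decay constants here are only qualitative and may depend on the support of `g`.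
  have hint : ∀ (b H : RSpace n → ℂ), Continuous b → Continuous H →
      (∃ C : ℝ, ∀ η, ‖b η‖ ≤ C * (1 + ‖η‖) ^ κ) → (∃ C : ℝ, ∀ η, (1 + ‖η‖) ^ m * ‖H η‖ ≤ C) →
      Integrable (fun η => b η * H η) := by
    rintro b H hb hH ⟨C, hC⟩ ⟨D, hD⟩
    refine integrable_of_decay (C := C * D) (r := m - κ) (hb.mul hH).aestronglyMeasurable
      (by linarith) fun η => ?_
    have hpos : 0 < 1 + ‖η‖ := by positivity
    rw [norm_mul, neg_sub, sub_eq_add_neg, Real.rpow_add hpos]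
    calc ‖b η‖ * ‖H η‖ ≤ (C * (1 + ‖η‖) ^ κ) * (D * (1 + ‖η‖) ^ (-(m : ℝ))) :=
          mul_le_mul (hC η) (le_mul_rpow_neg_of_pow_mul_le (norm_nonneg _) (hD η))
            (norm_nonneg _) ((norm_nonneg _).trans (hC η))
      _ = _ := by ring
  set h := fun z => g (x - z) with hh
  have hhc : ContDiff ℝ m h := hg.comp (contDiff_const.sub contDiff_id)
  have hhs : HasCompactSupport h := hasCompactSupport_reflect hs x
  have hw := continuous_wgt (n := n) M 1
  have hS : ∀ j q, (fun z : RSpace n => (Complex.I * (z j : ℂ)) ^ q * ((wgt M 1 z : ℂ) * h z)) =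
      fun z => (wgt M 1 z : ℂ) * ((Complex.I * (z j : ℂ)) ^ q * h z) := by
    intro j q; funext z; ring
  have hSi : ∀ j q, Integrable
      (fun z : RSpace n => (Complex.I * (z j : ℂ)) ^ q * ((wgt M 1 z : ℂ) * h z)) := by
    intro j q
    refine Continuous.integrable_of_hasCompactSupport ?_ (hhs.mul_left.mul_left)
    have := hhc.continuous
    fun_prop
  have hwi : Integrable (fun z => (wgt M 1 z : ℂ) * h z) := by
    refine Continuous.integrable_of_hasCompactSupport ?_ hhs.mul_left
    have := hhc.continuous
    fun_prop
  have key := integral_mul_osc_weight M (c := 1) (h := h) (a₀ := a)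
    (a := fun j i => (partialD j)^[i] a) (fun j => IsJet.of_contDiff j ha) (fun j => rfl) hwi
    (fun j i _ => hSi j i) ?_ ?_
  · simp only [Complex.ofReal_one, one_pow, mul_one] at key
    refine Eq.trans (integral_congr_ae (Filter.Eventually.of_forall fun η => ?_)) key
    simp only
    rw [hh, osc_reflect, mul_assoc]
  · refine hint _ _ ha.continuous (continuous_osc hwi) ha0 ?_
    exact exists_osc_weight_decay M one_pos (exists_integrable_jet hhc hhs)
  · intro j p q hpq
    refine hint _ _ (iterate_partialD_continuous (by omega) j ha) (continuous_osc (hSi j q))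
      (hab j p (by omega)) ?_
    rw [hS]
    have h1 := contDiff_coord_pow_mul j q hhc
    have h2 : HasCompactSupport (fun z : RSpace n => (Complex.I * (z j : ℂ)) ^ q * h z) :=
      hhs.mul_left
    exact exists_osc_weight_decay M one_pos (exists_integrable_jet h1 h2)

end Localised

/-! ### Regularity of the frozen symbol -/

section Frozen

variable {n : ℕ} {m ρ δ : ℝ} {σ : RSpace n → RSpace n → RSpace n → ℂ}

theorem bisymD_zero (σ : RSpace n → RSpace n → RSpace n → ℂ) (x ξ η : RSpace n) :
    bisymD 0 0 0 σ x ξ η = σ x ξ η := by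
  simp only [bisymD, multiD_zero]

theorem IsBiSymbol.exists_growth (hσ : IsBiSymbol m ρ δ σ) {κ : ℝ} (h : m ≤ κ) (hκ : 0 ≤ κ) :
    ∃ C : ℝ, 0 ≤ C ∧ ∀ x ξ η, ‖σ x ξ η‖ ≤ C * ((1 + ‖ξ‖) ^ κ * (1 + ‖η‖) ^ κ) := by
  obtain ⟨C, hC⟩ := (hσ.mono h).bound 0 0 0
  refine ⟨|C|, abs_nonneg C, fun x ξ η => ?_⟩
  have h1 := hC x ξ η
  rw [bisymD_zero, order_zero] at h1
  simp only [Nat.cast_zero, mul_zero, add_zero, sub_zero] at h1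
  exact h1.trans (mul_le_mul (le_abs_self C)
    (one_add_add_rpow_le (norm_nonneg _) (norm_nonneg _) hκ) (by positivity) (abs_nonneg C))

theorem IsBiSymbol.continuous_unc (hσ : IsBiSymbol m ρ δ σ) : Continuous (unc σ) :=
  hσ.smooth_unc.continuous

theorem IsBiSymbol.continuous_comp (hσ : IsBiSymbol m ρ δ σ) {α : Type*} [TopologicalSpace α]
    {f g h : α → RSpace n} (hf : Continuous f) (hg : Continuous g) (hh : Continuous h) :
    Continuous (fun a => σ (f a) (g a) (h a)) :=
  hσ.continuous_unc.comp (hf.prodMk (hg.prodMk hh))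

theorem fourierHat_partialD (j : Fin n) {g : RSpace n → ℂ} (hg : ContDiff ℝ 1 g)
    (hs : HasCompactSupport g) (η : RSpace n) :
    fourierHat (partialD j g) η = Complex.I * (η j : ℂ) * fourierHat g η := by
  have hg' : ContDiff ℝ (1 : ℕ) g := by exact_mod_cast hg
  have h := osc_jet (IsJet.of_contDiff j hg') (fun i hi =>
    (iterate_partialD_continuous hi j hg').integrable_of_hasCompactSupport
      (iterate_partialD_hasCompactSupport i j hs)) (-η)
  simp only [Function.iterate_zero, id, Function.iterate_one, pow_one] at h
  rw [fourierHat_eq_osc, fourierHat_eq_osc]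
  have h2 : (((-η) j : ℝ) : ℂ) = -(η j : ℂ) := by simp
  rw [h2] at h
  linear_combination h

theorem frozenIntegrand_bound {p : ℕ} (hσ : IsBiSymbol m ρ δ σ) {κ : ℝ} (h : m ≤ κ) (hκ : 0 ≤ κ)
    {g : RSpace n → ℂ} (hg : ContDiff ℝ p g) (hs : HasCompactSupport g) :
    ∃ C : ℝ, 0 ≤ C ∧ ∀ x ξ η, ‖frozenIntegrand σ g x ξ η‖ ≤
      C * (1 + ‖ξ‖) ^ κ * (1 + ‖η‖) ^ (-((p : ℝ) - κ)) := by
  obtain ⟨C, hC0, hC⟩ := hσ.exists_growth h hκ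
  obtain ⟨D, hD⟩ := exists_fourierHat_decay hg hs
  have hD0 : 0 ≤ D := by
    have := (norm_nonneg _).trans (hD 0)
    simpa using this
  refine ⟨C * D, by positivity, fun x ξ η => ?_⟩
  have hpos : 0 < 1 + ‖η‖ := by positivity
  rw [frozenIntegrand, norm_mul, norm_mul, norm_expi, mul_one, neg_sub, sub_eq_add_neg,
    Real.rpow_add hpos]
  calc ‖σ x ξ η‖ * ‖fourierHat g η‖ ≤
        (C * ((1 + ‖ξ‖) ^ κ * (1 + ‖η‖) ^ κ)) * (D * (1 + ‖η‖) ^ (-(p : ℝ))) :=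
        mul_le_mul (hC x ξ η) (hD η) (norm_nonneg _) (by positivity)
    _ = _ := by ring

theorem continuous_frozenIntegrand (hσ : IsBiSymbol m ρ δ σ) {g : RSpace n → ℂ}
    (hg : Continuous g) (hs : HasCompactSupport g) :
    Continuous (fun q : (RSpace n × RSpace n) × RSpace n =>
      frozenIntegrand σ g q.1.1 q.1.2 q.2) := by
  have h1 := continuous_fourierHat (hg.integrable_of_hasCompactSupport hs)
  have h2 := hσ.continuous_comp (α := (RSpace n × RSpace n) × RSpace n)
    (f := fun q => q.1.1) (g := fun q => q.1.2) (h := fun q => q.2) (by fun_prop) (by fun_prop)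
    (by fun_prop)
  unfold frozenIntegrand
  exact (h2.mul (h1.comp continuous_snd)).mul
    (Continuous.expi (continuous_fst.comp continuous_fst) continuous_snd)

theorem integrable_frozenIntegrand {p : ℕ} (hσ : IsBiSymbol m ρ δ σ) {κ : ℝ} (h : m ≤ κ)
    (hκ : 0 ≤ κ) (hp : n + κ < p) {g : RSpace n → ℂ} (hg : ContDiff ℝ p g)
    (hs : HasCompactSupport g) (x ξ : RSpace n) :
    Integrable (fun η => frozenIntegrand σ g x ξ η) := by
  obtain ⟨C, -, hC⟩ := frozenIntegrand_bound hσ h hκ hg hs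
  refine integrable_of_decay (r := p - κ) ?_ (by linarith) fun η => hC x ξ η
  exact ((continuous_frozenIntegrand hσ hg.continuous hs).comp
    (by fun_prop : Continuous fun η : RSpace n => ((x, ξ), η))).aestronglyMeasurable

theorem continuous_frozenSymbol {p : ℕ} (hσ : IsBiSymbol m ρ δ σ) {κ : ℝ} (h : m ≤ κ)
    (hκ : 0 ≤ κ) (hp : n + κ < p) {g : RSpace n → ℂ} (hg : ContDiff ℝ p g)
    (hs : HasCompactSupport g) :
    Continuous (fun q : RSpace n × RSpace n => frozenSymbol σ g q.1 q.2) := by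
  obtain ⟨C, hC0, hC⟩ := frozenIntegrand_bound hσ h hκ hg hs
  have hcont := continuous_frozenIntegrand hσ hg.continuous hs
  rw [continuous_iff_continuousAt]
  intro q₀
  unfold frozenSymbol
  have hr : ((Module.finrank ℝ (RSpace n) : ℕ) : ℝ) < p - κ := by simp; linarith
  refine continuousAt_of_dominated (bound := fun η =>
      C * (1 + (‖q₀.2‖ + 1)) ^ κ * (1 + ‖η‖) ^ (-((p : ℝ) - κ)))
    (Filter.Eventually.of_forall fun q =>
      (integrable_frozenIntegrand hσ h hκ hp hg hs q.1 q.2).aestronglyMeasurable) ?_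
    ((integrable_one_add_norm hr).const_mul _)
    (Filter.Eventually.of_forall fun η =>
      (hcont.comp (by fun_prop : Continuous fun q : RSpace n × RSpace n => (q, η))).continuousAt)
  filter_upwards [Metric.ball_mem_nhds q₀ one_pos] with q hq
  refine Filter.Eventually.of_forall fun η => (hC q.1 q.2 η).trans ?_
  have h1 : ‖q.2‖ ≤ ‖q₀.2‖ + 1 := by
    have h2 : dist q.2 q₀.2 ≤ dist q q₀ := le_max_right _ _
    have h3 := norm_le_norm_add_norm_sub' q.2 q₀.2
    rw [dist_eq_norm] at h2
    rw [Metric.mem_ball] at hq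
    linarith
  gcongr

/-- Each of the two blocks is bounded through the coordinate expansion of its argument. It turns
bounds for partial derivatives into the bound of the total derivative that differentiation under the
integral needs. -/
theorem clm_prod_norm_le (L : (RSpace n × RSpace n) →L[ℝ] ℂ) {B : ℝ} (hB : 0 ≤ B)
    (h1 : ∀ j, ‖L (EuclideanSpace.single j 1, 0)‖ ≤ B)
    (h2 : ∀ j, ‖L (0, EuclideanSpace.single j 1)‖ ≤ B) : ‖L‖ ≤ 2 * n * B := by
  have hX : ∀ (K : RSpace n →L[ℝ] ℂ), (∀ j, ‖K (EuclideanSpace.single j 1)‖ ≤ B) →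
      ∀ x, ‖K x‖ ≤ n * B * ‖x‖ := by
    intro K hK x
    conv_lhs => rw [← (EuclideanSpace.basisFun (Fin n) ℝ).sum_repr x]
    rw [map_sum]
    refine (norm_sum_le _ _).trans ((Finset.sum_le_sum fun j _ => ?_).trans
      (le_of_eq (?_ : ∑ _j : Fin n, B * ‖x‖ = _)))
    · rw [map_smul, norm_smul, mul_comm]
      refine mul_le_mul ?_ ?_ (norm_nonneg _) hB
      · simpa using hK j
      · simpa using norm_coord_le x j
    · simp; ring
  refine L.opNorm_le_bound (by positivity) fun y => ?_
  have e : L y = (L.comp (ContinuousLinearMap.inl ℝ _ _)) y.1 +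
      (L.comp (ContinuousLinearMap.inr ℝ _ _)) y.2 := by
    simp only [ContinuousLinearMap.comp_apply, ContinuousLinearMap.inl_apply,
      ContinuousLinearMap.inr_apply]
    rw [← map_add]
    simp
  rw [e]
  have k1 := hX (L.comp (ContinuousLinearMap.inl ℝ _ _)) (by simpa using h1) y.1
  have k2 := hX (L.comp (ContinuousLinearMap.inr ℝ _ _)) (by simpa using h2) y.2
  have k3 : ‖y.1‖ ≤ ‖y‖ := norm_fst_le y
  have k4 : ‖y.2‖ ≤ ‖y‖ := norm_snd_le y
  have hn : (0 : ℝ) ≤ n * B := by positivity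
  refine (norm_add_le _ _).trans ?_
  nlinarith [mul_le_mul_of_nonneg_left k3 hn, mul_le_mul_of_nonneg_left k4 hn]

theorem hasLineDerivAt_expi_general (x ζ v : RSpace n) :
    HasLineDerivAt ℝ (fun y => expi y ζ) (Complex.I * ((inner ℝ v ζ : ℝ) : ℂ) * expi x ζ) x v := by
  unfold HasLineDerivAt expi
  have h : ∀ t : ℝ, (inner ℝ (x + t • v) ζ : ℝ) = inner ℝ x ζ + t * inner ℝ v ζ := by
    intro t
    rw [inner_add_left, real_inner_smul_left]
  simp_rw [h]
  have h1 : HasDerivAt (fun t : ℝ => (inner ℝ x ζ : ℝ) + t * inner ℝ v ζ) (inner ℝ v ζ) 0 := by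
    simpa using ((hasDerivAt_id (0 : ℝ)).mul_const (inner ℝ v ζ : ℝ)).const_add (inner ℝ x ζ : ℝ)
  have h2 := (h1.ofReal_comp.const_mul Complex.I).cexp
  rw [mul_comm, zero_mul, add_zero] at h2
  exact h2

theorem fderiv_expi_fst (η : RSpace n) (q v : RSpace n × RSpace n) :
    fderiv ℝ (fun q : RSpace n × RSpace n => expi q.1 η) q v =
      Complex.I * ((inner ℝ v.1 η : ℝ) : ℂ) * expi q.1 η := by
  have he : Differentiable ℝ (fun q : RSpace n × RSpace n => expi q.1 η) :=
    ((contDiff_expi (k := 1)).comp (contDiff_fst.prodMk contDiff_const)).differentiable (by simp)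
  have h1 : HasLineDerivAt ℝ (fun q : RSpace n × RSpace n => expi q.1 η) _ q v :=
    (he q).hasFDerivAt.hasLineDerivAt v
  have h2 : HasLineDerivAt ℝ (fun q : RSpace n × RSpace n => expi q.1 η)
      (Complex.I * ((inner ℝ v.1 η : ℝ) : ℂ) * expi q.1 η) q v :=
    hasLineDerivAt_expi_general q.1 η v.1
  exact HasDerivAt.unique h1 h2

theorem fderiv_symbol_slice (hσ : IsBiSymbol m ρ δ σ) (η : RSpace n) :
    Differentiable ℝ (fun q : RSpace n × RSpace n => σ q.1 q.2 η) ∧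
    ∀ q v, fderiv ℝ (fun q : RSpace n × RSpace n => σ q.1 q.2 η) q v =
      symDir (v.1, v.2, 0) σ q.1 q.2 η := by
  let ι : (RSpace n × RSpace n) →L[ℝ] RSpace n × RSpace n × RSpace n :=
    (ContinuousLinearMap.fst ℝ _ _).prod ((ContinuousLinearMap.snd ℝ _ _).prod 0)
  have hι : (fun q : RSpace n × RSpace n => σ q.1 q.2 η) = fun q => unc σ ((0, 0, η) + ι q) := by
    funext q
    simp [ι, unc]
  have hd1 : Differentiable ℝ (unc σ) := hσ.smooth_unc.differentiable (by simp)
  refine ⟨?_, fun q v => ?_⟩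
  · rw [hι]
    exact hd1.comp (ι.differentiable.const_add _)
  · have := congrFun (dirD_comp_affine ι (0, 0, η) v hd1) q
    rw [hι]
    refine this.trans ?_
    simp [ι, symDir]

theorem fderiv_frozenIntegrand (hσ : IsBiSymbol m ρ δ σ) (g : RSpace n → ℂ) (η : RSpace n)
    (q : RSpace n × RSpace n) :
    DifferentiableAt ℝ (fun q : RSpace n × RSpace n => frozenIntegrand σ g q.1 q.2 η) q ∧
    ∀ v : RSpace n × RSpace n,
      fderiv ℝ (fun q : RSpace n × RSpace n => frozenIntegrand σ g q.1 q.2 η) q v =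
        frozenIntegrand (symDir (v.1, v.2, 0) σ) g q.1 q.2 η +
          σ q.1 q.2 η * (Complex.I * ((inner ℝ v.1 η : ℝ) : ℂ) * fourierHat g η) * expi q.1 η := by
  obtain ⟨hs1, hv⟩ := fderiv_symbol_slice hσ η
  have he : Differentiable ℝ (fun q : RSpace n × RSpace n => expi q.1 η) :=
    ((contDiff_expi (k := 1)).comp (contDiff_fst.prodMk contDiff_const)).differentiable (by simp)
  have hmul : (fun q : RSpace n × RSpace n => frozenIntegrand σ g q.1 q.2 η) =
      fun q : RSpace n × RSpace n => (σ q.1 q.2 η * fourierHat g η) * expi q.1 η := rfl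
  have hs2 : Differentiable ℝ (fun q : RSpace n × RSpace n => σ q.1 q.2 η * fourierHat g η) :=
    hs1.mul_const _
  refine ⟨(hs2.mul he) q, fun v => ?_⟩
  rw [hmul, fderiv_fun_mul (hs2 q) (he q), fderiv_mul_const (hs1 q)]
  simp only [add_apply, smul_apply, smul_eq_mul, hv, frozenIntegrand, fderiv_expi_fst]
  ring

/-- Differentiation of the frozen symbol under the integral sign. -/
theorem hasFDerivAt_frozenSymbol {p : ℕ} (hδ : δ ≤ 1) (hρ : 0 ≤ ρ) (hσ : IsBiSymbol m ρ δ σ)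
    {κ : ℝ} (h : m ≤ κ) (hκ : 0 ≤ κ) (hp : n + κ + 1 < p) {g : RSpace n → ℂ}
    (hg : ContDiff ℝ p g) (hs : HasCompactSupport g) (q₀ : RSpace n × RSpace n) :
    DifferentiableAt ℝ (fun q : RSpace n × RSpace n => frozenSymbol σ g q.1 q.2) q₀ ∧
    (∀ j, fderiv ℝ (fun q : RSpace n × RSpace n => frozenSymbol σ g q.1 q.2) q₀
        (EuclideanSpace.single j 1, 0) = frozenSymbol (symDir (eX j) σ) g q₀.1 q₀.2 +
          frozenSymbol σ (partialD j g) q₀.1 q₀.2) ∧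
    ∀ j, fderiv ℝ (fun q : RSpace n × RSpace n => frozenSymbol σ g q.1 q.2) q₀
        (0, EuclideanSpace.single j 1) = frozenSymbol (symDir (eXi j) σ) g q₀.1 q₀.2 := by
  -- One derivative of `g` is set aside for the term in which `e^{i x·η}` is differentiated.
  obtain ⟨p, rfl⟩ : ∃ p', p = p' + 1 := ⟨p - 1, by
    have : (0 : ℝ) < p := by have : (0 : ℝ) ≤ n := Nat.cast_nonneg n; linarith
    have : 0 < p := by exact_mod_cast this
    omega⟩
  have hg1 : ContDiff ℝ 1 g := hg.of_le (by norm_cast; omega)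
  have hdg : ∀ j, ContDiff ℝ p (partialD j g) := fun j => partialD_contDiff j hg
  have hds : ∀ j, HasCompactSupport (partialD j g) := fun j => partialD_hasCompactSupport j hs
  push_cast at hp
  -- The factor `i η_j` from the derivative of `e^{i x·η}` is absorbed into the transform of `∂_j
  -- g`.
  have e1 : ∀ (j : Fin n) (q : RSpace n × RSpace n) (η : RSpace n), σ q.1 q.2 η * (Complex.I * (η j : ℂ) * fourierHat g η) * expi q.1 η =
      frozenIntegrand σ (partialD j g) q.1 q.2 η := by
    intro j q η
    rw [frozenIntegrand, fourierHat_partialD j hg1 hs]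
  have hX : ∀ j, IsBiSymbol (m + δ) ρ δ (symDir (eX j) σ) := hσ.symDir_eX
  have hXi : ∀ j, IsBiSymbol (m - ρ) ρ δ (symDir (eXi j) σ) := hσ.symDir_eXi
  -- The growth exponent rises to `κ + 1` as `δ ≤ 1`, but all `p + 1` derivatives of `g` are
  -- available; all three families then decay in `η` with the same exponent `p - κ`.
  choose C1 hC10 hC1 using fun j =>
    frozenIntegrand_bound (hX j) (κ := κ + 1) (by linarith) (by linarith) hg hs
  choose C2 hC20 hC2 using fun j => frozenIntegrand_bound hσ h hκ (hdg j) (hds j)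
  choose C3 hC30 hC3 using fun j =>
    frozenIntegrand_bound (hXi j) (κ := κ + 1) (by linarith) (by linarith) hg hs
  set K : ℝ := ∑ j, (C1 j + C2 j + C3 j) with hK
  have hKj : ∀ j, C1 j + C2 j + C3 j ≤ K := fun j =>
    Finset.single_le_sum (f := fun j => C1 j + C2 j + C3 j)
      (fun j _ => by have := hC10 j; have := hC20 j; have := hC30 j; positivity)
      (Finset.mem_univ j)
  have hK0 : 0 ≤ K := Finset.sum_nonneg fun j _ => by
    have := hC10 j; have := hC20 j; have := hC30 j; positivity
  -- A bound of `1 + |ξ|` on the unit ball about the base point, so that the dominating function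
  -- depends on `η` alone.
  set R : ℝ := 1 + (‖q₀.2‖ + 1) with hR
  set F' := fun (q : RSpace n × RSpace n) (η : RSpace n) =>
    fderiv ℝ (fun q : RSpace n × RSpace n => frozenIntegrand σ g q.1 q.2 η) q with hF'
  have hdX : ∀ q η j, F' q η (EuclideanSpace.single j 1, 0) =
      frozenIntegrand (symDir (eX j) σ) g q.1 q.2 η +
        frozenIntegrand σ (partialD j g) q.1 q.2 η := by
    intro q η j
    rw [← e1]
    refine ((fderiv_frozenIntegrand hσ g η q).2 (EuclideanSpace.single j 1, 0)).trans ?_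
    simp [eX, EuclideanSpace.inner_single_left]
  have hdXi : ∀ q η j, F' q η (0, EuclideanSpace.single j 1) =
      frozenIntegrand (symDir (eXi j) σ) g q.1 q.2 η := by
    intro q η j
    refine ((fderiv_frozenIntegrand hσ g η q).2 (0, EuclideanSpace.single j 1)).trans ?_
    simp [eXi]
  have hbound : ∀ η, ∀ q ∈ Metric.ball q₀ 1, ‖F' q η‖ ≤
      2 * n * (K * R ^ (κ + 1) * (1 + ‖η‖) ^ (-((p : ℝ) - κ))) := by
    intro η q hq
    have hq2 : 1 + ‖q.2‖ ≤ R := by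
      have h2 : dist q.2 q₀.2 ≤ dist q q₀ := le_max_right _ _
      have h3 := norm_le_norm_add_norm_sub' q.2 q₀.2
      rw [dist_eq_norm] at h2
      rw [Metric.mem_ball] at hq
      linarith
    have hw : (0 : ℝ) ≤ (1 + ‖η‖) ^ (-((p : ℝ) - κ)) := by positivity
    have t0 : 1 ≤ 1 + ‖q.2‖ := by have := norm_nonneg q.2; linarith
    have t1 : (1 + ‖q.2‖) ^ (κ + 1) ≤ R ^ (κ + 1) :=
      Real.rpow_le_rpow (by linarith) hq2 (by linarith)
    have t2 : (1 + ‖q.2‖) ^ κ ≤ R ^ (κ + 1) :=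
      (Real.rpow_le_rpow_of_exponent_le t0 (by linarith)).trans t1
    have t3 : -(((p + 1 : ℕ) : ℝ) - (κ + 1)) = -((p : ℝ) - κ) := by push_cast; ring
    have b1 : ∀ j, ‖frozenIntegrand (symDir (eX j) σ) g q.1 q.2 η‖ ≤
        C1 j * (R ^ (κ + 1) * (1 + ‖η‖) ^ (-((p : ℝ) - κ))) := by
      intro j
      refine (hC1 j q.1 q.2 η).trans ?_
      rw [t3, mul_assoc]
      have := hC10 j
      gcongr
    have b2 : ∀ j, ‖frozenIntegrand σ (partialD j g) q.1 q.2 η‖ ≤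
        C2 j * (R ^ (κ + 1) * (1 + ‖η‖) ^ (-((p : ℝ) - κ))) := by
      intro j
      refine (hC2 j q.1 q.2 η).trans ?_
      rw [mul_assoc]
      have := hC20 j
      gcongr
    have b3 : ∀ j, ‖frozenIntegrand (symDir (eXi j) σ) g q.1 q.2 η‖ ≤
        C3 j * (R ^ (κ + 1) * (1 + ‖η‖) ^ (-((p : ℝ) - κ))) := by
      intro j
      refine (hC3 j q.1 q.2 η).trans ?_
      rw [t3, mul_assoc]
      have := hC30 j
      gcongr
    set Y := R ^ (κ + 1) * (1 + ‖η‖) ^ (-((p : ℝ) - κ)) with hY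
    have hY0 : 0 ≤ Y := by positivity
    have hd1 := hdX q η
    have hd2 := hdXi q η
    refine clm_prod_norm_le _ (by positivity) (fun j => ?_) fun j => ?_
    · rw [hd1, mul_assoc]
      refine (norm_add_le _ _).trans ((add_le_add (b1 j) (b2 j)).trans ?_)
      rw [← add_mul]
      exact mul_le_mul_of_nonneg_right (by have := hC30 j; linarith [hKj j]) hY0
    · rw [hd2, mul_assoc]
      refine (b3 j).trans ?_
      exact mul_le_mul_of_nonneg_right
        (by have := hC10 j; have := hC20 j; linarith [hKj j]) hY0
  have hmeas : AEStronglyMeasurable (F' q₀) volume := by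
    refine Continuous.aestronglyMeasurable (continuous_clm_apply.mpr fun v => ?_)
    simp only [hF', (fderiv_frozenIntegrand hσ g _ q₀).2]
    have hgh := continuous_fourierHat (hg.continuous.integrable_of_hasCompactSupport hs)
    have c1 : Continuous fun η => σ q₀.1 q₀.2 η :=
      hσ.continuous_comp continuous_const continuous_const continuous_id
    have c2 : Continuous fun η => symDir (v.1, v.2, 0) σ q₀.1 q₀.2 η :=
      (symDir_smooth (v.1, v.2, 0) hσ.smooth_unc).continuous.comp
        (continuous_const.prodMk (continuous_const.prodMk continuous_id))
    unfold frozenIntegrand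
    fun_prop
  have hr : ((Module.finrank ℝ (RSpace n) : ℕ) : ℝ) < p - κ := by simp; linarith
  have m1 : ∀ᶠ q : RSpace n × RSpace n in nhds q₀,
      AEStronglyMeasurable (fun η => frozenIntegrand σ g q.1 q.2 η) volume :=
    Filter.Eventually.of_forall fun q => (integrable_frozenIntegrand hσ h hκ
      (by push_cast; linarith) hg hs q.1 q.2).aestronglyMeasurable
  have m2 : ∀ᵐ η, ∀ q ∈ Metric.ball q₀ 1, HasFDerivAt
      (fun q : RSpace n × RSpace n => frozenIntegrand σ g q.1 q.2 η) (F' q η) q :=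
    Filter.Eventually.of_forall fun η q _ => (fderiv_frozenIntegrand hσ g η q).1.hasFDerivAt
  have main := hasFDerivAt_integral_of_dominated_of_fderiv_le (Metric.ball_mem_nhds q₀ one_pos) m1
    (integrable_frozenIntegrand hσ h hκ (by push_cast; linarith) hg hs q₀.1 q₀.2) hmeas
    (Filter.Eventually.of_forall hbound)
    (((integrable_one_add_norm hr).const_mul _).const_mul _) m2
  have hFi : Integrable (F' q₀) := (((integrable_one_add_norm hr).const_mul _).const_mul _).mono'
    hmeas (Filter.Eventually.of_forall fun η => hbound η q₀ (Metric.mem_ball_self one_pos))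
  have main' : HasFDerivAt (fun q : RSpace n × RSpace n => frozenSymbol σ g q.1 q.2)
    (∫ η, F' q₀ η) q₀ := main
  refine ⟨main'.differentiableAt, fun j => ?_, fun j => ?_⟩
  · rw [main'.fderiv, ContinuousLinearMap.integral_apply hFi]
    simp only [hdX]
    exact integral_add (integrable_frozenIntegrand (hX j) (κ := κ + 1) (by linarith)
      (by linarith) (by push_cast; linarith) hg hs _ _)
      (integrable_frozenIntegrand hσ h hκ (by linarith) (hdg j) (hds j) _ _)
  · rw [main'.fderiv, ContinuousLinearMap.integral_apply hFi]
    simp only [hdXi]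
    rfl

end Frozen

/-! ### Smoothness, Leibniz rule and bounds for the frozen symbol -/

section FrozenRegularity

variable {n : ℕ} {m ρ δ : ℝ} {σ : RSpace n → RSpace n → RSpace n → ℂ}

theorem mulD_comm {E : Type*} [NormedAddCommGroup E] [NormedSpace ℝ E] (v w : Fin n → E)
    (α β : Fin n → ℕ) {F : E → ℂ} (hF : ContDiff ℝ ∞ F) :
    mulD v α (mulD w β F) = mulD w β (mulD v α F) := by
  induction hk : order β generalizing β F with
  | zero =>
    have : β = 0 := by
      funext i
      simpa using (Finset.sum_eq_zero_iff.mp hk) i (Finset.mem_univ i)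
    rw [this, mulD_zero, mulD_zero]
  | succ k ih =>
    have hβ : β ≠ 0 := by rintro rfl; rw [order_zero] at hk; omega
    obtain ⟨j, β', rfl, hp⟩ := exists_mulD_peel w β hβ
    rw [order_add, order_single] at hk
    rw [hp, hp, ih β' (dirD_smooth _ hF) (by omega), dirD_mulD _ _ _ (hF.smooth_nat _)]

/-- Each partial derivative is again a combination of frozen symbols, in which `κ` has grown by one
or `g` has lost one derivative. The budget `n + κ + k < p` survives either change when `k` drops by
one. -/
theorem contDiff_frozenSymbol (hδ : δ ≤ 1) (hρ : 0 ≤ ρ) (k : ℕ) {m : ℝ}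
    {σ : RSpace n → RSpace n → RSpace n → ℂ} (hσ : IsBiSymbol m ρ δ σ)
    {κ : ℝ} (h : m ≤ κ) (hκ : 0 ≤ κ) {p : ℕ} (hp : n + κ + k < p) {g : RSpace n → ℂ}
    (hg : ContDiff ℝ p g) (hs : HasCompactSupport g) :
    ContDiff ℝ k (fun q : RSpace n × RSpace n => frozenSymbol σ g q.1 q.2) := by
  induction k generalizing m σ κ p g with
  | zero =>
    exact contDiff_zero.mpr (continuous_frozenSymbol hσ h hκ (by simpa using hp) hg hs)
  | succ k ih =>
    push_cast at hp
    have hk : (0 : ℝ) ≤ k := Nat.cast_nonneg k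
    have hn : (0 : ℝ) ≤ n := Nat.cast_nonneg n
    have hD := hasFDerivAt_frozenSymbol hδ hρ hσ h hκ (by linarith) hg hs
    obtain ⟨p, rfl⟩ : ∃ p', p = p' + 1 := ⟨p - 1, by
      have : (0 : ℝ) < p := by linarith
      have : 0 < p := by exact_mod_cast this
      omega⟩
    push_cast at hp
    have e : ((k + 1 : ℕ) : WithTop ℕ∞) = (k : WithTop ℕ∞) + 1 := by norm_cast
    rw [e, contDiff_succ_iff_fderiv_apply]
    refine ⟨fun q => (hD q).1, fun h => by simp at h, fun y => ?_⟩
    have hy : ∀ q, fderiv ℝ (fun q : RSpace n × RSpace n => frozenSymbol σ g q.1 q.2) q y =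
        (∑ j, (y.1 j : ℂ) * (frozenSymbol (symDir (eX j) σ) g q.1 q.2 +
          frozenSymbol σ (partialD j g) q.1 q.2)) +
        ∑ j, (y.2 j : ℂ) * frozenSymbol (symDir (eXi j) σ) g q.1 q.2 := by
      intro q
      have hy1 : y = (∑ j, y.1 j • ((EuclideanSpace.single j 1, 0) : RSpace n × RSpace n)) +
          ∑ j, y.2 j • ((0, EuclideanSpace.single j 1) : RSpace n × RSpace n) := by
        have hb := fun z : RSpace n => (EuclideanSpace.basisFun (Fin n) ℝ).sum_repr z
        simp only [EuclideanSpace.basisFun_repr, EuclideanSpace.basisFun_apply] at hb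
        refine Prod.ext ?_ ?_
        · simp [Prod.fst_sum, hb]
        · simp [Prod.snd_sum, hb]
      conv_lhs => rw [hy1]
      rw [map_add, map_sum, map_sum]
      simp only [map_smul, (hD q).2.1, (hD q).2.2, Complex.real_smul]
    simp only [hy]
    refine ContDiff.add (ContDiff.sum fun j _ => contDiff_const.mul (ContDiff.add ?_ ?_))
      (ContDiff.sum fun j _ => contDiff_const.mul ?_)
    · exact ih (hσ.symDir_eX j) (κ := κ + 1) (by linarith) (by linarith)
        (by push_cast; linarith) hg hs
    · exact ih hσ h hκ (by linarith) (partialD_contDiff j hg) (partialD_hasCompactSupport j hs)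
    · exact ih (hσ.symDir_eXi j) (κ := κ) (by linarith) hκ (by push_cast; linarith) hg hs

theorem partialD_frozenSymbol_x {p : ℕ} (hδ : δ ≤ 1) (hρ : 0 ≤ ρ) (hσ : IsBiSymbol m ρ δ σ)
    {κ : ℝ} (h : m ≤ κ) (hκ : 0 ≤ κ) (hp : n + κ + 1 < p) {g : RSpace n → ℂ}
    (hg : ContDiff ℝ p g) (hs : HasCompactSupport g) (j : Fin n) (ξ : RSpace n) :
    partialD j (fun x => frozenSymbol σ g x ξ) =
      (fun x => frozenSymbol (symDir (eX j) σ) g x ξ) +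
        fun x => frozenSymbol σ (partialD j g) x ξ := by
  funext x
  have hD := hasFDerivAt_frozenSymbol hδ hρ hσ h hκ hp hg hs (x, ξ)
  have h1 := HasFDerivAt.comp (f := fun x : RSpace n => (x, ξ)) x hD.1.hasFDerivAt
    (hasFDerivAt_prodMk_left (𝕜 := ℝ) x ξ)
  unfold partialD
  rw [show (fun x => frozenSymbol σ g x ξ) =
    (fun q : RSpace n × RSpace n => frozenSymbol σ g q.1 q.2) ∘ fun x => (x, ξ) from rfl, h1.fderiv]
  exact hD.2.1 j

theorem partialD_frozenSymbol_xi {p : ℕ} (hδ : δ ≤ 1) (hρ : 0 ≤ ρ) (hσ : IsBiSymbol m ρ δ σ)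
    {κ : ℝ} (h : m ≤ κ) (hκ : 0 ≤ κ) (hp : n + κ + 1 < p) {g : RSpace n → ℂ}
    (hg : ContDiff ℝ p g) (hs : HasCompactSupport g) (j : Fin n) (x : RSpace n) :
    Differentiable ℝ (fun ξ => frozenSymbol σ g x ξ) ∧
    partialD j (fun ξ => frozenSymbol σ g x ξ) =
      fun ξ => frozenSymbol (symDir (eXi j) σ) g x ξ := by
  have hD := fun ξ => hasFDerivAt_frozenSymbol hδ hρ hσ h hκ hp hg hs (x, ξ)
  have h1 := fun ξ => (hD ξ).1.hasFDerivAt.comp ξ (hasFDerivAt_prodMk_right x ξ)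
  refine ⟨fun ξ => (h1 ξ).differentiableAt, ?_⟩
  funext ξ
  unfold partialD
  rw [show (fun ξ => frozenSymbol σ g x ξ) =
    (fun q : RSpace n × RSpace n => frozenSymbol σ g q.1 q.2) ∘ fun ξ => (x, ξ) from rfl,
    (h1 ξ).fderiv]
  exact (hD ξ).2.2 j

/-- Derivatives in `ξ` fall on `σ` only and do not raise its order, since `ρ ≥ 0`. They use none of
the regularity of `g`, hence any number is allowed. -/
theorem contDiff_frozenSymbol_xi {p : ℕ} (hδ : δ ≤ 1) (hρ : 0 ≤ ρ) (k : ℕ) {m : ℝ}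
    {σ : RSpace n → RSpace n → RSpace n → ℂ} (hσ : IsBiSymbol m ρ δ σ)
    {κ : ℝ} (h : m ≤ κ) (hκ : 0 ≤ κ) (hp : n + κ + 1 < p) {g : RSpace n → ℂ}
    (hg : ContDiff ℝ p g) (hs : HasCompactSupport g) (x : RSpace n) :
    ContDiff ℝ k (fun ξ => frozenSymbol σ g x ξ) := by
  induction k generalizing m σ with
  | zero =>
    exact contDiff_zero.mpr ((continuous_frozenSymbol hσ h hκ (by linarith) hg hs).comp
      (by fun_prop : Continuous fun ξ : RSpace n => (x, ξ)))
  | succ k ih =>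
    have e : ((k + 1 : ℕ) : WithTop ℕ∞) = (k : WithTop ℕ∞) + 1 := by norm_cast
    rw [e, contDiff_succ_iff_fderiv_apply]
    have hd : Differentiable ℝ (fun ξ => frozenSymbol σ g x ξ) := by
      have hD := fun ξ => hasFDerivAt_frozenSymbol hδ hρ hσ h hκ hp hg hs (x, ξ)
      exact fun ξ => ((hD ξ).1.hasFDerivAt.comp ξ (hasFDerivAt_prodMk_right x ξ)).differentiableAt
    refine ⟨hd, fun h => by simp at h, fun y => ?_⟩
    have hy : ∀ ξ, fderiv ℝ (fun ξ => frozenSymbol σ g x ξ) ξ y =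
        ∑ j, (y j : ℂ) * frozenSymbol (symDir (eXi j) σ) g x ξ := by
      intro ξ
      have hb := (EuclideanSpace.basisFun (Fin n) ℝ).sum_repr y
      simp only [EuclideanSpace.basisFun_repr, EuclideanSpace.basisFun_apply] at hb
      conv_lhs => rw [← hb]
      rw [map_sum]
      refine Finset.sum_congr rfl fun j _ => ?_
      rw [map_smul, Complex.real_smul]
      congr 1
      exact congrFun (partialD_frozenSymbol_xi hδ hρ hσ h hκ hp hg hs j x).2 ξ
    simp only [hy]
    exact ContDiff.sum fun j _ => contDiff_const.mul
      (ih (hσ.symDir_eXi j) (by linarith))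

/-- The symbol `∂_ξ^β σ`. -/
def xiD (β : Fin n → ℕ) (σ : RSpace n → RSpace n → RSpace n → ℂ) :
    RSpace n → RSpace n → RSpace n → ℂ := fun x ξ η => mulD eXi β (unc σ) (x, ξ, η)

theorem unc_xiD (β : Fin n → ℕ) (σ : RSpace n → RSpace n → RSpace n → ℂ) :
    unc (xiD β σ) = mulD eXi β (unc σ) := rfl

theorem xiD_zero (σ : RSpace n → RSpace n → RSpace n → ℂ) : xiD 0 σ = σ := by
  unfold xiD
  simp only [mulD_zero]
  rfl

theorem xiD_add_single (β : Fin n → ℕ) (j : Fin n) (hσ : ContDiff ℝ ∞ (unc σ)) :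
    xiD (β + Pi.single j 1) σ = xiD β (symDir (eXi j) σ) := by
  unfold xiD
  rw [mulD_add_single _ _ _ (hσ.smooth_nat _), unc_symDir]

theorem bisymD_xiD (μ β γ : Fin n → ℕ) (hσ : ContDiff ℝ ∞ (unc σ)) (x ξ η : RSpace n) :
    bisymD μ 0 γ (xiD β σ) x ξ η = bisymD μ β γ σ x ξ η := by
  rw [bisymD_eq _ _ _ (by rw [unc_xiD]; exact mulD_smooth _ _ hσ), bisymD_eq _ _ _ hσ, mulD_zero,
    unc_xiD, mulD_comm _ _ _ _ hσ]

theorem multiD_zero_order {β : Fin n → ℕ} (h : order β = 0) : β = 0 := by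
  funext i
  simpa using (Finset.sum_eq_zero_iff.mp h) i (Finset.mem_univ i)

theorem IsBiSymbol.xiD (β : Fin n → ℕ) (hσ : IsBiSymbol m ρ δ σ) :
    IsBiSymbol (m - ρ * order β) ρ δ (xiD β σ) := by
  induction hk : order β generalizing β σ m with
  | zero =>
    rw [multiD_zero_order hk, xiD_zero]
    simpa using hσ
  | succ k ih =>
    have hβ : β ≠ 0 := by rintro rfl; rw [order_zero] at hk; omega
    obtain ⟨j, β', rfl, hp⟩ := exists_mulD_peel (eXi (n := n)) β hβ
    rw [order_add, order_single] at hk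
    rw [xiD_add_single _ _ hσ.smooth_unc]
    have := ih β' (hσ.symDir_eXi j) (by omega)
    refine this.mono (le_of_eq ?_)
    push_cast
    ring

theorem multiD_frozenSymbol_xi {p : ℕ} (hδ : δ ≤ 1) (hρ : 0 ≤ ρ) (β : Fin n → ℕ)
    (hσ : IsBiSymbol m ρ δ σ)
    {κ : ℝ} (h : m ≤ κ) (hκ : 0 ≤ κ) (hp : n + κ + 1 < p) {g : RSpace n → ℂ}
    (hg : ContDiff ℝ p g) (hs : HasCompactSupport g) (x ξ : RSpace n) :
    multiD β (fun ξ' => frozenSymbol σ g x ξ') ξ = frozenSymbol (_root_.xiD β σ) g x ξ := by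
  induction hk : order β generalizing β σ m with
  | zero => rw [multiD_zero_order hk, xiD_zero, multiD_zero]
  | succ k ih =>
    have hβ : β ≠ 0 := by rintro rfl; rw [order_zero] at hk; omega
    obtain ⟨j, β', rfl, hpe⟩ :=
      exists_mulD_peel (fun i : Fin n => (EuclideanSpace.single i 1 : RSpace n)) β hβ
    rw [order_add, order_single] at hk
    rw [xiD_add_single _ _ hσ.smooth_unc, multiD_eq_mulD, hpe, ← partialD_eq_dirD,
      (partialD_frozenSymbol_xi hδ hρ hσ h hκ hp hg hs j x).2, ← multiD_eq_mulD]
    exact ih β' (hσ.symDir_eXi j) (by linarith) (by omega)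

/-- One derivative in `x` falls on `σ` or on `e^{i x·η}`, and in the second case passes to `g`.
Additivity of the remaining `r` derivatives needs both summands to be `C^r`, which
`contDiff_frozenSymbol` supplies. -/
theorem multiD_frozenSymbol_succ {p : ℕ} (hδ : δ ≤ 1) (hρ : 0 ≤ ρ) (hσ : IsBiSymbol m ρ δ σ)
    {κ : ℝ} (h : m ≤ κ) (hκ : 0 ≤ κ) {g : RSpace n → ℂ}
    (hg : ContDiff ℝ (p + 1 : ℕ) g) (hs : HasCompactSupport g) {α : Fin n → ℕ} {r : ℕ}
    (hα : order α = r + 1) (hp : n + κ + r < p) :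
    ∃ (j : Fin n) (α' : Fin n → ℕ), order α' = r ∧ ∀ x ξ,
      multiD α (fun x => frozenSymbol σ g x ξ) x =
        multiD α' (fun x => frozenSymbol (symDir (eX j) σ) g x ξ) x +
        multiD α' (fun x => frozenSymbol σ (partialD j g) x ξ) x := by
  have hα0 : α ≠ 0 := by rintro rfl; rw [order_zero] at hα; omega
  have hr : (0 : ℝ) ≤ r := Nat.cast_nonneg r
  obtain ⟨j, α', rfl, hpe⟩ :=
    exists_mulD_peel (fun i : Fin n => (EuclideanSpace.single i 1 : RSpace n)) α hα0
  rw [order_add, order_single] at hα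
  have hα' : order α' = r := by omega
  refine ⟨j, α', hα', fun x ξ => ?_⟩
  rw [multiD_eq_mulD, hpe, ← partialD_eq_dirD, ← multiD_eq_mulD,
    partialD_frozenSymbol_x hδ hρ hσ h hκ (by push_cast; linarith) hg hs]
  have hx : Continuous fun x : RSpace n => (x, ξ) := by fun_prop
  have c1 := contDiff_frozenSymbol hδ hρ r (hσ.symDir_eX j) (κ := κ + 1) (by linarith)
    (by linarith) (by push_cast; linarith) hg hs
  have c2 := contDiff_frozenSymbol hδ hρ r hσ h hκ (by linarith)
    (partialD_contDiff j hg) (partialD_hasCompactSupport j hs)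
  rw [(goodOp_multiD α').2.1 _ _]
  · rfl
  · rw [hα']; exact c1.comp (contDiff_id.prodMk contDiff_const)
  · rw [hα']; exact c2.comp (contDiff_id.prodMk contDiff_const)

theorem continuous_multiD_frozenSymbol (hδ : δ ≤ 1) (hρ : 0 ≤ ρ) (r : ℕ) {m : ℝ}
    {σ : RSpace n → RSpace n → RSpace n → ℂ} (hσ : IsBiSymbol m ρ δ σ)
    {κ : ℝ} (h : m ≤ κ) (hκ : 0 ≤ κ) {p : ℕ} (hp : n + κ + r < p) {g : RSpace n → ℂ}
    (hg : ContDiff ℝ p g) (hs : HasCompactSupport g) {α : Fin n → ℕ} (hα : order α = r) :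
    Continuous (fun q : RSpace n × RSpace n =>
      multiD α (fun x => frozenSymbol σ g x q.2) q.1) := by
  induction r generalizing m σ κ p g α with
  | zero =>
    rw [multiD_zero_order hα]
    simp only [multiD_zero]
    exact continuous_frozenSymbol hσ h hκ (by simpa using hp) hg hs
  | succ r ih =>
    push_cast at hp
    have hr : (0 : ℝ) ≤ r := Nat.cast_nonneg r
    have hn : (0 : ℝ) ≤ n := Nat.cast_nonneg n
    obtain ⟨p, rfl⟩ : ∃ p', p = p' + 1 := ⟨p - 1, by
      have : (0 : ℝ) < p := by linarith
      have : 0 < p := by exact_mod_cast this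
      omega⟩
    push_cast at hp
    obtain ⟨j, α', hα', hF⟩ := multiD_frozenSymbol_succ hδ hρ hσ h hκ hg hs hα (by linarith)
    simp only [hF]
    exact (ih (hσ.symDir_eX j) (κ := κ + 1) (by linarith) (by linarith)
      (by push_cast; linarith) hg hs hα').add (ih hσ h hκ (by linarith) (partialD_contDiff j hg)
        (partialD_hasCompactSupport j hs) hα')

/-- Bounds for the derivatives of a symbol of order at most `r` in `x` and at most `q` in the
second frequency variable; `d` and `b` count derivatives that have been taken already. -/
def BoundX (ρ δ : ℝ) (r q : ℕ) (A : ℝ) (d b : ℕ)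
    (τ : RSpace n → RSpace n → RSpace n → ℂ) : Prop :=
  ∀ μ γ : Fin n → ℕ, order μ ≤ r → order γ ≤ q → ∀ x ξ η, ‖bisymD μ 0 γ τ x ξ η‖ ≤
    A * (1 + ‖ξ‖ + ‖η‖) ^ (δ * (d + order μ : ℝ) - ρ * (b + order γ : ℝ))

theorem BoundX.symDir_eX {r q d b : ℕ} {A : ℝ} (hσ : ContDiff ℝ ∞ (unc σ))
    (h : BoundX ρ δ (r + 1) q A d b σ) (j : Fin n) :
    BoundX ρ δ r q A (d + 1) b (symDir (eX j) σ) := by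
  intro μ γ hμ hγ x ξ η
  have := h (μ + Pi.single j 1) γ (by rw [order_add, order_single]; omega) hγ x ξ η
  rw [bisymD_symDir_eX _ _ _ _ hσ]
  refine this.trans_eq ?_
  rw [order_add, order_single]
  push_cast
  ring_nf

theorem BoundX.mono {r r' q d b : ℕ} {A : ℝ} (h : BoundX ρ δ r q A d b σ) (hr : r' ≤ r) :
    BoundX ρ δ r' q A d b σ := fun μ γ hμ hγ => h μ γ (hμ.trans hr) hγ

theorem bisymD_eta_single (hσ : ContDiff ℝ ∞ (unc σ)) (j : Fin n) (i : ℕ) (x ξ η : RSpace n) :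
    (partialD j)^[i] (fun η' => σ x ξ η') η = bisymD 0 0 (Pi.single j i) σ x ξ η := by
  unfold bisymD
  rw [multiD_zero, multiD_zero, multiD_eq_mulD, mulD_single]
  · rfl
  · have : ContDiff ℝ ∞ (fun η' => unc σ (x, ξ, η')) :=
      hσ.comp (contDiff_const.prodMk (contDiff_const.prodMk contDiff_id))
    exact this.smooth_nat i

theorem contDiff_eta_slice (hσ : ContDiff ℝ ∞ (unc σ)) (x ξ : RSpace n) :
    ContDiff ℝ ∞ (fun η => σ x ξ η) :=
  hσ.comp (f := fun η => (x, ξ, η)) (contDiff_const.prodMk (contDiff_const.prodMk contDiff_id))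

theorem norm_iterate_partialD_le {p : ℕ} {g : RSpace n → ℂ} {B : ℝ} (hg : ContDiff ℝ p g)
    (hB : ∀ γ : Fin n → ℕ, order γ ≤ p → ∀ z, ‖multiD γ g z‖ ≤ B) (j : Fin n) {i : ℕ} (hi : i ≤ p)
    (z : RSpace n) : ‖(partialD j)^[i] g z‖ ≤ B := by
  have h1 := hB (Pi.single j i) (by rwa [order_single]) z
  rw [multiD_eq_mulD, mulD_single] at h1
  · exact h1
  · exact hg.of_le (by exact_mod_cast hi)

/-- The estimate of the frozen symbol without derivatives. -/
theorem exists_frozenSymbol_bound (hδ0 : 0 ≤ δ) (hδ : δ ≤ 1) (hρ : 0 ≤ ρ) (M : ℕ) (hM : n < 2 * M)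
    (P : ℕ) : ∃ C : ℝ, 0 ≤ C ∧ ∀ (r d b p : ℕ), p ≤ P → n + 1 + d ≤ p →
      ∀ (A B : ℝ) (τ : RSpace n → RSpace n → RSpace n → ℂ) (g : RSpace n → ℂ),
        0 ≤ A → ContDiff ℝ ∞ (unc τ) → BoundX ρ δ r (2 * M) A d b τ → ContDiff ℝ p g →
        HasCompactSupport g → (∀ γ : Fin n → ℕ, order γ ≤ p → ∀ z, ‖multiD γ g z‖ ≤ B) →
        ∀ x ξ, ‖frozenSymbol τ g x ξ‖ ≤ C * A * B * (1 + ‖ξ‖) ^ (δ * d - ρ * b) := by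
  choose K hK0 hK using locTransform_decay (n := n) M hM
  -- The decay constants for all exponents up to `P` are added, so that one constant serves every `p
  -- ≤ P`; the induction on derivatives changes `p`.
  set K' : ℝ := ∑ i ∈ Finset.range (P + 1), K i with hK'
  have hKK : ∀ i ≤ P, K i ≤ K' := fun i hi =>
    Finset.single_le_sum (fun i _ => hK0 i) (Finset.mem_range.mpr (by omega))
  have hK'0 : 0 ≤ K' := Finset.sum_nonneg fun i _ => hK0 i
  set J : ℝ := ∫ η : RSpace n, (1 + ‖η‖) ^ (-((n : ℝ) + 1)) with hJ
  have hJi : Integrable (fun η : RSpace n => (1 + ‖η‖) ^ (-((n : ℝ) + 1))) :=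
    integrable_one_add_norm (by simp)
  have hJ0 : 0 ≤ J := integral_nonneg fun η => by positivity
  refine ⟨(n + 1) * K' * J, by positivity, fun r d b p hpP hdp A B τ g hA hτ hτb hg hs hB x ξ => ?_⟩
  have hB0 : 0 ≤ B := (norm_nonneg _).trans (hB 0 (by rw [order_zero]; omega) 0)
  have hd0 : 0 ≤ δ * d := by positivity
  have hdd : δ * d ≤ d := mul_le_of_le_one_left (Nat.cast_nonneg d) hδ
  have hnp : (n : ℝ) + 1 + d ≤ p := by exact_mod_cast hdp
  set Y := (1 + ‖ξ‖) ^ (δ * d - ρ * b) with hY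
  have hY0 : 0 ≤ Y := by positivity
  have hγ : ∀ γ : Fin n → ℕ, order γ ≤ 2 * M → ∀ η, ‖bisymD 0 0 γ τ x ξ η‖ ≤
      A * Y * (1 + ‖η‖) ^ (δ * d) := by
    intro γ hγ η
    refine (hτb 0 γ (by rw [order_zero]; omega) hγ x ξ η).trans ?_
    rw [order_zero, mul_assoc]
    refine mul_le_mul_of_nonneg_left ?_ hA
    have h1 : (1 : ℝ) ≤ 1 + ‖ξ‖ + ‖η‖ := by
      have := norm_nonneg ξ; have := norm_nonneg η; linarith
    -- The gain `-ρ|γ|` of the derivatives in `η` is discarded; the rest splits into `(1 + |ξ|)^{δd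
    -- - ρb} (1 + |η|)^{δd}`.
    refine (Real.rpow_le_rpow_of_exponent_le h1 (y := _) (z := δ * d - ρ * b) ?_).trans
      (one_add_add_rpow_sub_le (norm_nonneg _) (norm_nonneg _) hd0 (by positivity))
    have : 0 ≤ ρ * (order γ : ℝ) := by positivity
    push_cast
    linarith
  have ha0 : ∀ η, ‖τ x ξ η‖ ≤ A * Y * (1 + ‖η‖) ^ (δ * d) := by
    intro η
    have := hγ 0 (by rw [order_zero]; omega) η
    rwa [bisymD_zero] at this
  have haj : ∀ j, ∀ i ≤ 2 * M, ∀ η, ‖(partialD j)^[i] (fun η' => τ x ξ η') η‖ ≤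
      A * Y * (1 + ‖η‖) ^ (δ * d) := by
    intro j i hi η
    rw [bisymD_eta_single hτ]
    exact hγ _ (by rwa [order_single]) η
  have key := integral_mul_fourierHat M (κ := δ * d) (by linarith)
    ((contDiff_eta_slice hτ x ξ).smooth_nat _) ⟨_, ha0⟩ (fun j i hi => ⟨_, haj j i hi⟩) hg hs x
  unfold frozenSymbol frozenIntegrand
  rw [key]
  have hloc := hK p g B hg (fun z => by simpa [multiD_zero] using hB 0 (by rw [order_zero]; omega) z)
    (fun j i hi z => norm_iterate_partialD_le hg hB j hi z) x
  calc _ ≤ ∫ η, ((n + 1) * (A * Y)) * (K' * B) * (1 + ‖η‖) ^ (-((n : ℝ) + 1)) := by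
        refine norm_integral_le_of_norm_le (hJi.const_mul _) (Filter.Eventually.of_forall fun η => ?_)
        have hpos : 0 < 1 + ‖η‖ := by positivity
        have h1 : (1 : ℝ) ≤ 1 + ‖η‖ := by have := norm_nonneg η; linarith
        have hs1 : ‖τ x ξ η + ∑ j, (-1) ^ M * (partialD j)^[2 * M] (fun η => τ x ξ η) η‖ ≤
            (n + 1) * (A * Y) * (1 + ‖η‖) ^ (δ * d) := by
          refine (norm_add_le _ _).trans ((add_le_add (ha0 η) ((norm_sum_le _ _).trans
            (Finset.sum_le_sum fun j _ => (?_ : _ ≤ A * Y * (1 + ‖η‖) ^ (δ * d))))).trans ?_)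
          · rw [norm_mul, norm_pow, norm_neg, norm_one, one_pow, one_mul]
            exact haj j _ le_rfl η
          · simp
            linarith
        rw [norm_mul]
        refine (mul_le_mul hs1 ((hloc η).trans (mul_le_mul_of_nonneg_right
          (mul_le_mul_of_nonneg_right (hKK p hpP) hB0) (by positivity))) (norm_nonneg _)
          (by positivity)).trans ?_
        -- Growth `δd ≤ d` against decay `p ≥ n + 1 + d` leaves the integrable exponent `-(n + 1)`.
        have h2 : (1 + ‖η‖) ^ (δ * d) * (1 + ‖η‖) ^ (-(p : ℝ)) ≤ (1 + ‖η‖) ^ (-((n : ℝ) + 1)) := by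
          rw [← Real.rpow_add hpos]
          exact Real.rpow_le_rpow_of_exponent_le h1 (by linarith)
        calc _ = ((n + 1) * (A * Y)) * (K' * B) *
              ((1 + ‖η‖) ^ (δ * d) * (1 + ‖η‖) ^ (-(p : ℝ))) := by ring
          _ ≤ _ := by gcongr
    _ = _ := by
        rw [integral_const_mul]
        ring

/-- The estimate of the derivatives of the frozen symbol. -/
theorem multiD_frozenSymbol_bound (hδ0 : 0 ≤ δ) (hδ : δ ≤ 1) (hρ : 0 ≤ ρ) (M : ℕ) (hM : n < 2 * M)
    (P : ℕ) : ∃ C : ℝ, 0 ≤ C ∧ ∀ (r d b p : ℕ), p ≤ P → n + 1 + d + r ≤ p →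
      ∀ (A B : ℝ) (τ : RSpace n → RSpace n → RSpace n → ℂ) (g : RSpace n → ℂ),
        0 ≤ A → IsBiSymbol (δ * d) ρ δ τ → BoundX ρ δ r (2 * M) A d b τ → ContDiff ℝ p g →
        HasCompactSupport g → (∀ γ : Fin n → ℕ, order γ ≤ p → ∀ z, ‖multiD γ g z‖ ≤ B) →
        ∀ α : Fin n → ℕ, order α = r → ∀ x ξ, ‖multiD α (fun x => frozenSymbol τ g x ξ) x‖ ≤
          2 ^ r * (C * A * B) * (1 + ‖ξ‖) ^ (δ * (d + r) - ρ * b) := by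
  obtain ⟨C, hC0, hC⟩ := exists_frozenSymbol_bound (n := n) hδ0 hδ hρ M hM P
  refine ⟨C, hC0, fun r => ?_⟩
  induction r with
  | zero =>
    intro d b p hpP hdp A B τ g hA hτ hτb hg hs hB α hα x ξ
    rw [multiD_zero_order hα, multiD_zero]
    have := hC 0 d b p hpP hdp A B τ g hA hτ.smooth_unc hτb hg hs hB x ξ
    simpa using this
  | succ r ih =>
    intro d b p hpP hdp A B τ g hA hτ hτb hg hs hB α hα x ξ
    obtain ⟨p, rfl⟩ : ∃ p', p = p' + 1 := ⟨p - 1, by omega⟩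
    have hdd : δ * d ≤ d := mul_le_of_le_one_left (Nat.cast_nonneg d) hδ
    have hnp : (n : ℝ) + 1 + d + r ≤ p := by exact_mod_cast (by omega : n + 1 + d + r ≤ p)
    have hB0 : 0 ≤ B := (norm_nonneg _).trans (hB 0 (by rw [order_zero]; omega) 0)
    obtain ⟨j, α', hα', hF⟩ := multiD_frozenSymbol_succ hδ hρ hτ le_rfl (by positivity) hg hs hα
      (by linarith)
    -- With the derivative on the symbol, `d` grows and `g` is unchanged; with the derivative on
    -- `g`, `d` stays and `p` drops. The second term has the smaller exponent in `1 + |ξ|`, and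
    -- adding the two doubles the constant.
    have h1 := ih (d + 1) b (p + 1) hpP (by omega) A B (symDir (eX j) τ) g hA
      ((hτ.symDir_eX j).mono (by push_cast; linarith)) (hτb.symDir_eX hτ.smooth_unc j) hg hs hB α'
      hα' x ξ
    have h2 := ih d b p (by omega) (by omega) A B τ (partialD j g) hA hτ (hτb.mono (by omega))
      (partialD_contDiff j hg) (partialD_hasCompactSupport j hs) (fun γ hγ z => ?_) α' hα' x ξ
    · rw [hF]
      have h3 : (1 + ‖ξ‖) ^ (δ * (d + r : ℝ) - ρ * b) ≤
          (1 + ‖ξ‖) ^ (δ * (d + (r + 1 : ℕ) : ℝ) - ρ * b) := by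
        refine Real.rpow_le_rpow_of_exponent_le (by have := norm_nonneg ξ; linarith) ?_
        push_cast
        nlinarith
      have h4 : (δ * ((d + 1 : ℕ) + r : ℝ) - ρ * b) = δ * (d + (r + 1 : ℕ) : ℝ) - ρ * b := by
        push_cast; ring
      rw [h4] at h1
      have h5 : 0 ≤ 2 ^ r * (C * A * B) := by positivity
      refine (norm_add_le _ _).trans ((add_le_add h1
        (h2.trans (mul_le_mul_of_nonneg_left h3 h5))).trans (le_of_eq ?_))
      ring
    · have := hB (γ + Pi.single j 1) (by rw [order_add, order_single]; omega) z
      rwa [multiD_eq_mulD, mulD_add_single, ← partialD_eq_dirD, ← multiD_eq_mulD] at this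
      exact hg.of_le (by exact_mod_cast (by omega))

end FrozenRegularity

/-! ### The frozen symbol in the symbol classes, and the seminorm estimate -/

section FrozenMain

variable {n : ℕ} {ρ δ : ℝ} {σ : RSpace n → RSpace n → RSpace n → ℂ}

theorem symD_frozenSymbol {p : ℕ} (hδ : δ ≤ 1) (hρ : 0 ≤ ρ) (hσ : IsBiSymbol 0 ρ δ σ)
    (hp : n + 1 < p) {g : RSpace n → ℂ} (hg : ContDiff ℝ p g) (hs : HasCompactSupport g)
    (α β : Fin n → ℕ) (x ξ : RSpace n) :
    symD α β (frozenSymbol σ g) x ξ = multiD α (fun x => frozenSymbol (xiD β σ) g x ξ) x := by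
  have hp' : (n : ℝ) + 1 < p := by exact_mod_cast hp
  unfold symD
  congr 1
  funext x'
  exact multiD_frozenSymbol_xi hδ hρ β hσ le_rfl le_rfl (by linarith) hg hs x' ξ

theorem IsBiSymbol.xiD_zero_order (hρ : 0 ≤ ρ) (hσ : IsBiSymbol 0 ρ δ σ) (β : Fin n → ℕ) :
    IsBiSymbol 0 ρ δ (_root_.xiD β σ) :=
  (hσ.xiD β).mono (by have : 0 ≤ ρ * (order β : ℝ) := by positivity
                      linarith)

/-- The derivatives in `ξ` are taken first and become part of the symbol. The hypothesis on `A`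
concerns the one multi-index `β`, with `|μ| ≤ |α|` and `|γ| ≤ 2M`, which keeps track of the orders
that the seminorm has to control. -/
theorem symD_frozenSymbol_bound (hδ0 : 0 ≤ δ) (hδ : δ ≤ 1) (hρ : 0 ≤ ρ) (M : ℕ) (hM : n < 2 * M)
    (P : ℕ) : ∃ C : ℝ, 0 ≤ C ∧ ∀ (p : ℕ), p ≤ P → n + 1 < p →
      ∀ (A B : ℝ) (σ : RSpace n → RSpace n → RSpace n → ℂ) (g : RSpace n → ℂ) (α β : Fin n → ℕ),
        0 ≤ A → n + 1 + order α ≤ p → IsBiSymbol 0 ρ δ σ →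
        (∀ μ γ : Fin n → ℕ, order μ ≤ order α → order γ ≤ 2 * M → ∀ x ξ η,
          ‖bisymD μ β γ σ x ξ η‖ ≤
            A * (1 + ‖ξ‖ + ‖η‖) ^ (0 + δ * order μ - ρ * (order β + order γ))) →
        ContDiff ℝ p g → HasCompactSupport g →
        (∀ γ : Fin n → ℕ, order γ ≤ p → ∀ z, ‖multiD γ g z‖ ≤ B) →
        ∀ x ξ, ‖symD α β (frozenSymbol σ g) x ξ‖ ≤
          2 ^ order α * (C * A * B) * (1 + ‖ξ‖) ^ (0 + δ * order α - ρ * order β) := by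
  obtain ⟨C, hC0, hC⟩ := multiD_frozenSymbol_bound (n := n) hδ0 hδ hρ M hM P
  refine ⟨C, hC0, fun p hpP hp A B σ g α β hA hαp hσ hb hg hs hB x ξ => ?_⟩
  rw [symD_frozenSymbol hδ hρ hσ hp hg hs]
  have := hC (order α) 0 (order β) p hpP (by omega) A B (xiD β σ) g hA
    ((hσ.xiD_zero_order hρ β).mono (by simp)) (fun μ γ hμ hγ x ξ η => ?_) hg hs hB α rfl x ξ
  · simpa using this
  · rw [bisymD_xiD _ _ _ hσ.smooth_unc]
    simpa using hb μ γ hμ hγ x ξ η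

theorem IsBiSymbol.exists_common_bound {m : ℝ} (hσ : IsBiSymbol m ρ δ σ) (a b c : ℕ) :
    ∃ A : ℝ, 0 ≤ A ∧ ∀ α β γ : Fin n → ℕ, order α ≤ a → order β ≤ b → order γ ≤ c → ∀ x ξ η,
      ‖bisymD α β γ σ x ξ η‖ ≤
        A * (1 + ‖ξ‖ + ‖η‖) ^ (m + δ * order α - ρ * (order β + order γ)) := by
  have := finite_multiIdx n a
  have := finite_multiIdx n b
  have := finite_multiIdx n c
  choose C hC using fun p : MultiIdx n a × MultiIdx n b × MultiIdx n c =>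
    hσ.bound p.1.1 p.2.1.1 p.2.2.1
  obtain ⟨A, hA⟩ := Set.finite_range C |>.bddAbove
  refine ⟨max A 0, le_max_right _ _, fun α β γ hα hβ hγ x ξ η => ?_⟩
  refine (hC (⟨α, hα⟩, ⟨β, hβ⟩, ⟨γ, hγ⟩) x ξ η).trans ?_
  refine mul_le_mul_of_nonneg_right ((hA ⟨_, rfl⟩).trans (le_max_left _ _)) ?_
  positivity

theorem exists_multiD_bound {p : ℕ} {g : RSpace n → ℂ} (hg : ContDiff ℝ p g)
    (hs : HasCompactSupport g) :
    ∃ B : ℝ, ∀ γ : Fin n → ℕ, order γ ≤ p → ∀ z, ‖multiD γ g z‖ ≤ B :=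
  let G : CcS n p := ⟨g, hg, hs⟩
  ⟨‖G‖, fun γ hγ z => G.le_norm γ hγ z⟩

theorem exists_symD_frozenSymbol_bound (hδ0 : 0 ≤ δ) (hδ : δ ≤ 1) (hρ : 0 ≤ ρ)
    (hσ : IsBiSymbol 0 ρ δ σ) {p : ℕ} (hp : n + 1 < p) {g : RSpace n → ℂ} (hg : ContDiff ℝ p g)
    (hs : HasCompactSupport g) (α β : Fin n → ℕ) (hα : n + 1 + order α ≤ p) :
    ∃ C : ℝ, ∀ x ξ, ‖symD α β (frozenSymbol σ g) x ξ‖ ≤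
      C * (1 + ‖ξ‖) ^ (0 + δ * order α - ρ * order β) := by
  obtain ⟨C, -, hC⟩ := symD_frozenSymbol_bound (n := n) hδ0 hδ hρ (n / 2 + 1) (by omega) p
  obtain ⟨A, hA, hAb⟩ := hσ.exists_common_bound (order α) (order β) (2 * (n / 2 + 1))
  obtain ⟨B, hB⟩ := exists_multiD_bound hg hs
  exact ⟨_, hC p le_rfl hp A B σ g α β hA hα hσ (fun μ γ hμ hγ => hAb μ β γ hμ le_rfl hγ) hg hs hB⟩

theorem isSymbolUpTo_frozenSymbol (hδ0 : 0 ≤ δ) (hδ : δ ≤ 1) (hρ : 0 ≤ ρ)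
    (hσ : IsBiSymbol 0 ρ δ σ) {p k : ℕ} (hp : n + 1 < p) (hk : n + k < p) {g : RSpace n → ℂ}
    (hg : ContDiff ℝ p g) (hs : HasCompactSupport g) :
    IsSymbolUpTo 0 ρ δ k (frozenSymbol σ g) := by
  have hp' : (n : ℝ) + 1 < p := by exact_mod_cast hp
  have hk' : (n : ℝ) + k < p := by exact_mod_cast hk
  refine ⟨fun x => ?_, fun β ξ => ?_, fun α β hα => ?_, fun α β hα => ?_⟩
  · exact contDiff_infty.mpr fun i =>
      contDiff_frozenSymbol_xi hδ hρ i hσ le_rfl le_rfl (by linarith) hg hs x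
  · simp only [multiD_frozenSymbol_xi hδ hρ β hσ le_rfl le_rfl (by linarith : (n : ℝ) + 0 + 1 < p)
      hg hs]
    exact (contDiff_frozenSymbol hδ hρ k (hσ.xiD_zero_order hρ β) le_rfl le_rfl (by linarith)
      hg hs).comp (f := fun x : RSpace n => (x, ξ)) (contDiff_id.prodMk contDiff_const)
  · simp only [symD_frozenSymbol hδ hρ hσ hp hg hs]
    have hα' : (order α : ℝ) ≤ k := by exact_mod_cast hα
    exact continuous_multiD_frozenSymbol hδ hρ (order α) (hσ.xiD_zero_order hρ β) le_rfl le_rfl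
      (by linarith) hg hs rfl
  · exact exists_symD_frozenSymbol_bound hδ0 hδ hρ hσ hp hg hs α β (by omega)

theorem isSymbol_frozenSymbol (hδ0 : 0 ≤ δ) (hδ : δ ≤ 1) (hρ : 0 ≤ ρ)
    (hσ : IsBiSymbol 0 ρ δ σ) {g : RSpace n → ℂ}
    (hg : ContDiff ℝ ∞ g) (hs : HasCompactSupport g) : IsSymbol 0 ρ δ (frozenSymbol σ g) := by
  refine ⟨?_, fun α β => ?_⟩
  · exact contDiff_infty.mpr fun k =>
      contDiff_frozenSymbol hδ hρ k hσ le_rfl le_rfl (p := n + k + 1) (by push_cast; linarith)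
        (contDiff_infty.mp hg _) hs
  -- As `g` is smooth, the number of its derivatives in use may follow `α`.
  · exact exists_symD_frozenSymbol_bound hδ0 hδ hρ hσ (p := n + 2 + order α) (by omega)
      (contDiff_infty.mp hg _) hs α β (by omega)

/-- A real supremum over an unbounded set takes the default value `0`; boundedness makes
`biSymbolNorm` a genuine upper bound. -/
theorem IsBiSymbol.bddAbove (hσ : IsBiSymbol 0 ρ δ σ) (k : ℕ) :
    BddAbove (Set.range fun p : (MultiIdx n k × MultiIdx n k × MultiIdx n k) ×
        (RSpace n × RSpace n × RSpace n) =>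
      ‖bisymD p.1.1.1 p.1.2.1.1 p.1.2.2.1 σ p.2.1 p.2.2.1 p.2.2.2‖ *
        (1 + ‖p.2.2.1‖ + ‖p.2.2.2‖) ^
          (-δ * order p.1.1.1 + ρ * (order p.1.2.1.1 + order p.1.2.2.1))) := by
  obtain ⟨A, hA, hAb⟩ := hσ.exists_common_bound k k k
  refine ⟨A, ?_⟩
  rintro _ ⟨p, rfl⟩
  have hpos : 0 < 1 + ‖p.2.2.1‖ + ‖p.2.2.2‖ := by positivity
  refine (mul_le_mul_of_nonneg_right (hAb _ _ _ p.1.1.2 p.1.2.1.2 p.1.2.2.2 _ _ _)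
    (by positivity)).trans_eq ?_
  rw [mul_assoc, ← Real.rpow_add hpos]
  ring_nf
  simp

theorem IsBiSymbol.norm_bisymD_le (hσ : IsBiSymbol 0 ρ δ σ) {k : ℕ} {α β γ : Fin n → ℕ}
    (hα : order α ≤ k) (hβ : order β ≤ k) (hγ : order γ ≤ k) (x ξ η : RSpace n) :
    ‖bisymD α β γ σ x ξ η‖ ≤ biSymbolNorm ρ δ k σ *
      (1 + ‖ξ‖ + ‖η‖) ^ (0 + δ * order α - ρ * (order β + order γ)) := by
  have hpos : 0 < 1 + ‖ξ‖ + ‖η‖ := by positivity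
  have h := le_ciSup (hσ.bddAbove k) ((⟨α, hα⟩, ⟨β, hβ⟩, ⟨γ, hγ⟩), (x, ξ, η))
  have h2 := mul_le_mul_of_nonneg_right h
    (Real.rpow_nonneg hpos.le (0 + δ * order α - ρ * (order β + order γ)))
  simp only at h2
  rw [mul_assoc, ← Real.rpow_add hpos, show (-δ * (order α : ℝ) + ρ * (order β + order γ) +
    (0 + δ * order α - ρ * (order β + order γ))) = 0 by ring, Real.rpow_zero, mul_one] at h2
  exact h2

theorem biSymbolNorm_nonneg (k : ℕ) : 0 ≤ biSymbolNorm ρ δ k σ :=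
  Real.iSup_nonneg fun _ => by positivity

/-- The order `l` must reach `2M > n` for the integration by parts in `η`, and `k` for the
derivatives in `x` and `ξ` that the seminorm itself contains. -/
theorem exists_symbolNorm_frozenSymbol_le (hδ0 : 0 ≤ δ) (hδ : δ ≤ 1) (hρ : 0 ≤ ρ) (k l s : ℕ)
    (hM : ∃ M, n < 2 * M ∧ 2 * M ≤ l) (hkl : k ≤ l) (hn : n + 1 < s) (hk : n + k < s) :
    ∃ C : ℝ, ∀ σ : RSpace n → RSpace n → RSpace n → ℂ, IsBiSymbol 0 ρ δ σ → ∀ g : CcS n s,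
      symbolNorm ρ δ k (frozenSymbol σ g) ≤ C * biSymbolNorm ρ δ l σ * ‖g‖ := by
  obtain ⟨M, hM, hMl⟩ := hM
  obtain ⟨C, hC0, hC⟩ := symD_frozenSymbol_bound (n := n) hδ0 hδ hρ M hM s
  refine ⟨2 ^ k * C, fun σ hσ g => ?_⟩
  have hg0 := norm_nonneg g
  have hσ0 := biSymbolNorm_nonneg (ρ := ρ) (δ := δ) (σ := σ) l
  refine Real.iSup_le (fun p => ?_) (by positivity)
  obtain ⟨⟨⟨α, hα⟩, ⟨β, hβ⟩⟩, x, ξ⟩ := p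
  simp only
  have hpos : 0 < 1 + ‖ξ‖ := by positivity
  have h1 := hC s le_rfl hn (biSymbolNorm ρ δ l σ) ‖g‖ σ g α β hσ0 (by omega) hσ
    (fun μ γ hμ hγ x ξ η => hσ.norm_bisymD_le (by omega) (by omega) (by omega) x ξ η)
    g.2.1 g.2.2 (fun γ hγ z => g.le_norm γ hγ z) x ξ
  refine (mul_le_mul_of_nonneg_right h1 (by positivity)).trans ?_
  rw [mul_assoc, ← Real.rpow_add hpos, show (0 + δ * (order α : ℝ) - ρ * order β +
    (-δ * order α + ρ * order β)) = 0 by ring, Real.rpow_zero, mul_one]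
  have h2 : (2 : ℝ) ^ order α ≤ 2 ^ k := pow_le_pow_right₀ (by norm_num) hα
  calc _ ≤ 2 ^ k * (C * biSymbolNorm ρ δ l σ * ‖g‖) := by gcongr
    _ = _ := by ring

end FrozenMain

/-- Since `0 < 1 - δ ≤ 1`, the quotient is at least its numerator. This is the integer form in which
derivatives of `g` are counted. -/
theorem add_half_lt_of_lt {n s : ℕ} {δ : ℝ} (hδ : 0 ≤ δ) (hδ1 : δ < 1)
    (hs : (((n / 2 : ℕ) : ℝ) + 1) / (1 - δ) + (n : ℝ) < (s : ℝ)) : n + (n / 2 + 1) < s := by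
  have h1 : (((n / 2 : ℕ) : ℝ) + 1) ≤ (((n / 2 : ℕ) : ℝ) + 1) / (1 - δ) :=
    le_div_self (by positivity) (by linarith) (by linarith)
  have : ((n + (n / 2 + 1) : ℕ) : ℝ) < s := by push_cast; linarith
  exact_mod_cast this

/-! ### Plancherel's theorem in the present normalisation, and duality in `L²` -/

section Plancherel

open FourierTransform

variable {n : ℕ}

theorem lintegral_comp_smul {r : ℝ} (hr : r ≠ 0) (f : RSpace n → ENNReal) :
    ∫⁻ x, f (r • x) = ENNReal.ofReal |(r ^ n)⁻¹| * ∫⁻ x, f x := by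
  have h := Measure.map_addHaar_smul (volume : Measure (RSpace n)) hr
  rw [finrank_euclideanSpace, Fintype.card_fin] at h
  have he : MeasurableEmbedding (fun x : RSpace n => r • x) :=
    (Homeomorph.smulOfNeZero r hr).measurableEmbedding
  rw [← he.lintegral_map, h, lintegral_smul_measure, smul_eq_mul]

theorem ae_eq_of_integral_schwartz_mul {u v : RSpace n → ℂ} (hu : LocallyIntegrable u)
    (hv : LocallyIntegrable v)
    (h : ∀ φ : 𝓢(RSpace n, ℂ), ∫ x, φ x * u x = ∫ x, φ x * v x) : u =ᵐ[volume] v := by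
  refine ae_eq_of_integral_contDiff_smul_eq hu hv fun g hg hgs => ?_
  have hs : HasCompactSupport fun x => (g x : ℂ) := hgs.comp_left (g := Complex.ofReal) (by simp)
  have := h (hs.toSchwartzMap (Complex.ofRealCLM.contDiff.comp hg))
  simp only [Complex.real_smul]
  exact this

theorem osc_eq_fourier (G : RSpace n → ℂ) (x : RSpace n) :
    osc G x = 𝓕 G ((-(2 * Real.pi)⁻¹) • x) := by
  rw [Real.fourier_eq', osc]
  refine integral_congr_ae (Filter.Eventually.of_forall fun ζ => ?_)
  simp only [expi, smul_eq_mul]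
  congr 2
  rw [inner_smul_right, real_inner_comm, mul_comm Complex.I]
  congr 2
  have := Real.pi_ne_zero
  field_simp

theorem integral_fourier_mul_of_integrable {G : RSpace n → ℂ} (hG : Integrable G)
    (φ : 𝓢(RSpace n, ℂ)) : ∫ x, φ x * 𝓕 G x = ∫ x, 𝓕 φ x * G x := by
  have := VectorFourier.integral_fourierIntegral_smul_eq_flip (L := innerₗ (RSpace n))
    Real.continuous_fourierChar (by exact continuous_inner) (φ.integrable (μ := volume)) hG
  rw [flip_innerₗ] at this
  exact this.symm

/-- The `L²` transform and the integral agree when tested against Schwartz functions: the former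
because it is the transform of a tempered distribution, the latter by Fubini. -/
theorem fourier_toLp_ae_eq {G : RSpace n → ℂ} (hG : Integrable G) (hG2 : MemLp G 2) :
    (𝓕 (hG2.toLp G) : LTwo n) =ᵐ[volume] 𝓕 G := by
  refine ae_eq_of_integral_schwartz_mul ?_ ?_ fun φ => ?_
  · exact (Lp.memLp _).locallyIntegrable (by norm_num)
  · exact (VectorFourier.fourierIntegral_continuous Real.continuous_fourierChar
      (by exact continuous_inner) hG).locallyIntegrable
  · have h1 := congrArg (fun T => T φ)
      (Lp.fourier_toTemperedDistribution_eq (hG2.toLp G))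
    simp only [TemperedDistribution.fourier_apply, Lp.toTemperedDistribution_apply,
      smul_eq_mul] at h1
    rw [← h1, integral_fourier_mul_of_integrable hG]
    refine integral_congr_ae ?_
    filter_upwards [hG2.coeFn_toLp] with x hx
    rw [hx]

theorem eLpNorm_two_sq (u : RSpace n → ℂ) : eLpNorm u 2 ^ 2 = ∫⁻ x, ‖u x‖ₑ ^ 2 := by
  have := eLpNorm_nnreal_pow_eq_lintegral (f := u) (μ := volume) (p := 2) (by norm_num)
  simp at this
  exact this

theorem lintegral_fourier_sq {G : RSpace n → ℂ} (hG : Integrable G) (hG2 : MemLp G 2) :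
    ∫⁻ x, ‖𝓕 G x‖ₑ ^ 2 = ∫⁻ x, ‖G x‖ₑ ^ 2 := by
  rw [← eLpNorm_two_sq, ← eLpNorm_two_sq, ← eLpNorm_congr_ae (fourier_toLp_ae_eq hG hG2),
    ← eLpNorm_congr_ae hG2.coeFn_toLp, ← Lp.enorm_def, ← Lp.enorm_def, ← ofReal_norm,
    ← ofReal_norm, Lp.norm_fourier_eq]

/-- Plancherel's theorem. -/
theorem lintegral_osc_sq {G : RSpace n → ℂ} (hG : Integrable G) (hG2 : MemLp G 2) :
    ∫⁻ x, ‖osc G x‖ₑ ^ 2 = ENNReal.ofReal ((2 * Real.pi) ^ n) * ∫⁻ x, ‖G x‖ₑ ^ 2 := by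
  have hpi : (0 : ℝ) < 2 * Real.pi := by positivity
  simp only [osc_eq_fourier]
  rw [lintegral_comp_smul (neg_ne_zero.mpr (inv_ne_zero hpi.ne')) (fun x => ‖𝓕 G x‖ₑ ^ 2),
    lintegral_fourier_sq hG hG2]
  congr 2
  rw [abs_inv, abs_pow, abs_neg, abs_inv, abs_of_pos hpi, inv_pow, inv_inv]

/-- The dilation of a Schwartz function. -/
def dilation (r : ℝ) (hr : r ≠ 0) : 𝓢(RSpace n, ℂ) →L[ℂ] 𝓢(RSpace n, ℂ) :=
  SchwartzMap.compCLMOfContinuousLinearEquiv ℂ (ContinuousLinearEquiv.smulLeft (Units.mk0 r hr))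

theorem dilation_apply (r : ℝ) (hr : r ≠ 0) (f : 𝓢(RSpace n, ℂ)) (x : RSpace n) :
    dilation r hr f x = f (r • x) := rfl

theorem two_pi_ne_zero : 2 * Real.pi ≠ 0 := by positivity

theorem two_pi_inv_ne_zero : (2 * Real.pi)⁻¹ ≠ 0 := by positivity

/-- The transform `f̂` of a Schwartz function as a Schwartz function. -/
def fourierHatS (f : 𝓢(RSpace n, ℂ)) : 𝓢(RSpace n, ℂ) :=
  dilation (2 * Real.pi)⁻¹ two_pi_inv_ne_zero (𝓕 f)

theorem fourierHatS_apply (f : 𝓢(RSpace n, ℂ)) (ξ : RSpace n) :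
    fourierHatS f ξ = fourierHat f ξ := by
  rw [fourierHat_eq_osc, osc_eq_fourier, smul_neg, neg_smul, neg_neg]
  rfl

theorem lintegral_fourierHat_sq (f : 𝓢(RSpace n, ℂ)) :
    ∫⁻ x, ‖fourierHat f x‖ₑ ^ 2 =
      ENNReal.ofReal ((2 * Real.pi) ^ n) * ∫⁻ x, ‖f x‖ₑ ^ 2 := by
  simp only [fourierHat_eq_osc]
  rw [lintegral_neg_eq_self (fun x => ‖osc f x‖ₑ ^ 2)]
  exact lintegral_osc_sq f.integrable (f.memLp 2)

/-- Fourier inversion, with a dilation by `2π` between the two normalisations. It allows the test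
function in a pairing to be given by its transform. -/
theorem exists_fourierHat_eq (k : 𝓢(RSpace n, ℂ)) :
    ∃ K : 𝓢(RSpace n, ℂ), ∀ x, k x = fourierHat K x := by
  refine ⟨𝓕⁻ (dilation (2 * Real.pi) two_pi_ne_zero k), fun x => ?_⟩
  rw [← fourierHatS_apply]
  unfold fourierHatS
  rw [fourier_fourierInv_eq, dilation_apply, dilation_apply, smul_smul, mul_inv_cancel₀, one_smul]
  exact two_pi_ne_zero

/-- The Riesz representation theorem for functionals given on Schwartz functions. -/
theorem exists_riesz (ℓ : 𝓢(RSpace n, ℂ) →ₗ[ℂ] ℂ) {C : ℝ} (hC : 0 ≤ C)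
    (h : ∀ φ, ‖ℓ φ‖ ≤ C * ‖φ.toLp 2 (volume : Measure (RSpace n))‖) :
    ∃ v : LTwo n, ‖v‖ ≤ C ∧ ∀ φ, ℓ φ = ∫ x, φ x * star (v x) := by
  have hd : DenseRange (SchwartzMap.toLpCLM ℂ ℂ 2 (volume : Measure (RSpace n))).toLinearMap :=
    SchwartzMap.denseRange_toLpCLM ENNReal.ofNat_ne_top
  obtain ⟨L, hL, hLn⟩ : ∃ L : LTwo n →L[ℂ] ℂ,
      (∀ φ : 𝓢(RSpace n, ℂ), L (φ.toLp 2) = ℓ φ) ∧ ‖L‖ ≤ C :=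
    ⟨ℓ.extendOfNorm (SchwartzMap.toLpCLM ℂ ℂ 2 volume).toLinearMap,
      LinearMap.extendOfNorm_eq hd ⟨C, h⟩, ContinuousLinearMap.opNorm_le_bound _ hC
      (LinearMap.norm_extendOfNorm_apply_le hd C h)⟩
  refine ⟨(InnerProductSpace.toDual ℂ (LTwo n)).symm L, by rwa [LinearIsometryEquiv.norm_map],
    fun φ => ?_⟩
  rw [← hL, ← InnerProductSpace.toDual_symm_apply, L2.inner_def]
  refine integral_congr_ae ?_
  filter_upwards [φ.coeFn_toLp 2] with x hx
  rw [hx, RCLike.inner_apply]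
  rfl

theorem exists_integralFunctional {u : RSpace n → ℂ}
    (hint : ∀ φ : 𝓢(RSpace n, ℂ), Integrable fun x => φ x * u x) :
    ∃ ℓ : 𝓢(RSpace n, ℂ) →ₗ[ℂ] ℂ, ∀ φ, ℓ φ = ∫ x, φ x * u x :=
    ⟨{ toFun := fun φ => ∫ x, φ x * u x
       map_add' := fun φ ψ => by
        simp only [_root_.add_apply, add_mul]
        exact integral_add (hint φ) (hint ψ)
       map_smul' := fun c φ => by
        simp only [_root_.smul_apply, smul_eq_mul, mul_assoc, RingHom.id_apply]
        exact integral_const_mul _ _ }, fun φ => rfl⟩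

/-- Duality: a function which is a bounded functional on Schwartz functions is in `L²`. -/
theorem eLpNorm_le_of_forall_schwartz {u : RSpace n → ℂ} (hu : LocallyIntegrable u)
    (hint : ∀ φ : 𝓢(RSpace n, ℂ), Integrable fun x => φ x * u x) {C : ℝ} (hC : 0 ≤ C)
    (h : ∀ φ : 𝓢(RSpace n, ℂ), ‖∫ x, φ x * u x‖ ≤ C * ‖φ.toLp 2 (volume : Measure (RSpace n))‖) :
    MemLp u 2 ∧ eLpNorm u 2 ≤ ENNReal.ofReal C := by
  obtain ⟨ℓ, hℓ⟩ := exists_integralFunctional hint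
  obtain ⟨v, hv, hφ⟩ := exists_riesz ℓ hC fun φ => by rw [hℓ]; exact h φ
  have hvm : MemLp (fun x => star (v x)) 2 := (Lp.memLp v).star
  have hae : u =ᵐ[volume] fun x => star (v x) :=
    ae_eq_of_integral_schwartz_mul hu (hvm.locallyIntegrable (by norm_num)) fun φ =>
      (hℓ φ).symm.trans (hφ φ)
  have hn : eLpNorm (fun x => star (v x)) 2 volume = eLpNorm v 2 volume :=
    eLpNorm_congr_norm_ae (Filter.Eventually.of_forall fun x => norm_star (v x))
  have hve : eLpNorm v 2 volume ≤ ENNReal.ofReal C := by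
    rw [← Lp.enorm_def, ← ofReal_norm]
    exact ENNReal.ofReal_le_ofReal hv
  exact ⟨hvm.ae_eq hae.symm, ((eLpNorm_congr_ae hae).trans hn).trans_le hve⟩

end Plancherel

/-! ### A Taylor formula over a cube -/

section Box

variable {n : ℕ}

/-- Lebesgue measure on the unit interval. -/
def unitMeas : Measure ℝ := volume.restrict (Set.Icc 0 1)

instance : IsProbabilityMeasure unitMeas := ⟨by simp [unitMeas]⟩

/-- Lebesgue measure on the unit cube. -/
def cubeMeas (n : ℕ) : Measure (Fin n → ℝ) := Measure.pi fun _ => unitMeas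

instance : IsProbabilityMeasure (cubeMeas n) := by unfold cubeMeas; infer_instance

theorem cubeMeas_eq : cubeMeas n = volume.restrict (Set.univ.pi fun _ => Set.Icc 0 1) := by
  rw [cubeMeas, volume_pi, Measure.restrict_pi_pi]
  rfl

theorem integrable_cubeMeas {F : (Fin n → ℝ) → ℂ} (hF : Continuous F) :
    Integrable F (cubeMeas n) := by
  rw [cubeMeas_eq]
  exact hF.continuousOn.integrableOn_compact (isCompact_univ_pi fun _ => isCompact_Icc)

/-- Replacing one coordinate of a uniform point of the cube by an independent uniform variable
leaves the distribution unchanged. -/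
theorem measurePreserving_update (i : Fin n) :
    MeasurePreserving (fun p : (Fin n → ℝ) × ℝ => Function.update p.1 i p.2)
      ((cubeMeas n).prod unitMeas) (cubeMeas n) := by
  have hm : Measurable (fun p : (Fin n → ℝ) × ℝ => Function.update p.1 i p.2) := by
    refine measurable_pi_iff.mpr fun j => ?_
    by_cases h : j = i
    · subst h; simpa using measurable_snd
    · simp only [Function.update_of_ne h]; fun_prop
  refine ⟨hm, (Measure.pi_eq fun s hs => ?_).symm⟩
  rw [Measure.map_apply hm (MeasurableSet.univ_pi hs)]
  have : (fun p : (Fin n → ℝ) × ℝ => Function.update p.1 i p.2) ⁻¹' (Set.univ.pi s) =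
      (Set.univ.pi (Function.update s i Set.univ)) ×ˢ s i := by
    ext ⟨τ, t⟩
    simp only [Set.mem_preimage, Set.mem_univ_pi, Set.mem_prod]
    constructor
    · refine fun h => ⟨fun j => ?_, by simpa using h i⟩
      by_cases hj : j = i
      · subst hj; simp
      · simpa [hj] using h j
    · rintro ⟨h1, h2⟩ j
      by_cases hj : j = i
      · subst hj; simpa using h2
      · simpa [hj] using h1 j
  rw [this, Measure.prod_prod, cubeMeas, Measure.pi_pi,
    ← Finset.prod_erase_mul Finset.univ _ (Finset.mem_univ i),
    ← Finset.prod_erase_mul Finset.univ (fun j => unitMeas (s j)) (Finset.mem_univ i)]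
  simp only [Function.update_self, measure_univ, mul_one]
  congr 1
  refine Finset.prod_congr rfl fun j hj => ?_
  rw [Function.update_of_ne (Finset.ne_of_mem_erase hj)]

theorem integral_cubeMeas_update (i : Fin n) {F : (Fin n → ℝ) → ℂ} (hF : Continuous F) :
    ∫ τ, F τ ∂cubeMeas n = ∫ τ, ∫ t, F (Function.update τ i t) ∂unitMeas ∂cubeMeas n := by
  rw [← integral_prod (fun p : (Fin n → ℝ) × ℝ => F (Function.update p.1 i p.2))
    ((measurePreserving_update i).integrable_comp_of_integrable (integrable_cubeMeas hF))]
  conv_lhs => rw [← (measurePreserving_update i).map_eq]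
  exact integral_map (measurePreserving_update i).aemeasurable hF.aestronglyMeasurable

/-- The integrand is the derivative in `t` of `(t - 1) ψ(y + w t e)`, which vanishes at `t = 1` and
equals `-ψ(y)` at `t = 0`. -/
theorem eq_integral_unit {ψ ψ' : RSpace n → ℂ} {e : RSpace n} (w : ℝ)
    (h : ∀ y, HasLineDerivAt ℝ ψ (ψ' y) y e) (hψ : Continuous ψ) (hψ' : Continuous ψ')
    (y : RSpace n) :
    ψ y = ∫ t, (ψ (y + w • t • e) + (w * (t - 1) : ℝ) * ψ' (y + w • t • e)) ∂unitMeas := by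
  have hd : ∀ t : ℝ, HasDerivAt (fun t : ℝ => ψ (y + w • t • e)) (w * ψ' (y + w • t • e)) t := by
    intro t
    have h1 : HasDerivAt (fun s : ℝ => ψ (y + w • t • e + s • e)) (ψ' (y + w • t • e)) 0 := h _
    have h2 : HasDerivAt (fun u : ℝ => w * (u - t)) w t := by
      simpa using ((hasDerivAt_id t).sub_const t).const_mul w
    have h3 := HasDerivAt.scomp t (h := fun u : ℝ => w * (u - t)) (by simpa using h1) h2
    have h4 : ((fun s : ℝ => ψ (y + w • t • e + s • e)) ∘ fun u => w * (u - t)) =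
        fun t : ℝ => ψ (y + w • t • e) := by
      funext u
      simp only [Function.comp]
      congr 1
      module
    rw [h4] at h3
    refine h3.congr_deriv ?_
    simp
  have hd2 : ∀ t ∈ Set.uIcc (0 : ℝ) 1, HasDerivAt (fun t : ℝ => ((t - 1 : ℝ) : ℂ) *
      ψ (y + w • t • e)) (ψ (y + w • t • e) + (w * (t - 1) : ℝ) * ψ' (y + w • t • e)) t := by
    intro t _
    have h1 : HasDerivAt (fun t : ℝ => ((t - 1 : ℝ) : ℂ)) 1 t := by
      simpa using ((hasDerivAt_id t).sub_const 1).ofReal_comp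
    refine (h1.fun_mul (hd t)).congr_deriv ?_
    push_cast
    ring
  have := intervalIntegral.integral_eq_sub_of_hasDerivAt hd2
    (Continuous.intervalIntegrable (by fun_prop) _ _)
  rw [intervalIntegral.integral_of_le zero_le_one, ← integral_Icc_eq_integral_Ioc] at this
  unfold unitMeas
  rw [this]
  simp

/-- The Taylor formula over a cube, in terms of mixed derivatives. -/
theorem eq_sum_integral_cube {φ : Finset (Fin n) → RSpace n → ℂ} (w : ℝ)
    (hφ : ∀ J, ∀ i ∉ J, ∀ y, HasLineDerivAt ℝ (φ J) (φ (insert i J) y) y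
      (EuclideanSpace.single i 1))
    (hc : ∀ J, Continuous (φ J)) (ζ : RSpace n) (s : Finset (Fin n)) :
    φ ∅ ζ = ∑ J ∈ s.powerset, ∫ τ, ((∏ j ∈ J, w * (τ j - 1) : ℝ) : ℂ) *
      φ J (ζ + w • ∑ j ∈ s, τ j • EuclideanSpace.single j (1 : ℝ)) ∂cubeMeas n := by
  have hcF : ∀ (s J : Finset (Fin n)), Continuous fun τ : Fin n → ℝ =>
      ((∏ j ∈ J, w * (τ j - 1) : ℝ) : ℂ) *
      φ J (ζ + w • ∑ j ∈ s, τ j • EuclideanSpace.single j (1 : ℝ)) := by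
    intro s J
    have := hc J
    fun_prop
  induction s using Finset.induction_on with
  | empty => simp
  | insert i s hi ih =>
    -- The subsets of `insert i s` come in pairs `J`, `insert i J`. Each pair arises from the
    -- `J`-term by the one-dimensional formula along the `i`-th axis, whose variable is the
    -- coordinate `τ i`, redrawn independently.
    rw [ih, Finset.sum_powerset_insert hi, ← Finset.sum_add_distrib]
    refine Finset.sum_congr rfl fun J hJ => ?_
    have hiJ : i ∉ J := fun h => hi (Finset.mem_powerset.mp hJ h)
    rw [← integral_add (integrable_cubeMeas (hcF _ _)) (integrable_cubeMeas (hcF _ _)),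
      integral_cubeMeas_update i (F := fun τ => ((∏ j ∈ J, w * (τ j - 1) : ℝ) : ℂ) *
        φ J (ζ + w • ∑ j ∈ insert i s, τ j • EuclideanSpace.single j (1 : ℝ)) +
        ((∏ j ∈ insert i J, w * (τ j - 1) : ℝ) : ℂ) *
        φ (insert i J) (ζ + w • ∑ j ∈ insert i s, τ j • EuclideanSpace.single j (1 : ℝ)))
        ((hcF _ _).add (hcF _ _))]
    · refine integral_congr_ae (Filter.Eventually.of_forall fun τ => ?_)
      simp only
      rw [eq_integral_unit w (hφ J i hiJ) (hc J) (hc _), ← integral_const_mul]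
      refine integral_congr_ae (Filter.Eventually.of_forall fun t => ?_)
      have e1 : ∏ j ∈ J, w * (Function.update τ i t j - 1) = ∏ j ∈ J, w * (τ j - 1) :=
        Finset.prod_congr rfl fun j hj => by
          rw [Function.update_of_ne (by rintro rfl; exact hiJ hj)]
      have e2 : ∑ j ∈ s, Function.update τ i t j • EuclideanSpace.single j (1 : ℝ) =
          ∑ j ∈ s, τ j • EuclideanSpace.single j (1 : ℝ) :=
        Finset.sum_congr rfl fun j hj => by
          rw [Function.update_of_ne (by rintro rfl; exact hi hj)]
      simp only [Finset.prod_insert hiJ, Finset.sum_insert hi, e1, e2, Function.update_self]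
      rw [show ζ + w • (t • EuclideanSpace.single i (1 : ℝ) +
          ∑ j ∈ s, τ j • EuclideanSpace.single j (1 : ℝ)) =
        ζ + w • ∑ j ∈ s, τ j • EuclideanSpace.single j (1 : ℝ) +
          w • t • EuclideanSpace.single i (1 : ℝ) by module]
      push_cast
      ring

/-- The kernels of the Taylor formula over the unit cube. -/
def boxKernel (J : Finset (Fin n)) (z : RSpace n) : ℝ :=
  (Set.univ.pi fun _ : Fin n => Set.Icc (0 : ℝ) 1).indicator (fun τ => ∏ j ∈ J, (τ j - 1)) z.ofLp

theorem measurable_boxKernel (J : Finset (Fin n)) : Measurable (boxKernel J) := by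
  have h1 : Measurable ((Set.univ.pi fun _ : Fin n => Set.Icc (0 : ℝ) 1).indicator
      (fun τ => ∏ j ∈ J, (τ j - 1))) :=
    Measurable.indicator (by fun_prop) (MeasurableSet.univ_pi fun _ => measurableSet_Icc)
  exact h1.comp (by fun_prop)

theorem abs_boxKernel_le (J : Finset (Fin n)) (z : RSpace n) : |boxKernel J z| ≤ 1 := by
  unfold boxKernel
  by_cases h : z.ofLp ∈ Set.univ.pi fun _ : Fin n => Set.Icc (0 : ℝ) 1
  · rw [Set.indicator_of_mem h, Finset.abs_prod]
    refine Finset.prod_le_one (fun _ _ => abs_nonneg _) fun j _ => ?_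
    have := h j (Set.mem_univ j)
    rw [abs_le]
    constructor <;> linarith [this.1, this.2]
  · rw [Set.indicator_of_notMem h]; simp

theorem norm_le_of_boxKernel_ne_zero {J : Finset (Fin n)} {z : RSpace n}
    (h : boxKernel J z ≠ 0) : ‖z‖ ≤ n := by
  have h1 : z.ofLp ∈ Set.univ.pi fun _ : Fin n => Set.Icc (0 : ℝ) 1 := by
    by_contra h1
    exact h (Set.indicator_of_notMem h1 _)
  have hb := (EuclideanSpace.basisFun (Fin n) ℝ).sum_repr z
  simp only [EuclideanSpace.basisFun_repr, EuclideanSpace.basisFun_apply] at hb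
  rw [← hb]
  refine (norm_sum_le _ _).trans ((Finset.sum_le_sum fun j _ => (?_ : _ ≤ (1 : ℝ))).trans (by simp))
  have := h1 j (Set.mem_univ j)
  rw [norm_smul, PiLp.norm_single, norm_one, mul_one, Real.norm_eq_abs, abs_le]
  constructor <;> linarith [this.1, this.2]

/-- The substitution `ξ = ζ + w τ` turns the cube average into an integral over `ξ`. Since `ζ` is
fixed, `w` may be chosen as a function of `ζ`. -/
theorem eq_sum_integral_boxKernel {φ : Finset (Fin n) → RSpace n → ℂ} {w : ℝ} (hw : 0 < w)
    (hφ : ∀ J, ∀ i ∉ J, ∀ y, HasLineDerivAt ℝ (φ J) (φ (insert i J) y) y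
      (EuclideanSpace.single i 1))
    (hc : ∀ J, Continuous (φ J)) (ζ : RSpace n) :
    φ ∅ ζ = ∑ J, ∫ ξ, ((w ^ J.card * (w ^ n)⁻¹ * boxKernel J (w⁻¹ • (ξ - ζ)) : ℝ) : ℂ) * φ J ξ := by
  rw [eq_sum_integral_cube w hφ hc ζ Finset.univ, Finset.powerset_univ]
  refine Finset.sum_congr rfl fun J _ => ?_
  have h1 := integral_sub_right_eq_self (μ := (volume : Measure (RSpace n)))
    (fun z => ((w ^ J.card * (w ^ n)⁻¹ * boxKernel J (w⁻¹ • z) : ℝ) : ℂ) * φ J (ζ + z)) ζ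
  simp only [add_sub_cancel] at h1
  rw [h1]
  have h2 := Measure.integral_comp_smul (volume : Measure (RSpace n))
    (fun z => ((w ^ J.card * (w ^ n)⁻¹ * boxKernel J (w⁻¹ • z) : ℝ) : ℂ) * φ J (ζ + z)) w
  rw [finrank_euclideanSpace, Fintype.card_fin, abs_of_pos (by positivity),
    eq_inv_smul_iff₀ (by positivity)] at h2
  rw [← h2, ← integral_smul, cubeMeas_eq,
    ← integral_indicator (MeasurableSet.univ_pi fun _ => measurableSet_Icc),
    ← (PiLp.volume_preserving_ofLp (Fin n)).integral_comp
      (MeasurableEquiv.toLp 2 (Fin n → ℝ)).symm.measurableEmbedding]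
  refine integral_congr_ae (Filter.Eventually.of_forall fun z => ?_)
  have hb := (EuclideanSpace.basisFun (Fin n) ℝ).sum_repr z
  simp only [EuclideanSpace.basisFun_repr, EuclideanSpace.basisFun_apply] at hb
  simp only [smul_smul, inv_mul_cancel₀ hw.ne', one_smul, boxKernel]
  by_cases h : z.ofLp ∈ Set.univ.pi fun _ : Fin n => Set.Icc (0 : ℝ) 1
  · rw [Set.indicator_of_mem h, Set.indicator_of_mem h, hb, Finset.prod_mul_distrib,
      Finset.prod_const, Complex.real_smul]
    have hwn : (w : ℂ) ^ n ≠ 0 := by exact_mod_cast (pow_pos hw n).ne'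
    push_cast
    field_simp
  · rw [Set.indicator_of_notMem h, Set.indicator_of_notMem h]
    simp

end Box

/-! ### The frequency scale and the two Schur estimates -/

/-- The frequency scale `(1 + R + |ξ|)^δ`, up to a constant. -/
def scale {n : ℕ} (δ R : ℝ) (ξ : RSpace n) : ℝ := (1 + R + ‖ξ‖) ^ δ / (2 * (n + 1))

section Schur

variable {n : ℕ} {δ R : ℝ}

theorem scale_pos (hR : 0 ≤ R) (ξ : RSpace n) : 0 < scale δ R ξ := by
  unfold scale; positivity

theorem inv_scale_le (hδ : 0 ≤ δ) (hR : 0 ≤ R) (ξ : RSpace n) :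
    (scale δ R ξ)⁻¹ ≤ 2 * (n + 1) := by
  unfold scale
  rw [inv_div]
  refine div_le_self (by positivity) (Real.one_le_rpow ?_ hδ)
  linarith [norm_nonneg ξ]

theorem continuous_scale (hR : 0 ≤ R) : Continuous (scale (n := n) δ R) := by
  unfold scale
  refine Continuous.div_const (Continuous.rpow_const (by fun_prop) fun ξ => Or.inl ?_) _
  positivity

theorem scale_le_two_mul (hδ : 0 ≤ δ) (hδ1 : δ ≤ 1) (hR : 0 ≤ R) {ξ ζ : RSpace n}
    (h : 1 + R + ‖ξ‖ ≤ 2 * (1 + R + ‖ζ‖)) : scale δ R ξ ≤ 2 * scale δ R ζ := by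
  unfold scale
  rw [← mul_div_assoc]
  refine div_le_div_of_nonneg_right ?_ (by positivity)
  calc (1 + R + ‖ξ‖) ^ δ ≤ (2 * (1 + R + ‖ζ‖)) ^ δ := by gcongr
    _ = 2 ^ δ * (1 + R + ‖ζ‖) ^ δ := Real.mul_rpow (by norm_num) (by positivity)
    _ ≤ 2 ^ (1 : ℝ) * (1 + R + ‖ζ‖) ^ δ := by gcongr; norm_num
    _ = _ := by rw [Real.rpow_one]

/-- The divisor `2(n + 1)` in `scale` serves this bound: points of the box at `ζ` lie within `n
w(ζ)` of `ζ`, hence within half of `1 + R + |ζ|`, where the scales are comparable. -/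
theorem scale_le (hδ1 : δ ≤ 1) (hR : 0 ≤ R) (ζ : RSpace n) :
    n * scale δ R ζ ≤ (1 + R + ‖ζ‖) / 2 := by
  unfold scale
  have h1 : (1 + R + ‖ζ‖) ^ δ ≤ 1 + R + ‖ζ‖ := by
    have := Real.rpow_le_rpow_of_exponent_le (x := 1 + R + ‖ζ‖) (by linarith [norm_nonneg ζ]) hδ1
    rwa [Real.rpow_one] at this
  have h2 : 0 ≤ (1 + R + ‖ζ‖) ^ δ := by positivity
  have hn : (0 : ℝ) ≤ n := Nat.cast_nonneg n
  rw [mul_div_assoc', div_le_div_iff₀ (by positivity) (by norm_num)]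
  nlinarith

theorem one_add_norm_comparable {r : ℝ} (hR : 0 ≤ R) {ξ ζ : RSpace n} (h : ‖ξ - ζ‖ ≤ r)
    (hr : r ≤ (1 + R + ‖ζ‖) / 2) :
    1 + R + ‖ξ‖ ≤ 2 * (1 + R + ‖ζ‖) ∧ 1 + R + ‖ζ‖ ≤ 2 * (1 + R + ‖ξ‖) := by
  have h1 : ‖ξ‖ ≤ ‖ζ‖ + ‖ξ - ζ‖ := by
    have := norm_add_le ζ (ξ - ζ); rwa [add_sub_cancel] at this
  have h2 : ‖ζ‖ ≤ ‖ξ‖ + ‖ξ - ζ‖ := by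
    have := norm_sub_le ξ (ξ - ζ); rwa [sub_sub_cancel] at this
  have := norm_nonneg ζ
  constructor <;> linarith

theorem scale_comparable (hδ : 0 ≤ δ) (hδ1 : δ ≤ 1) (hR : 0 ≤ R) {ξ ζ : RSpace n}
    (h : ‖ξ - ζ‖ ≤ (1 + R + ‖ζ‖) / 2) :
    scale δ R ξ ≤ 2 * scale δ R ζ ∧ scale δ R ζ ≤ 2 * scale δ R ξ := by
  obtain ⟨h1, h2⟩ := one_add_norm_comparable hR h le_rfl
  exact ⟨scale_le_two_mul hδ hδ1 hR h1, scale_le_two_mul hδ hδ1 hR h2⟩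

/-- The decay profile `w⁻ⁿ (1 + |z| / w)^{-(n+1)}`. -/
def profile {n : ℕ} (w : ℝ) (z : RSpace n) : ℝ := w⁻¹ ^ n * (1 + w⁻¹ * ‖z‖) ^ (-((n : ℝ) + 1))

theorem profile_nonneg {w : ℝ} (hw : 0 ≤ w) (z : RSpace n) : 0 ≤ profile w z := by
  unfold profile; positivity

theorem integrable_one_add_norm_rpow : Integrable fun z : RSpace n =>
    (1 + ‖z‖) ^ (-((n : ℝ) + 1)) := integrable_one_add_norm (by simp)

/-- The profile is a dilate with normalised mass, so its integral depends neither on the scale nor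
on the centre. -/
theorem lintegral_profile {w : ℝ} (hw : 0 < w) (θ : RSpace n) :
    ∫⁻ ξ, ENNReal.ofReal (profile w (ξ - θ)) =
      ENNReal.ofReal (∫ z : RSpace n, (1 + ‖z‖) ^ (-((n : ℝ) + 1))) := by
  rw [lintegral_sub_right_eq_self (fun z => ENNReal.ofReal (profile w z)) θ,
    ofReal_integral_eq_lintegral_ofReal integrable_one_add_norm_rpow
      (Filter.Eventually.of_forall fun z => by positivity)]
  have h1 := lintegral_comp_smul (inv_ne_zero hw.ne')
    fun z : RSpace n => ENNReal.ofReal ((1 + ‖z‖) ^ (-((n : ℝ) + 1)))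
  unfold profile
  simp only [ENNReal.ofReal_mul (pow_nonneg (inv_nonneg.mpr hw.le) n)]
  have e : ∀ z : RSpace n, 1 + w⁻¹ * ‖z‖ = 1 + ‖w⁻¹ • z‖ := fun z => by
    rw [norm_smul, Real.norm_of_nonneg (by positivity)]
  simp only [e]
  rw [lintegral_const_mul' _ _ ENNReal.ofReal_ne_top, h1, ← mul_assoc,
    ← ENNReal.ofReal_mul (by positivity), abs_of_pos (by positivity),
    mul_inv_cancel₀ (by positivity), ENNReal.ofReal_one, one_mul]

theorem inv_pow_two_mul_le {x y : ℝ} {k : ℕ} (hx : 0 < x) (h : x ≤ 2 * y) :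
    y⁻¹ ^ k ≤ 2 ^ k * x⁻¹ ^ k := by
  have hy : 0 < y := by linarith
  rw [← mul_pow]
  refine pow_le_pow_left₀ (by positivity) ?_ k
  rw [← div_eq_mul_inv, inv_eq_one_div, div_le_div_iff₀ hy hx]
  linarith

/-- Near the diagonal `w(ξ)` may be replaced by `w(θ)` at the cost of powers of `2`, and the kernel
becomes a convolution profile at a scale that does not depend on the integration variable `ξ`. -/
theorem wgt_scale_le_profile_near (hδ : 0 ≤ δ) (hδ1 : δ ≤ 1) (hR : 0 ≤ R) (M : ℕ)
    (hM : n + 1 ≤ 2 * M) {ξ θ : RSpace n} (h : ‖ξ - θ‖ ≤ (1 + R + ‖θ‖) / 2) :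
    (scale δ R ξ)⁻¹ ^ n * ((1 + (scale δ R ξ)⁻¹ * ‖ξ - θ‖) ^ (2 * M))⁻¹ ≤
      2 ^ n * 2 ^ (2 * M) * profile (scale δ R θ) (ξ - θ) := by
  have hw := scale_pos (δ := δ) hR ξ
  have hw' := scale_pos (δ := δ) hR θ
  obtain ⟨h1, h2⟩ := scale_comparable hδ hδ1 hR h
  set w := scale δ R ξ
  set w' := scale δ R θ
  have hr := norm_nonneg (ξ - θ)
  have e1 : w⁻¹ ^ n ≤ 2 ^ n * w'⁻¹ ^ n := inv_pow_two_mul_le hw' h2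
  have e2 : (1 + w'⁻¹ * ‖ξ - θ‖) ≤ 2 * (1 + w⁻¹ * ‖ξ - θ‖) := by
    have : w'⁻¹ ≤ 2 * w⁻¹ := by simpa using inv_pow_two_mul_le (k := 1) hw h1
    nlinarith
  have e3 : ((1 + w⁻¹ * ‖ξ - θ‖) ^ (2 * M))⁻¹ ≤ 2 ^ (2 * M) * ((1 + w'⁻¹ * ‖ξ - θ‖) ^ (2 * M))⁻¹ := by
    have := inv_pow_two_mul_le (k := 2 * M) (by positivity) e2
    simpa [inv_pow] using this
  have e4 : ((1 + w'⁻¹ * ‖ξ - θ‖) ^ (2 * M))⁻¹ ≤ (1 + w'⁻¹ * ‖ξ - θ‖) ^ (-((n : ℝ) + 1)) := by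
    rw [← Real.rpow_natCast, ← Real.rpow_neg (by positivity)]
    refine Real.rpow_le_rpow_of_exponent_le ?_ ?_
    · have : 0 ≤ w'⁻¹ * ‖ξ - θ‖ := by positivity
      linarith
    · have : ((n + 1 : ℕ) : ℝ) ≤ (2 * M : ℕ) := by exact_mod_cast hM
      push_cast at this ⊢
      linarith
  unfold profile
  calc _ ≤ (2 ^ n * w'⁻¹ ^ n) * (2 ^ (2 * M) * (1 + w'⁻¹ * ‖ξ - θ‖) ^ (-((n : ℝ) + 1))) :=
        mul_le_mul e1 (e3.trans (by gcongr)) (by positivity) (by positivity)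
    _ = _ := by ring

/-- Far from the diagonal the distance `r` controls the frequency, so `w(ξ) ≤ (3r)^δ` and `1 + r /
w(ξ)` is at least `(1 + r)^{1-δ} / 3`. The power `2M` of this beats `(1 + r)^{n+1}`. -/
theorem wgt_scale_le_profile_far (hδ : 0 ≤ δ) (hδ1 : δ ≤ 1) (hR : 0 ≤ R) (M : ℕ)
    (hM : (n : ℝ) + 1 ≤ (1 - δ) * (2 * M : ℕ)) {ξ θ : RSpace n}
    (h : (1 + R + ‖θ‖) / 2 < ‖ξ - θ‖) :
    (scale δ R ξ)⁻¹ ^ n * ((1 + (scale δ R ξ)⁻¹ * ‖ξ - θ‖) ^ (2 * M))⁻¹ ≤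
      (2 * (n + 1)) ^ n * 3 ^ (2 * M) * profile 1 (ξ - θ) := by
  have hw := scale_pos (δ := δ) hR ξ
  have hwi := inv_scale_le (δ := δ) hδ hR ξ
  have hr : 1 / 2 ≤ ‖ξ - θ‖ := by have := norm_nonneg θ; linarith
  set r := ‖ξ - θ‖ with hrdef
  have h1 : ‖ξ‖ ≤ ‖θ‖ + r := by
    have := norm_add_le θ (ξ - θ); rwa [add_sub_cancel] at this
  -- `1 + R + |ξ| ≤ (1 + R + |θ|) + r`, and the bracket is less than `2r`.
  have hW : 1 + R + ‖ξ‖ ≤ 3 * r := by linarith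
  have hws : scale δ R ξ ≤ (3 * r) ^ δ := by
    unfold scale
    refine (div_le_self (by positivity) ?_).trans (by gcongr)
    have : (0 : ℝ) ≤ n := Nat.cast_nonneg n
    linarith
  have h2 : (1 + r) ^ (1 - δ) / 3 ≤ 1 + (scale δ R ξ)⁻¹ * r := by
    have h3 : (1 + r) ^ (1 - δ) ≤ (3 * r) ^ (1 - δ) :=
      Real.rpow_le_rpow (by positivity) (by linarith) (by linarith)
    have h4 : (3 * r) ^ (1 - δ) = 3 * r / (3 * r) ^ δ := by
      rw [Real.rpow_sub (by linarith), Real.rpow_one]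
    have h5 : r / (3 * r) ^ δ ≤ (scale δ R ξ)⁻¹ * r := by
      rw [div_eq_inv_mul]
      refine mul_le_mul_of_nonneg_right ?_ (by linarith)
      exact inv_anti₀ hw hws
    have h6 : 3 * r / (3 * r) ^ δ = 3 * (r / (3 * r) ^ δ) := by ring
    linarith
  have h3 : (1 + r) ^ ((n : ℝ) + 1) / 3 ^ (2 * M) ≤ (1 + (scale δ R ξ)⁻¹ * r) ^ (2 * M) := by
    refine le_trans ?_ (pow_le_pow_left₀ (by positivity) h2 (2 * M))
    rw [div_pow]
    refine div_le_div_of_nonneg_right ?_ (by positivity)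
    rw [← Real.rpow_mul_natCast (by linarith)]
    exact Real.rpow_le_rpow_of_exponent_le (by linarith) hM
  have h4 : ((1 + (scale δ R ξ)⁻¹ * r) ^ (2 * M))⁻¹ ≤ 3 ^ (2 * M) * (1 + r) ^ (-((n : ℝ) + 1)) := by
    refine (inv_anti₀ (by positivity) h3).trans_eq ?_
    rw [inv_div, Real.rpow_neg (by positivity), div_eq_mul_inv]
  unfold profile
  rw [← hrdef, inv_one, one_pow, one_mul, one_mul, mul_assoc]
  exact mul_le_mul (pow_le_pow_left₀ (by positivity) hwi n) h4 (by positivity) (by positivity)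

/-- The Schur estimate of the weights, uniformly in `R`. -/
theorem exists_schur_wgt (hδ : 0 ≤ δ) (hδ1 : δ ≤ 1) (M : ℕ)
    (hM : (n : ℝ) + 1 ≤ (1 - δ) * (2 * M : ℕ)) : ∃ C : ℝ, ∀ R, 0 ≤ R → ∀ θ : RSpace n,
      ∫⁻ ξ, ENNReal.ofReal ((scale δ R ξ)⁻¹ ^ n * wgt M (scale δ R ξ)⁻¹ (ξ - θ) ^ 2) ≤
        ENNReal.ofReal C := by
  set J := ∫ z : RSpace n, (1 + ‖z‖) ^ (-((n : ℝ) + 1)) with hJ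
  set C1 : ℝ := ((n : ℝ) + 1) ^ (2 * M) * (2 ^ n * 2 ^ (2 * M)) with hC1
  set C2 : ℝ := ((n : ℝ) + 1) ^ (2 * M) * ((2 * (n + 1)) ^ n * 3 ^ (2 * M)) with hC2
  have hM' : n + 1 ≤ 2 * M := by
    have h1 : (1 - δ) * (2 * M : ℕ) ≤ (2 * M : ℕ) :=
      mul_le_of_le_one_left (Nat.cast_nonneg _) (by linarith)
    exact_mod_cast hM.trans h1
  have hC1' : 0 ≤ C1 := by positivity
  have hC2' : 0 ≤ C2 := by positivity
  have hJ0 : 0 ≤ J := integral_nonneg fun z => by positivity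
  refine ⟨C1 * J + C2 * J, fun R hR θ => ?_⟩
  have hpt : ∀ ξ : RSpace n, (scale δ R ξ)⁻¹ ^ n * wgt M (scale δ R ξ)⁻¹ (ξ - θ) ^ 2 ≤
      C1 * profile (scale δ R θ) (ξ - θ) + C2 * profile 1 (ξ - θ) := by
    intro ξ
    have hw := scale_pos (δ := δ) hR ξ
    have p1 := profile_nonneg (scale_pos (δ := δ) hR θ).le (ξ - θ)
    have p2 := profile_nonneg zero_le_one (ξ - θ)
    -- One of the two factors of the weight is bounded by `1`; the decay of the other suffices.
    have h0 : wgt M (scale δ R ξ)⁻¹ (ξ - θ) ^ 2 ≤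
        ((n : ℝ) + 1) ^ (2 * M) * ((1 + (scale δ R ξ)⁻¹ * ‖ξ - θ‖) ^ (2 * M))⁻¹ := by
      have h1 := wgt_decay M (inv_nonneg.mpr hw.le) (ξ - θ)
      rw [← le_div_iff₀' (by positivity), div_eq_mul_inv] at h1
      refine le_trans ?_ h1
      rw [sq]
      exact mul_le_of_le_one_left (wgt_pos M _ _).le (wgt_le_one M _ _)
    have h2 := mul_le_mul_of_nonneg_left h0 (by positivity : 0 ≤ (scale δ R ξ)⁻¹ ^ n)
    refine h2.trans ?_
    rw [mul_left_comm]
    rcases le_or_gt ‖ξ - θ‖ ((1 + R + ‖θ‖) / 2) with h | h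
    · have h3 := mul_le_mul_of_nonneg_left (wgt_scale_le_profile_near hδ hδ1 hR M hM' h)
        (by positivity : 0 ≤ ((n : ℝ) + 1) ^ (2 * M))
      have h4 : 0 ≤ C2 * profile 1 (ξ - θ) := mul_nonneg hC2' p2
      rw [hC1]
      linarith
    · have h3 := mul_le_mul_of_nonneg_left (wgt_scale_le_profile_far hδ hδ1 hR M hM h)
        (by positivity : 0 ≤ ((n : ℝ) + 1) ^ (2 * M))
      have h4 : 0 ≤ C1 * profile (scale δ R θ) (ξ - θ) := mul_nonneg hC1' p1
      rw [hC2]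
      linarith
  refine (lintegral_mono fun ξ => ENNReal.ofReal_le_ofReal (hpt ξ)).trans (le_of_eq ?_)
  have e : ∀ ξ : RSpace n,
      ENNReal.ofReal (C1 * profile (scale δ R θ) (ξ - θ) + C2 * profile 1 (ξ - θ)) =
      ENNReal.ofReal C1 * ENNReal.ofReal (profile (scale δ R θ) (ξ - θ)) +
      ENNReal.ofReal C2 * ENNReal.ofReal (profile 1 (ξ - θ)) := by
    intro ξ
    rw [ENNReal.ofReal_add (mul_nonneg hC1' (profile_nonneg (scale_pos hR θ).le _))
      (mul_nonneg hC2' (profile_nonneg zero_le_one _)), ENNReal.ofReal_mul hC1',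
      ENNReal.ofReal_mul hC2']
  have hm : Measurable fun ξ : RSpace n =>
      ENNReal.ofReal C1 * ENNReal.ofReal (profile (scale δ R θ) (ξ - θ)) := by
    unfold profile; fun_prop
  simp only [e]
  rw [lintegral_add_left hm, lintegral_const_mul' _ _ ENNReal.ofReal_ne_top,
    lintegral_const_mul' _ _ ENNReal.ofReal_ne_top, lintegral_profile (scale_pos hR θ),
    lintegral_profile one_pos, ← ENNReal.ofReal_mul hC1', ← ENNReal.ofReal_mul hC2',
    ← ENNReal.ofReal_add (by positivity) (by positivity)]

/-- The kernel that localizes the frequency variable to the scale. -/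
def locKernel (δ R : ℝ) (J : Finset (Fin n)) (ξ ζ : RSpace n) : ℝ :=
  scale δ R ζ ^ J.card * (scale δ R ζ ^ n)⁻¹ * boxKernel J ((scale δ R ζ)⁻¹ • (ξ - ζ))

theorem measurable_locKernel (hR : 0 ≤ R) (J : Finset (Fin n)) :
    Measurable fun p : RSpace n × RSpace n => locKernel δ R J p.1 p.2 := by
  have h1 : Measurable fun p : RSpace n × RSpace n => scale δ R p.2 :=
    (continuous_scale hR).measurable.comp measurable_snd
  unfold locKernel
  exact ((h1.pow_const _).mul (h1.pow_const _).inv).mul ((measurable_boxKernel J).comp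
    (h1.inv.smul (measurable_fst.sub measurable_snd)))

theorem norm_sub_le_of_locKernel_ne_zero (hδ1 : δ ≤ 1) (hR : 0 ≤ R) {J : Finset (Fin n)}
    {ξ ζ : RSpace n} (h : locKernel δ R J ξ ζ ≠ 0) :
    ‖ξ - ζ‖ ≤ n * scale δ R ζ ∧ ‖ξ - ζ‖ ≤ (1 + R + ‖ζ‖) / 2 := by
  have hw := scale_pos (δ := δ) hR ζ
  have h1 := norm_le_of_boxKernel_ne_zero (right_ne_zero_of_mul h)
  rw [norm_smul, Real.norm_of_nonneg (by positivity), inv_mul_le_iff₀ hw, mul_comm] at h1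
  exact ⟨h1, h1.trans (scale_le hδ1 hR ζ)⟩

theorem abs_locKernel_le (hR : 0 ≤ R) (J : Finset (Fin n)) (ξ ζ : RSpace n) :
    |locKernel δ R J ξ ζ| ≤ scale δ R ζ ^ J.card * (scale δ R ζ)⁻¹ ^ n := by
  have hw := scale_pos (δ := δ) hR ζ
  unfold locKernel
  rw [abs_mul, abs_of_pos (by positivity), inv_pow]
  exact mul_le_of_le_one_right (by positivity) (abs_boxKernel_le _ _)

/-- The Schur estimate of the localizing kernels, uniformly in `R`. -/
theorem exists_schur_locKernel (hδ : 0 ≤ δ) (hδ1 : δ ≤ 1) (q : ℕ) : ∃ C : ℝ,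
    ∀ R, 0 ≤ R → ∀ (J : Finset (Fin n)) (ζ : RSpace n),
      ∫⁻ ξ, ENNReal.ofReal (scale δ R ξ ^ n *
        ((scale δ R ξ)⁻¹ ^ (J.card + q) * (‖ξ - ζ‖ ^ q * |locKernel δ R J ξ ζ|)) ^ 2) ≤
        ENNReal.ofReal C := by
  set I := ∫ z : RSpace n, (1 + ‖z‖) ^ (-((n : ℝ) + 1)) with hI
  have hI0 : 0 ≤ I := integral_nonneg fun z => by positivity
  set C1 : ℝ := 2 ^ n * (2 ^ (n + q) * n ^ q) ^ 2 * (n + 1) ^ ((n : ℝ) + 1) with hC1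
  have hC1' : 0 ≤ C1 := by positivity
  refine ⟨C1 * I, fun R hR J ζ => ?_⟩
  have hw' := scale_pos (δ := δ) hR ζ
  have hpt : ∀ ξ, scale δ R ξ ^ n *
        ((scale δ R ξ)⁻¹ ^ (J.card + q) * (‖ξ - ζ‖ ^ q * |locKernel δ R J ξ ζ|)) ^ 2 ≤
      C1 * profile (scale δ R ζ) (ξ - ζ) := by
    intro ξ
    by_cases h : locKernel δ R J ξ ζ = 0
    · rw [h]
      simp only [abs_zero, mul_zero, ne_eq, OfNat.ofNat_ne_zero, not_false_eq_true, zero_pow]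
      exact mul_nonneg hC1' (profile_nonneg hw'.le _)
    obtain ⟨h1, h2⟩ := norm_sub_le_of_locKernel_ne_zero hδ1 hR h
    obtain ⟨h3, h4⟩ := scale_comparable hδ hδ1 hR h2
    have hk := abs_locKernel_le (δ := δ) hR J ξ ζ
    have hw := scale_pos (δ := δ) hR ξ
    set w := scale δ R ξ
    set w' := scale δ R ζ
    have hJ : J.card ≤ n := by simpa using Finset.card_le_univ J
    have e1 : w ^ n ≤ 2 ^ n * w' ^ n := by
      rw [← mul_pow]; exact pow_le_pow_left₀ hw.le h3 n
    have e2 : w⁻¹ ^ (J.card + q) ≤ 2 ^ (n + q) * w'⁻¹ ^ (J.card + q) := by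
      refine (inv_pow_two_mul_le hw' h4).trans ?_
      gcongr
      norm_num
    have e3 : ‖ξ - ζ‖ ^ q ≤ n ^ q * w' ^ q := by
      rw [← mul_pow]; exact pow_le_pow_left₀ (norm_nonneg _) h1 q
    -- The powers of the scale balance: `|J| + q` negative ones against `q` from the distance and
    -- `|J|` from the kernel, which leaves `w'^{-n}`.
    have e4 : w⁻¹ ^ (J.card + q) * (‖ξ - ζ‖ ^ q * |locKernel δ R J ξ ζ|) ≤
        2 ^ (n + q) * n ^ q * w'⁻¹ ^ n := by
      calc _ ≤ (2 ^ (n + q) * w'⁻¹ ^ (J.card + q)) *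
            ((n ^ q * w' ^ q) * (w' ^ J.card * w'⁻¹ ^ n)) := by gcongr
        _ = (2 ^ (n + q) * n ^ q * w'⁻¹ ^ n) * ((w'⁻¹ * w') ^ (J.card + q)) := by ring
        _ = _ := by rw [inv_mul_cancel₀ hw'.ne', one_pow, mul_one]
    -- On the support of the kernel `|ξ - ζ| ≤ n w'`, so the profile is bounded below there and may
    -- be inserted at the cost of `(n + 1)^{n+1}`.
    have e5 : (n + 1 : ℝ) ^ (-((n : ℝ) + 1)) ≤ (1 + w'⁻¹ * ‖ξ - ζ‖) ^ (-((n : ℝ) + 1)) := by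
      refine Real.rpow_le_rpow_of_nonpos (by positivity) ?_ (by linarith [(Nat.cast_nonneg n : (0 : ℝ) ≤ n)])
      have : w'⁻¹ * ‖ξ - ζ‖ ≤ n := by rw [inv_mul_le_iff₀ hw', mul_comm]; exact h1
      linarith
    have e6 : (1 : ℝ) ≤ (n + 1) ^ ((n : ℝ) + 1) * (1 + w'⁻¹ * ‖ξ - ζ‖) ^ (-((n : ℝ) + 1)) := by
      refine le_trans (le_of_eq ?_) (mul_le_mul_of_nonneg_left e5 (by positivity))
      rw [← Real.rpow_add (by positivity)]
      simp
    calc _ ≤ (2 ^ n * w' ^ n) * (2 ^ (n + q) * n ^ q * w'⁻¹ ^ n) ^ 2 := by gcongr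
      _ = 2 ^ n * (2 ^ (n + q) * n ^ q) ^ 2 * w'⁻¹ ^ n * (w' * w'⁻¹) ^ n := by ring
      _ = 2 ^ n * (2 ^ (n + q) * n ^ q) ^ 2 * w'⁻¹ ^ n * 1 := by
        rw [mul_inv_cancel₀ hw'.ne', one_pow]
      _ ≤ 2 ^ n * (2 ^ (n + q) * n ^ q) ^ 2 * w'⁻¹ ^ n *
          ((n + 1) ^ ((n : ℝ) + 1) * (1 + w'⁻¹ * ‖ξ - ζ‖) ^ (-((n : ℝ) + 1))) := by gcongr
      _ = _ := by rw [hC1, profile]; ring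
  refine (lintegral_mono fun ξ => ENNReal.ofReal_le_ofReal (hpt ξ)).trans (le_of_eq ?_)
  simp only [ENNReal.ofReal_mul hC1']
  rw [lintegral_const_mul' _ _ ENNReal.ofReal_ne_top, lintegral_profile hw']

end Schur

/-! ### Weighted Schwartz functions, and Plancherel for a product -/

section FixedFrequency

variable {n : ℕ}

open LineDeriv in
theorem schwartz_jet (S : 𝓢(RSpace n, ℂ)) (j : Fin n) (m : ℕ) :
    ∃ F : ℕ → RSpace n → ℂ, F 0 = S ∧ IsJet j m F ∧ ∀ i ≤ m, Integrable (F i) := by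
  have h : ∀ i, ∃ T : 𝓢(RSpace n, ℂ), (T : RSpace n → ℂ) = (partialD j)^[i] S := by
    intro i
    induction i with
    | zero => exact ⟨S, rfl⟩
    | succ i ih =>
      obtain ⟨T, hT⟩ := ih
      refine ⟨∂_{(EuclideanSpace.single j 1 : RSpace n)} T, ?_⟩
      rw [Function.iterate_succ_apply', ← hT]
      funext x
      exact SchwartzMap.lineDerivOp_apply_eq_fderiv _ _ _
  refine ⟨fun i => (partialD j)^[i] S, rfl, IsJet.of_contDiff j (S.smooth m), fun i _ => ?_⟩
  obtain ⟨T, hT⟩ := h i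
  have := T.integrable (μ := volume)
  rwa [hT] at this

theorem exists_schwartz_coord_mul (S : 𝓢(RSpace n, ℂ)) (j : Fin n) (q : ℕ) :
    ∃ T : 𝓢(RSpace n, ℂ), ∀ z, T z = (Complex.I * (z j : ℂ)) ^ q * S z := by
  induction q with
  | zero => exact ⟨S, fun z => by simp⟩
  | succ q ih =>
    obtain ⟨T, hT⟩ := ih
    let L : RSpace n →L[ℝ] ℂ :=
      Complex.I • (Complex.ofRealCLM.comp (EuclideanSpace.proj (𝕜 := ℝ) j))
    have hL : ∀ z, L z = Complex.I * (z j : ℂ) := fun z => by simp [L]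
    refine ⟨SchwartzMap.smulLeftCLM ℂ L T, fun z => ?_⟩
    rw [SchwartzMap.smulLeftCLM_apply_apply L.hasTemperateGrowth, hT, hL, smul_eq_mul]
    ring

variable (M : ℕ) {c : ℝ}

theorem integrable_wgt_mul (S : 𝓢(RSpace n, ℂ)) : Integrable fun z => (wgt M c z : ℂ) * S z := by
  have hS : Integrable (S : RSpace n → ℂ) := S.integrable
  refine hS.bdd_mul (c := 1) ?_ (Filter.Eventually.of_forall fun z => ?_)
  · have : Continuous fun z : RSpace n => (wgt M c z : ℂ) := by fun_prop
    exact this.aestronglyMeasurable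
  · rw [Complex.norm_real, Real.norm_of_nonneg (wgt_pos M c z).le]
    exact wgt_le_one M c z

theorem memLp_wgt_mul (S : 𝓢(RSpace n, ℂ)) :
    MemLp (fun z => (wgt M c z : ℂ) * S z) 2 := by
  have hS : MemLp (S : RSpace n → ℂ) 2 volume := S.memLp 2
  refine hS.of_le ?_ (Filter.Eventually.of_forall fun z => ?_)
  · have : Continuous fun z : RSpace n => (wgt M c z : ℂ) := by fun_prop
    exact (this.mul S.continuous).aestronglyMeasurable
  · rw [norm_mul, Complex.norm_real, Real.norm_of_nonneg (wgt_pos M c z).le]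
    exact mul_le_of_le_one_left (norm_nonneg _) (wgt_le_one M c z)

theorem integrable_osc_wgt_mul (hc : 0 < c) (S : 𝓢(RSpace n, ℂ)) :
    Integrable (osc fun z => (wgt M c z : ℂ) * S z) := by
  obtain ⟨C, hC⟩ := exists_osc_weight_decay M hc (m := n + 1) fun j => schwartz_jet S j (n + 1)
  refine ((integrable_one_add_norm_rpow (n := n)).const_mul C).mono'
    (continuous_osc (integrable_wgt_mul M S)).aestronglyMeasurable
    (Filter.Eventually.of_forall fun η => ?_)
  have hp : 0 < (1 + ‖η‖) ^ (n + 1) := by positivity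
  rw [Real.rpow_neg (by positivity), ← div_eq_mul_inv, le_div_iff₀ (by positivity), mul_comm]
  have := hC η
  rwa [← Real.rpow_natCast, Nat.cast_add, Nat.cast_one] at this

/-- In the Leibniz rule each derivative on `f` costs `w` and is paid for by one factor `w⁻¹`;
derivatives on `g` keep theirs. -/
theorem norm_jetMul_le_sum {f g : ℕ → RSpace n → ℂ} {i : ℕ} {x : RSpace n} {A w : ℝ} (hw : 0 < w)
    (hf : ∀ p ≤ i, ‖f p x‖ ≤ A * w ^ p) :
    w⁻¹ ^ i * ‖jetMul f g i x‖ ≤ 2 ^ i * A * ∑ q ∈ Finset.range (i + 1), w⁻¹ ^ q * ‖g q x‖ := by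
  have hA : 0 ≤ A := by simpa using (norm_nonneg _).trans (hf 0 (Nat.zero_le _))
  have h1 : ‖jetMul f g i x‖ ≤ ∑ p ∈ Finset.HasAntidiagonal.antidiagonal i,
      2 ^ i * (A * w ^ p.1 * ‖g p.2 x‖) := by
    refine (norm_sum_le _ _).trans (Finset.sum_le_sum fun p hp => ?_)
    rw [Finset.HasAntidiagonal.mem_antidiagonal] at hp
    rw [norm_mul, norm_mul, Complex.norm_natCast]
    refine mul_le_mul (by exact_mod_cast Nat.choose_le_two_pow i p.1)
      (mul_le_mul_of_nonneg_right (hf p.1 (by omega)) (norm_nonneg _)) (by positivity)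
      (by positivity)
  refine (mul_le_mul_of_nonneg_left h1 (by positivity)).trans (le_of_eq ?_)
  rw [Finset.mul_sum, Finset.mul_sum, ← Finset.Nat.sum_antidiagonal_swap,
    Finset.Nat.sum_antidiagonal_eq_sum_range_succ_mk]
  refine Finset.sum_congr rfl fun q hq => ?_
  have hq' : q ≤ i := by rw [Finset.mem_range] at hq; omega
  simp only [Prod.fst_swap, Prod.snd_swap]
  have : w⁻¹ ^ i = w⁻¹ ^ q * w⁻¹ ^ (i - q) := by rw [← pow_add]; congr 1; omega
  rw [this]
  calc _ = 2 ^ i * A * (w⁻¹ ^ q * ‖g q x‖) * (w⁻¹ * w) ^ (i - q) := by ring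
    _ = _ := by rw [inv_mul_cancel₀ hw.ne', one_pow, mul_one]

/-- The quadratic estimate of a product of oscillatory integrals by Plancherel's theorem. -/
theorem lintegral_le_of_osc_mul_osc {ι : Type*} [Fintype ι] {G : ι → RSpace n → ℂ}
    {H f : RSpace n → ℂ} {D w : ℝ} {b : ι → ℝ} (hD : 0 ≤ D) (hw : 0 < w)
    (hG : ∀ i, Integrable (G i)) (hG2 : ∀ i, MemLp (G i) 2) (hH : Integrable H) (hH2 : MemLp H 2)
    (hf : ∀ x, ‖f x‖ ≤ D * ∑ i, b i * ‖osc (G i) x‖ * ‖osc H x‖) :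
    ∫⁻ x, ‖f x‖ₑ ≤ ENNReal.ofReal (D * (2 * Real.pi) ^ n) *
      ∑ i, ((∫⁻ z, ENNReal.ofReal (w ^ n * (b i * ‖G i z‖) ^ 2)) +
        ∫⁻ z, ENNReal.ofReal (w⁻¹ ^ n * ‖H z‖ ^ 2)) := by
  have hpt : ∀ x, ‖f x‖ₑ ≤ ENNReal.ofReal D * ∑ i, (ENNReal.ofReal (w ^ n * b i ^ 2) *
      ‖osc (G i) x‖ₑ ^ 2 + ENNReal.ofReal (w⁻¹ ^ n) * ‖osc H x‖ₑ ^ 2) := by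
    intro x
    have h1 : ‖f x‖ ≤ D * ∑ i, (w ^ n * b i ^ 2 * ‖osc (G i) x‖ ^ 2 + w⁻¹ ^ n * ‖osc H x‖ ^ 2) := by
      refine (hf x).trans (mul_le_mul_of_nonneg_left (Finset.sum_le_sum fun i _ => ?_) hD)
      have hwn : w ^ n * w⁻¹ ^ n = 1 := by rw [← mul_pow, mul_inv_cancel₀ hw.ne', one_pow]
      have hp : 0 < w ^ n := by positivity
      have hp' : 0 < w⁻¹ ^ n := by positivity
      set P := b i * ‖osc (G i) x‖
      set Q := ‖osc H x‖
      -- The arithmetic-geometric inequality with the weights `w^{±n}`, which make both resulting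
      -- kernels integrate in `ξ` to a bounded quantity.
      have h2 : 0 ≤ w⁻¹ ^ n * (w ^ n * P - Q) ^ 2 := by positivity
      have h3 : w⁻¹ ^ n * (w ^ n * P - Q) ^ 2 =
          (w ^ n * w⁻¹ ^ n) * (w ^ n * P ^ 2) - 2 * (w ^ n * w⁻¹ ^ n) * (P * Q) +
            w⁻¹ ^ n * Q ^ 2 := by ring
      rw [h3, hwn] at h2
      have h4 : 0 ≤ w ^ n * P ^ 2 := by positivity
      have h5 : 0 ≤ w⁻¹ ^ n * Q ^ 2 := by positivity
      have h6 : w ^ n * b i ^ 2 * ‖osc (G i) x‖ ^ 2 = w ^ n * P ^ 2 := by ring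
      rw [h6]
      linarith
    rw [← ofReal_norm]
    refine (ENNReal.ofReal_le_ofReal h1).trans (le_of_eq ?_)
    rw [ENNReal.ofReal_mul hD, ENNReal.ofReal_sum_of_nonneg fun i _ => by positivity]
    congr 1
    refine Finset.sum_congr rfl fun i _ => ?_
    rw [ENNReal.ofReal_add (by positivity) (by positivity), ENNReal.ofReal_mul (by positivity : 0 ≤ w ^ n * b i ^ 2),
      ENNReal.ofReal_mul (by positivity : 0 ≤ w⁻¹ ^ n), ENNReal.ofReal_pow (norm_nonneg _),
      ENNReal.ofReal_pow (norm_nonneg _), ofReal_norm, ofReal_norm]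
  have hmG : ∀ i, Measurable fun x => ‖osc (G i) x‖ₑ ^ 2 := fun i =>
    ((continuous_osc (hG i)).measurable.enorm).pow_const 2
  have hmH : Measurable fun x => ‖osc H x‖ₑ ^ 2 := (continuous_osc hH).measurable.enorm.pow_const 2
  refine (lintegral_mono hpt).trans (le_of_eq ?_)
  have hsum : ∫⁻ x, ∑ i, (ENNReal.ofReal (w ^ n * b i ^ 2) *
      ‖osc (G i) x‖ₑ ^ 2 + ENNReal.ofReal (w⁻¹ ^ n) * ‖osc H x‖ₑ ^ 2) =
      ∑ i, ∫⁻ x, (ENNReal.ofReal (w ^ n * b i ^ 2) *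
      ‖osc (G i) x‖ₑ ^ 2 + ENNReal.ofReal (w⁻¹ ^ n) * ‖osc H x‖ₑ ^ 2) :=
    lintegral_finsetSum _ fun i _ => ((hmG i).const_mul _).add (hmH.const_mul _)
  rw [lintegral_const_mul' _ _ ENNReal.ofReal_ne_top, hsum, ENNReal.ofReal_mul hD, mul_assoc]
  congr 1
  rw [Finset.mul_sum]
  refine Finset.sum_congr rfl fun i _ => ?_
  rw [lintegral_add_left ((hmG i).const_mul _), lintegral_const_mul' _ _ ENNReal.ofReal_ne_top,
    lintegral_const_mul' _ _ ENNReal.ofReal_ne_top, lintegral_osc_sq (hG i) (hG2 i),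
    lintegral_osc_sq hH hH2, mul_add]
  have e1 : ∀ z, ENNReal.ofReal (w ^ n * (b i * ‖G i z‖) ^ 2) =
      ENNReal.ofReal (w ^ n * b i ^ 2) * ‖G i z‖ₑ ^ 2 := fun z => by
    rw [mul_pow, ← mul_assoc, ENNReal.ofReal_mul (by positivity), ENNReal.ofReal_pow (norm_nonneg _),
      ofReal_norm]
  have e2 : ∀ z, ENNReal.ofReal (w⁻¹ ^ n * ‖H z‖ ^ 2) =
      ENNReal.ofReal (w⁻¹ ^ n) * ‖H z‖ₑ ^ 2 := fun z => by
    rw [ENNReal.ofReal_mul (by positivity), ENNReal.ofReal_pow (norm_nonneg _), ofReal_norm]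
  simp only [e1, e2]
  rw [lintegral_const_mul' _ _ ENNReal.ofReal_ne_top, lintegral_const_mul' _ _ ENNReal.ofReal_ne_top]
  ring

/-- The monomials that come up in the integration by parts. -/
def coordMono (i : Option (Fin n × ℕ)) (z : RSpace n) : ℂ :=
  i.elim 1 fun p => (Complex.I * (z p.1 : ℂ)) ^ p.2

/-- The degree of `coordMono`. -/
def coordDeg (i : Option (Fin n × ℕ)) : ℕ := i.elim 0 Prod.snd

theorem norm_coordMono_le (i : Option (Fin n × ℕ)) (z : RSpace n) :
    ‖coordMono i z‖ ≤ ‖z‖ ^ coordDeg i := by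
  cases i with
  | none => simp [coordMono, coordDeg]
  | some p =>
    simp only [coordMono, coordDeg, Option.elim, norm_pow, norm_mul, Complex.norm_I, one_mul,
      Complex.norm_real]
    exact pow_le_pow_left₀ (norm_nonneg _) (norm_coord_le z p.1) _

end FixedFrequency

/-! ### The integral in the space variable at a fixed frequency -/

section FixedFrequencyEstimate

variable {n : ℕ} (M : ℕ)

/-- The terms of the quadratic estimate for a fixed frequency. -/
def quadTerms (w : ℝ) (l : ℕ) (G S : RSpace n → ℂ) : ENNReal :=
  (∑ q ∈ Finset.range (2 * M + 1),
    ∫⁻ z, ENNReal.ofReal (w ^ n * (w⁻¹ ^ (l + q) * (‖z‖ ^ q * ‖G z‖)) ^ 2)) +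
  ∫⁻ z, ENNReal.ofReal (w⁻¹ ^ n * (wgt M w⁻¹ z * ‖S z‖) ^ 2)

theorem sum_option_le_quadTerms {w : ℝ} (hw : 0 < w) (l : ℕ) (G S : RSpace n → ℂ) :
    ∑ i : Option (Fin n × Fin (2 * M + 1)),
      ((∫⁻ z, ENNReal.ofReal (w ^ n * (w⁻¹ ^ (l + coordDeg (i.map fun p => (p.1, (p.2 : ℕ)))) *
        ‖coordMono (i.map fun p => (p.1, (p.2 : ℕ))) z * G z‖) ^ 2)) +
        ∫⁻ z, ENNReal.ofReal (w⁻¹ ^ n * ‖(wgt M w⁻¹ z : ℂ) * S z‖ ^ 2)) ≤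
      ENNReal.ofReal (n * (2 * M + 1) + 1) * quadTerms M w l G S := by
  have h : ∀ i : Option (Fin n × Fin (2 * M + 1)),
      ((∫⁻ z, ENNReal.ofReal (w ^ n * (w⁻¹ ^ (l + coordDeg (i.map fun p => (p.1, (p.2 : ℕ)))) *
        ‖coordMono (i.map fun p => (p.1, (p.2 : ℕ))) z * G z‖) ^ 2)) +
        ∫⁻ z, ENNReal.ofReal (w⁻¹ ^ n * ‖(wgt M w⁻¹ z : ℂ) * S z‖ ^ 2)) ≤
      quadTerms M w l G S := by
    intro i
    have hdeg : coordDeg (i.map fun p => (p.1, (p.2 : ℕ))) ∈ Finset.range (2 * M + 1) := by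
      rw [Finset.mem_range]
      cases i with
      | none => simp [coordDeg]
      | some p => exact p.2.2
    refine add_le_add (le_trans (lintegral_mono fun z => ENNReal.ofReal_le_ofReal ?_)
      (Finset.single_le_sum (f := fun q => ∫⁻ z, ENNReal.ofReal
        (w ^ n * (w⁻¹ ^ (l + q) * (‖z‖ ^ q * ‖G z‖)) ^ 2)) (fun _ _ => zero_le) hdeg))
      (le_of_eq (lintegral_congr fun z => ?_))
    · rw [norm_mul]
      have := norm_coordMono_le (i.map fun p => (p.1, (p.2 : ℕ))) z
      gcongr
    · rw [norm_mul, Complex.norm_real, Real.norm_of_nonneg (wgt_pos M _ z).le]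
  refine (Finset.sum_le_sum fun i _ => h i).trans (le_of_eq ?_)
  rw [Finset.sum_const, nsmul_eq_mul]
  congr 1
  rw [Finset.card_univ, Fintype.card_option, Fintype.card_prod, Fintype.card_fin, Fintype.card_fin,
    ← ENNReal.ofReal_natCast]
  push_cast
  ring_nf

/-- The index `none` carries the term without derivatives, `some (j, q)` the terms in which `q` of
the `2M` derivatives along `j` fall on the transform of `G`. The other `2M - q` fall on `A` and are
absorbed by the powers of `w⁻¹`. -/
theorem fixedFrequency_pointwise {w A₀ : ℝ} (hw : 0 < w) (l : ℕ) {A G : RSpace n → ℂ} {H : ℂ}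
    {x : RSpace n} (hA0 : ‖A x‖ ≤ A₀ * w⁻¹ ^ l)
    (hA : ∀ j, ∀ p ≤ 2 * M, ‖(partialD j)^[p] A x‖ ≤ A₀ * w⁻¹ ^ l * w ^ p) :
    ‖(A x * osc G x + ∑ j, (-1) ^ M * ((w⁻¹ : ℝ) : ℂ) ^ (2 * M) *
      jetMul (fun p => (partialD j)^[p] A)
        (fun q => osc fun z => (Complex.I * (z j : ℂ)) ^ q * G z) (2 * M) x) * H‖ ≤
    (2 ^ (2 * M) * A₀) * ∑ i : Option (Fin n × Fin (2 * M + 1)),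
      w⁻¹ ^ (l + coordDeg (i.map fun p => (p.1, (p.2 : ℕ)))) *
        ‖osc (fun z => coordMono (i.map fun p => (p.1, (p.2 : ℕ))) z * G z) x‖ * ‖H‖ := by
  have hA₀ : 0 ≤ A₀ := by
    have := (norm_nonneg _).trans hA0
    exact nonneg_of_mul_nonneg_left this (by positivity)
  rw [norm_mul, ← Finset.sum_mul, ← mul_assoc, Fintype.sum_option, Fintype.sum_prod_type, mul_add]
  refine mul_le_mul_of_nonneg_right ((norm_add_le _ _).trans (add_le_add ?_ ?_)) (norm_nonneg _)
  · simp only [Option.map_none, coordDeg, coordMono, Option.elim, one_mul, add_zero]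
    rw [norm_mul, ← mul_assoc]
    refine mul_le_mul_of_nonneg_right (hA0.trans ?_) (norm_nonneg _)
    rw [mul_assoc]
    exact le_mul_of_one_le_left (by positivity) (one_le_pow₀ (by norm_num))
  · rw [Finset.mul_sum]
    refine (norm_sum_le _ _).trans (Finset.sum_le_sum fun j _ => ?_)
    rw [norm_mul, norm_mul, norm_pow, norm_neg, norm_one, one_pow, one_mul, norm_pow,
      Complex.norm_real, Real.norm_of_nonneg (inv_pos.mpr hw).le]
    refine (norm_jetMul_le_sum hw (hA j)).trans (le_of_eq ?_)
    rw [Finset.sum_range, Finset.mul_sum, Finset.mul_sum]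
    refine Finset.sum_congr rfl fun q _ => ?_
    simp only [Option.map_some, coordDeg, coordMono, Option.elim, pow_add]
    ring

/-- The estimate of the space integral for a fixed frequency. -/
theorem fixedFrequency_estimate {w A₀ : ℝ} (hw : 0 < w) (l : ℕ) {A G : RSpace n → ℂ}
    (hAs : ContDiff ℝ (2 * M : ℕ) A) (hA0 : ∀ x, ‖A x‖ ≤ A₀ * w⁻¹ ^ l)
    (hA : ∀ j, ∀ p ≤ 2 * M, ∀ x, ‖(partialD j)^[p] A x‖ ≤ A₀ * w⁻¹ ^ l * w ^ p)
    (hG : ∀ i, Integrable fun z => coordMono i z * G z)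
    (hG2 : ∀ i, MemLp (fun z => coordMono i z * G z) 2) (S : 𝓢(RSpace n, ℂ)) :
    ‖∫ x, A x * osc G x * osc S x‖ₑ ≤
      ENNReal.ofReal (2 ^ (2 * M) * A₀ * (2 * Real.pi) ^ n * (n * (2 * M + 1) + 1)) *
        quadTerms M w l G S := by
  have hwi : 0 < w⁻¹ := inv_pos.mpr hw
  have hA₀ : 0 ≤ A₀ := nonneg_of_mul_nonneg_left ((norm_nonneg _).trans (hA0 0)) (by positivity)
  have hGj : ∀ (j : Fin n) (q : ℕ),
      Integrable fun z : RSpace n => (Complex.I * (z j : ℂ)) ^ q * G z := fun j q => hG (some (j, q))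
  have hG0 : Integrable G := by simpa [coordMono] using hG none
  have hcA : ∀ j, ∀ p ≤ 2 * M, Continuous ((partialD j)^[p] A) := fun j p hp =>
    iterate_partialD_continuous hp j hAs
  have hcO : ∀ (j : Fin n) (q : ℕ),
      Continuous (osc fun z : RSpace n => (Complex.I * (z j : ℂ)) ^ q * G z) := fun j q =>
    continuous_osc (hGj j q)
  have hcJ : ∀ j, ∀ p ≤ 2 * M, Continuous (jetMul (fun p => (partialD j)^[p] A)
      (fun q => osc fun z => (Complex.I * (z j : ℂ)) ^ q * G z) p) := by
    intro j p hp
    unfold jetMul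
    refine continuous_finsetSum _ fun r hr => ?_
    rw [Finset.HasAntidiagonal.mem_antidiagonal] at hr
    exact continuous_const.mul ((hcA j r.1 (by omega)).mul (hcO j r.2))
  have hbJ : ∀ j, ∀ p ≤ 2 * M, ∃ C : ℝ, ∀ x, ‖jetMul (fun p => (partialD j)^[p] A)
      (fun q => osc fun z => (Complex.I * (z j : ℂ)) ^ q * G z) p x‖ ≤ C := by
    intro j p hp
    refine ⟨_, fun x => norm_jetMul_le
      (A := ∑ r ∈ Finset.range (p + 1), A₀ * w⁻¹ ^ l * w ^ r)
      (B := ∑ r ∈ Finset.range (p + 1), ∫ z : RSpace n, ‖(Complex.I * (z j : ℂ)) ^ r * G z‖)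
      (fun r hr => ?_) fun r hr => ?_⟩
    · exact (hA j r (by omega) x).trans (Finset.single_le_sum
        (f := fun r => A₀ * w⁻¹ ^ l * w ^ r) (fun r _ => by positivity)
        (Finset.mem_range.mpr (by omega)))
    · exact (norm_osc_le _ _).trans (Finset.single_le_sum
        (f := fun r => ∫ z : RSpace n, ‖(Complex.I * (z j : ℂ)) ^ r * G z‖)
        (fun r _ => integral_nonneg fun _ => norm_nonneg _) (Finset.mem_range.mpr (by omega)))
  have hQ : ∀ (j : Fin n) (q : ℕ), Integrable (fun z : RSpace n => (Complex.I * (z j : ℂ)) ^ q *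
      ((wgt M w⁻¹ z : ℂ) * S z)) ∧ Integrable (osc fun z : RSpace n =>
        (Complex.I * (z j : ℂ)) ^ q * ((wgt M w⁻¹ z : ℂ) * S z)) := by
    intro j q
    obtain ⟨T, hT⟩ := exists_schwartz_coord_mul S j q
    have : (fun z : RSpace n => (Complex.I * (z j : ℂ)) ^ q * ((wgt M w⁻¹ z : ℂ) * S z)) =
        fun z => (wgt M w⁻¹ z : ℂ) * T z := by
      funext z
      rw [hT]
      ring
    rw [this]
    exact ⟨integrable_wgt_mul M T, integrable_osc_wgt_mul M hwi T⟩
  -- The weight is dilated by `w`, so that the `2M` derivatives of the amplitude come with the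
  -- factor `w^{-2M}` that compensates their growth.
  have key := integral_mul_osc_weight M (c := w⁻¹) (h := S) (a₀ := fun x => A x * osc G x)
    (a := fun j => jetMul (fun p => (partialD j)^[p] A)
      (fun q => osc fun z => (Complex.I * (z j : ℂ)) ^ q * G z))
    (fun j => (IsJet.of_contDiff j hAs).jetMul (isJet_osc j _ fun i _ => hGj j i))
    (fun j => by funext x; rw [jetMul_zero]; simp) (integrable_wgt_mul M S) (fun j i _ => (hQ j i).1)
    ?_ fun j p q hpq => ?_
  · rw [key]
    have hpt := fun x => fixedFrequency_pointwise M (x := x) (G := G)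
      (H := osc (fun z => (wgt M w⁻¹ z : ℂ) * S z) x) hw l (hA0 x) fun j p hp => hA j p hp x
    have hL := lintegral_le_of_osc_mul_osc
      (G := fun (i : Option (Fin n × Fin (2 * M + 1))) z =>
        coordMono (i.map fun p => (p.1, (p.2 : ℕ))) z * G z)
      (b := fun i => w⁻¹ ^ (l + coordDeg (i.map fun p => (p.1, (p.2 : ℕ)))))
      (D := 2 ^ (2 * M) * A₀) (by positivity) hw (fun i => hG _) (fun i => hG2 _)
      (integrable_wgt_mul M S) (memLp_wgt_mul M S) hpt
    refine (enorm_integral_le_lintegral_enorm _).trans (hL.trans ?_)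
    refine (mul_le_mul_right (sum_option_le_quadTerms M hw l G S) _).trans (le_of_eq ?_)
    rw [← mul_assoc, ← ENNReal.ofReal_mul (by positivity)]
  · refine (integrable_osc_wgt_mul M hwi S).bdd_mul (c := A₀ * w⁻¹ ^ l * ∫ z, ‖G z‖) ?_
      (Filter.Eventually.of_forall fun x => ?_)
    · exact (hAs.continuous.mul (continuous_osc hG0)).aestronglyMeasurable
    · rw [norm_mul]
      exact mul_le_mul (hA0 x) (norm_osc_le _ _) (norm_nonneg _) (by positivity)
  · obtain ⟨C, hC⟩ := hbJ j p (by omega)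
    exact (hQ j q).2.bdd_mul (hcJ j p (by omega)).aestronglyMeasurable
      (Filter.Eventually.of_forall hC)

end FixedFrequencyEstimate

/-! ### Localising the frequency integral -/

section FrequencyLocalization

variable {n : ℕ} {δ R : ℝ}

theorem schwartz_decay (F : 𝓢(RSpace n, ℂ)) (k : ℕ) :
    ∃ C : ℝ, 0 ≤ C ∧ ∀ ζ, (1 + ‖ζ‖) ^ k * ‖F ζ‖ ≤ C := by
  have h := fun ζ => SchwartzMap.one_add_le_sup_seminorm_apply (𝕜 := ℝ) (m := (k, 0)) (k := k)
    (n := 0) le_rfl le_rfl F ζ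
  simp only [norm_iteratedFDeriv_zero] at h
  exact ⟨_, (by positivity : (0 : ℝ) ≤ _).trans (h 0), h⟩

theorem abs_locKernel_le_const (hδ : 0 ≤ δ) (hR : 0 ≤ R) (J : Finset (Fin n)) (ξ ζ : RSpace n) :
    |locKernel δ R J ξ ζ| ≤ (2 * (n + 1)) ^ n := by
  have hw := scale_pos (δ := δ) hR ζ
  have hJ : J.card ≤ n := by simpa using Finset.card_le_univ J
  have h1 : (1 : ℝ) ≤ 2 * (n + 1) := by
    have : (0 : ℝ) ≤ n := Nat.cast_nonneg n
    linarith
  calc _ ≤ scale δ R ζ ^ J.card * (scale δ R ζ)⁻¹ ^ n := abs_locKernel_le hR J ξ ζ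
    _ = (scale δ R ζ * (scale δ R ζ)⁻¹) ^ J.card * (scale δ R ζ)⁻¹ ^ (n - J.card) := by
        rw [mul_pow, mul_assoc, ← pow_add, Nat.add_sub_cancel' hJ]
    _ = (scale δ R ζ)⁻¹ ^ (n - J.card) := by rw [mul_inv_cancel₀ hw.ne', one_pow, one_mul]
    _ ≤ (2 * (n + 1)) ^ (n - J.card) :=
        pow_le_pow_left₀ (by positivity) (inv_scale_le hδ hR ζ) _
    _ ≤ _ := pow_le_pow_right₀ h1 (Nat.sub_le _ _)

/-- On the support of the kernel `1 + |ξ| ≤ 2(1 + R)(1 + |ζ|)`, so the decay of `F` in `ζ` can be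
shared between both variables. The constant depends on `R`; the bound only justifies Fubini. -/
theorem locKernel_mul_decay (hδ : 0 ≤ δ) (hδ1 : δ ≤ 1) (hR : 0 ≤ R) (F : 𝓢(RSpace n, ℂ)) :
    ∃ C : ℝ, 0 ≤ C ∧ ∀ (J : Finset (Fin n)) (ξ ζ : RSpace n), ‖(locKernel δ R J ξ ζ : ℂ) * F ζ‖ ≤
      C * ((1 + ‖ξ‖) ^ (-((n : ℝ) + 1)) * (1 + ‖ζ‖) ^ (-((n : ℝ) + 1))) := by
  obtain ⟨C, hC0, hC⟩ := schwartz_decay F (2 * (n + 1))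
  refine ⟨(2 * (n + 1)) ^ n * (2 * (1 + R)) ^ (n + 1) * C, by positivity, fun J ξ ζ => ?_⟩
  by_cases h : locKernel δ R J ξ ζ = 0
  · rw [h]
    simp only [Complex.ofReal_zero, zero_mul, norm_zero]
    positivity
  obtain ⟨-, h2⟩ := norm_sub_le_of_locKernel_ne_zero hδ1 hR h
  have h3 := (one_add_norm_comparable hR h2 le_rfl).1
  have hz := norm_nonneg ζ
  have h4 : 1 + ‖ξ‖ ≤ 2 * (1 + R) * (1 + ‖ζ‖) := by nlinarith
  have hp : ∀ y : RSpace n, (1 + ‖y‖) ^ (-((n : ℝ) + 1)) = ((1 + ‖y‖) ^ (n + 1))⁻¹ := fun y => by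
    rw [Real.rpow_neg (by positivity)]
    congr 1
    rw [← Real.rpow_natCast, Nat.cast_add, Nat.cast_one]
  have h5 := pow_le_pow_left₀ (by positivity) h4 (n + 1)
  rw [mul_pow] at h5
  have h6 := hC ζ
  rw [norm_mul, Complex.norm_real, Real.norm_eq_abs, hp, hp, ← mul_inv, ← div_eq_mul_inv,
    le_div_iff₀ (by positivity)]
  calc |locKernel δ R J ξ ζ| * ‖F ζ‖ * ((1 + ‖ξ‖) ^ (n + 1) * (1 + ‖ζ‖) ^ (n + 1))
      ≤ (2 * (n + 1)) ^ n * ‖F ζ‖ *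
        ((2 * (1 + R)) ^ (n + 1) * (1 + ‖ζ‖) ^ (n + 1) * (1 + ‖ζ‖) ^ (n + 1)) := by
        have := abs_locKernel_le_const hδ hR J ξ ζ
        gcongr
    _ = (2 * (n + 1)) ^ n * (2 * (1 + R)) ^ (n + 1) * ((1 + ‖ζ‖) ^ (2 * (n + 1)) * ‖F ζ‖) := by
        rw [two_mul (n + 1), pow_add (1 + ‖ζ‖)]
        ring
    _ ≤ _ := by gcongr

/-- A symbol together with its mixed frequency derivatives of order at most one in each variable,
adapted to the frequency scale. -/
structure ScaleSymbol (δ R : ℝ) (m : ℕ) (A₀ : ℝ)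
    (φ : Finset (Fin n) → RSpace n → RSpace n → ℂ) : Prop where
  line : ∀ x J, ∀ i ∉ J, ∀ ξ, HasLineDerivAt ℝ (φ J x) (φ (insert i J) x ξ) ξ
    (EuclideanSpace.single i 1)
  cont : ∀ J, Continuous fun p : RSpace n × RSpace n => φ J p.1 p.2
  smooth : ∀ J ξ, ContDiff ℝ m fun x => φ J x ξ
  bound₀ : ∀ J x ξ, ‖φ J x ξ‖ ≤ A₀ * (scale δ R ξ)⁻¹ ^ J.card
  bound : ∀ J ξ j, ∀ p ≤ m, ∀ x, ‖(partialD j)^[p] (fun x => φ J x ξ) x‖ ≤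
    A₀ * (scale δ R ξ)⁻¹ ^ J.card * scale δ R ξ ^ p

variable {m : ℕ} {A₀ : ℝ} {φ : Finset (Fin n) → RSpace n → RSpace n → ℂ}

theorem ScaleSymbol.nonneg (hR : 0 ≤ R) (h : ScaleSymbol δ R m A₀ φ) : 0 ≤ A₀ :=
  nonneg_of_mul_nonneg_left ((norm_nonneg _).trans (h.bound₀ ∅ 0 0))
    (by have := scale_pos (δ := δ) hR (0 : RSpace n); positivity)

theorem ScaleSymbol.norm_le (hδ : 0 ≤ δ) (hR : 0 ≤ R) (h : ScaleSymbol δ R m A₀ φ)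
    (J : Finset (Fin n)) (x ξ : RSpace n) : ‖φ J x ξ‖ ≤ A₀ * (2 * (n + 1)) ^ n := by
  have hw := scale_pos (δ := δ) hR ξ
  have hJ : J.card ≤ n := by simpa using Finset.card_le_univ J
  have h1 : (1 : ℝ) ≤ 2 * (n + 1) := by
    have : (0 : ℝ) ≤ n := Nat.cast_nonneg n
    linarith
  refine (h.bound₀ J x ξ).trans (mul_le_mul_of_nonneg_left ?_ (h.nonneg hR))
  exact (pow_le_pow_left₀ (by positivity) (inv_scale_le hδ hR ξ) _).trans
    (pow_le_pow_right₀ h1 hJ)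

theorem measurable_localized (hR : 0 ≤ R) (F : 𝓢(RSpace n, ℂ)) (J : Finset (Fin n)) :
    Measurable fun p : RSpace n × RSpace n => (locKernel δ R J p.1 p.2 : ℂ) * F p.2 :=
  (Complex.measurable_ofReal.comp (measurable_locKernel hR J)).mul
    (F.continuous.measurable.comp measurable_snd)

theorem integrable_decay_prod : Integrable fun p : RSpace n × RSpace n =>
    (1 + ‖p.1‖) ^ (-((n : ℝ) + 1)) * (1 + ‖p.2‖) ^ (-((n : ℝ) + 1)) :=
  integrable_one_add_norm_rpow.mul_prod integrable_one_add_norm_rpow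

theorem integrable_localized (hδ : 0 ≤ δ) (hδ1 : δ ≤ 1) (hR : 0 ≤ R) (F : 𝓢(RSpace n, ℂ))
    (J : Finset (Fin n)) (ξ : RSpace n) :
    Integrable fun ζ => (locKernel δ R J ξ ζ : ℂ) * F ζ := by
  obtain ⟨C, -, hC⟩ := locKernel_mul_decay hδ hδ1 hR F
  refine ((integrable_one_add_norm_rpow (n := n)).const_mul
    (C * (1 + ‖ξ‖) ^ (-((n : ℝ) + 1)))).mono' ?_ (Filter.Eventually.of_forall fun ζ => ?_)
  · exact ((measurable_localized (δ := δ) hR F J).comp measurable_prodMk_left).aestronglyMeasurable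
  · rw [mul_assoc]
    exact hC J ξ ζ

/-- The frequency integral in terms of localized oscillatory integrals. -/
theorem ScaleSymbol.integral_eq_sum (hδ : 0 ≤ δ) (hδ1 : δ ≤ 1) (hR : 0 ≤ R)
    (h : ScaleSymbol δ R m A₀ φ) (F : 𝓢(RSpace n, ℂ)) (x : RSpace n) :
    ∫ ζ, φ ∅ x ζ * (expi x ζ * F ζ) =
      ∑ J, ∫ ξ, φ J x ξ * osc (fun ζ => (locKernel δ R J ξ ζ : ℂ) * F ζ) x := by
  obtain ⟨C, hC0, hC⟩ := locKernel_mul_decay hδ hδ1 hR F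
  have hA := h.nonneg hR
  have hint : ∀ J, Integrable fun p : RSpace n × RSpace n =>
      φ J x p.2 * (expi x p.1 * ((locKernel δ R J p.2 p.1 : ℂ) * F p.1)) := by
    intro J
    refine ((integrable_decay_prod (n := n)).const_mul (A₀ * (2 * (n + 1)) ^ n * C)).mono' ?_
      (Filter.Eventually.of_forall fun p => ?_)
    · have h1 : Continuous fun p : RSpace n × RSpace n => φ J x p.2 :=
        (h.cont J).comp (by fun_prop : Continuous fun p : RSpace n × RSpace n => (x, p.2))
      have h2 : Continuous fun p : RSpace n × RSpace n => expi x p.1 := by fun_prop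
      exact (h1.measurable.mul (h2.measurable.mul
        ((measurable_localized (δ := δ) hR F J).comp measurable_swap))).aestronglyMeasurable
    · rw [norm_mul, norm_mul, norm_expi, one_mul, mul_assoc (A₀ * (2 * (n + 1)) ^ n)]
      refine mul_le_mul (h.norm_le hδ hR J x p.2) ?_ (norm_nonneg _) (by positivity)
      rw [mul_comm ((1 + ‖p.1‖) ^ _)]
      exact hC J p.2 p.1
  have hbox : ∀ ζ, φ ∅ x ζ * (expi x ζ * F ζ) = ∑ J, ∫ ξ,
      φ J x ξ * (expi x ζ * ((locKernel δ R J ξ ζ : ℂ) * F ζ)) := by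
    intro ζ
    rw [eq_sum_integral_boxKernel (scale_pos (δ := δ) hR ζ) (h.line x) (fun J => (h.cont J).comp
      (by fun_prop : Continuous fun ξ : RSpace n => (x, ξ))) ζ, Finset.sum_mul]
    refine Finset.sum_congr rfl fun J _ => ?_
    rw [← integral_mul_const]
    refine integral_congr_ae (Filter.Eventually.of_forall fun ξ => ?_)
    simp only [locKernel]
    ring
  simp only [hbox]
  rw [integral_finsetSum _ fun J _ => (hint J).integral_prod_left]
  refine Finset.sum_congr rfl fun J _ => ?_
  rw [integral_integral_swap (hint J)]
  refine integral_congr_ae (Filter.Eventually.of_forall fun ξ => ?_)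
  simp only [osc]
  rw [← integral_const_mul]

theorem measurable_osc_localized (hR : 0 ≤ R) (F : 𝓢(RSpace n, ℂ)) (J : Finset (Fin n)) :
    Measurable fun p : RSpace n × RSpace n =>
      osc (fun ζ => (locKernel δ R J p.2 ζ : ℂ) * F ζ) p.1 := by
  have h2 : Continuous fun q : (RSpace n × RSpace n) × RSpace n => expi q.1.1 q.2 := by
    fun_prop
  have h3 : Measurable fun q : (RSpace n × RSpace n) × RSpace n => (q.1.2, q.2) :=
    (measurable_snd.comp measurable_fst).prodMk measurable_snd
  have h4 : Measurable fun q : (RSpace n × RSpace n) × RSpace n =>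
      (locKernel δ R J q.1.2 q.2 : ℂ) * F q.2 := by
    have := (measurable_localized (δ := δ) hR F J).comp h3
    simpa only [Function.comp_def] using this
  have h1 : Measurable fun q : (RSpace n × RSpace n) × RSpace n =>
      expi q.1.1 q.2 * ((locKernel δ R J q.1.2 q.2 : ℂ) * F q.2) := h2.measurable.mul h4
  have h5 : StronglyMeasurable fun q : (RSpace n × RSpace n) × RSpace n =>
      expi q.1.1 q.2 * ((locKernel δ R J q.1.2 q.2 : ℂ) * F q.2) := h1.stronglyMeasurable
  have h6 : StronglyMeasurable fun p : RSpace n × RSpace n =>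
      ∫ ζ, expi p.1 ζ * ((locKernel δ R J p.2 ζ : ℂ) * F ζ) := h5.integral_prod_right'
  exact h6.measurable

/-- After pairing with `k` the integral in `x` is brought inside. There `ξ` is fixed and integration
by parts in `x` at the scale `w(ξ)` becomes possible. -/
theorem ScaleSymbol.form_eq_sum (hδ : 0 ≤ δ) (hδ1 : δ ≤ 1) (hR : 0 ≤ R)
    (h : ScaleSymbol δ R m A₀ φ) (F : 𝓢(RSpace n, ℂ)) {k : RSpace n → ℂ} (hk : Integrable k) :
    ∫ x, k x * ∫ ζ, φ ∅ x ζ * (expi x ζ * F ζ) =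
      ∑ J, ∫ ξ, ∫ x, φ J x ξ * osc (fun ζ => (locKernel δ R J ξ ζ : ℂ) * F ζ) x * k x := by
  obtain ⟨C, hC0, hC⟩ := locKernel_mul_decay hδ hδ1 hR F
  have hA := h.nonneg hR
  set I := ∫ z : RSpace n, (1 + ‖z‖) ^ (-((n : ℝ) + 1)) with hI
  have hI0 : 0 ≤ I := integral_nonneg fun z => by positivity
  have hosc : ∀ J ξ x, ‖osc (fun ζ => (locKernel δ R J ξ ζ : ℂ) * F ζ) x‖ ≤
      C * (1 + ‖ξ‖) ^ (-((n : ℝ) + 1)) * I := by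
    intro J ξ x
    refine (norm_osc_le _ _).trans ?_
    rw [hI, ← integral_const_mul]
    refine integral_mono (integrable_localized hδ hδ1 hR F J ξ).norm
      (integrable_one_add_norm_rpow.const_mul _) fun ζ => ?_
    simp only
    rw [mul_assoc]
    exact hC J ξ ζ
  have hint : ∀ J, Integrable fun p : RSpace n × RSpace n =>
      φ J p.1 p.2 * osc (fun ζ => (locKernel δ R J p.2 ζ : ℂ) * F ζ) p.1 * k p.1 := by
    intro J
    have hdom : Integrable fun p : RSpace n × RSpace n =>
        (A₀ * (2 * (n + 1)) ^ n * C * I) * (‖k p.1‖ * (1 + ‖p.2‖) ^ (-((n : ℝ) + 1))) :=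
      (hk.norm.mul_prod integrable_one_add_norm_rpow).const_mul _
    refine hdom.mono' ?_ (Filter.Eventually.of_forall fun p => ?_)
    · have h3 : AEStronglyMeasurable (fun p : RSpace n × RSpace n => k p.1) volume :=
        hk.aestronglyMeasurable.comp_fst
      exact ((h.cont J).aestronglyMeasurable.mul
        (measurable_osc_localized (δ := δ) hR F J).aestronglyMeasurable).mul h3
    · rw [norm_mul, norm_mul]
      calc _ ≤ (A₀ * (2 * (n + 1)) ^ n) * (C * (1 + ‖p.2‖) ^ (-((n : ℝ) + 1)) * I) * ‖k p.1‖ := by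
            gcongr
            · exact h.norm_le hδ hR J _ _
            · exact hosc J _ _
        _ = _ := by ring
  have e : ∀ x, k x * ∫ ζ, φ ∅ x ζ * (expi x ζ * F ζ) = ∑ J, ∫ ξ,
      φ J x ξ * osc (fun ζ => (locKernel δ R J ξ ζ : ℂ) * F ζ) x * k x := by
    intro x
    rw [h.integral_eq_sum hδ hδ1 hR F x, Finset.mul_sum]
    refine Finset.sum_congr rfl fun J _ => ?_
    rw [mul_comm, ← integral_mul_const]
  simp only [e]
  rw [integral_finsetSum _ fun J _ => (hint J).integral_prod_left]
  exact Finset.sum_congr rfl fun J _ => integral_integral_swap (hint J)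

end FrequencyLocalization

/-! ### The quadratic bound of the form -/

section FormBound

variable {n : ℕ} {δ R : ℝ} {A₀ : ℝ} {φ : Finset (Fin n) → RSpace n → RSpace n → ℂ}

theorem osc_translate (U : RSpace n → ℂ) (ξ x : RSpace n) :
    osc (fun z => U (z + ξ)) x = expi x (-ξ) * osc U x := by
  unfold osc
  rw [← integral_const_mul, ← integral_sub_right_eq_self _ ξ]
  refine integral_congr_ae (Filter.Eventually.of_forall fun ζ => ?_)
  simp only [sub_add_cancel]
  rw [← mul_assoc, ← expi_add_right, sub_eq_neg_add]

/-- The reflection of a Schwartz function. -/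
theorem exists_schwartz_reflect (K : 𝓢(RSpace n, ℂ)) (ξ : RSpace n) :
    ∃ S : 𝓢(RSpace n, ℂ), ∀ z, S z = K (ξ - z) := by
  refine ⟨(dilation (-1) (by norm_num) K).compSubConstCLM ℂ ξ, fun z => ?_⟩
  rw [SchwartzMap.compSubConstCLM_apply, dilation_apply]
  congr 1
  module

/-- The kernel of the quadratic estimate in the first function. -/
def kernelF (δ R : ℝ) (J : Finset (Fin n)) (q : ℕ) (ξ ζ : RSpace n) : ℝ :=
  scale δ R ξ ^ n *
    ((scale δ R ξ)⁻¹ ^ (J.card + q) * (‖ξ - ζ‖ ^ q * |locKernel δ R J ξ ζ|)) ^ 2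

/-- The kernel of the quadratic estimate in the second function. -/
def kernelK (δ R : ℝ) (M : ℕ) (ξ θ : RSpace n) : ℝ :=
  (scale δ R ξ)⁻¹ ^ n * wgt M (scale δ R ξ)⁻¹ (ξ - θ) ^ 2

theorem measurable_kernelF (hR : 0 ≤ R) (J : Finset (Fin n)) (q : ℕ) :
    Measurable fun p : RSpace n × RSpace n => kernelF δ R J q p.1 p.2 := by
  have h1 : Measurable fun p : RSpace n × RSpace n => scale δ R p.1 :=
    (continuous_scale hR).measurable.comp measurable_fst
  have h2 := measurable_locKernel (δ := δ) hR J
  have h3 : Measurable fun p : RSpace n × RSpace n => |locKernel δ R J p.1 p.2| := h2.abs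
  unfold kernelF
  fun_prop

theorem measurable_kernelK (hR : 0 ≤ R) (M : ℕ) :
    Measurable fun p : RSpace n × RSpace n => kernelK δ R M p.1 p.2 := by
  have h1 : Measurable fun p : RSpace n × RSpace n => scale δ R p.1 :=
    (continuous_scale hR).measurable.comp measurable_fst
  unfold kernelK wgt
  fun_prop

theorem kernelF_nonneg (hR : 0 ≤ R) (J : Finset (Fin n)) (q : ℕ) (ξ ζ : RSpace n) :
    0 ≤ kernelF δ R J q ξ ζ := by
  have := scale_pos (δ := δ) hR ξ
  unfold kernelF
  positivity

theorem kernelK_nonneg (hR : 0 ≤ R) (M : ℕ) (ξ θ : RSpace n) : 0 ≤ kernelK δ R M ξ θ := by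
  have := scale_pos (δ := δ) hR ξ
  unfold kernelK
  positivity

theorem quadTerms_localized (hR : 0 ≤ R) (M : ℕ) (J : Finset (Fin n)) (F K S : 𝓢(RSpace n, ℂ))
    (ξ : RSpace n) (hS : ∀ z, S z = K (ξ - z)) :
    quadTerms M (scale δ R ξ) J.card
      (fun z => (locKernel δ R J ξ (z + ξ) : ℂ) * F (z + ξ)) S =
    (∑ q ∈ Finset.range (2 * M + 1), ∫⁻ ζ, ENNReal.ofReal (kernelF δ R J q ξ ζ) * ‖F ζ‖ₑ ^ 2) +
      ∫⁻ θ, ENNReal.ofReal (kernelK δ R M ξ θ) * ‖K θ‖ₑ ^ 2 := by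
  unfold quadTerms
  congr 1
  · refine Finset.sum_congr rfl fun q _ => ?_
    rw [← lintegral_sub_right_eq_self _ ξ]
    refine lintegral_congr fun ζ => ?_
    simp only
    rw [sub_add_cancel, norm_mul, Complex.norm_real, Real.norm_eq_abs, norm_sub_rev, ← ofReal_norm,
      ← ENNReal.ofReal_pow (norm_nonneg _), ← ENNReal.ofReal_mul (kernelF_nonneg hR _ _ _ _),
      kernelF]
    congr 1
    ring
  · rw [← lintegral_sub_left_eq_self _ ξ]
    refine lintegral_congr fun θ => ?_
    rw [hS, sub_sub_cancel, ← ofReal_norm, ← ENNReal.ofReal_pow (norm_nonneg _),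
      ← ENNReal.ofReal_mul (kernelK_nonneg hR _ _ _), kernelK]
    congr 1
    ring

theorem coordMono_mul_schwartz (i : Option (Fin n × ℕ)) (T : 𝓢(RSpace n, ℂ)) :
    ∃ T' : 𝓢(RSpace n, ℂ), ∀ z, coordMono i z * T z = T' z := by
  cases i with
  | none => exact ⟨T, fun z => by simp [coordMono]⟩
  | some p =>
    obtain ⟨T', hT'⟩ := exists_schwartz_coord_mul T p.1 p.2
    exact ⟨T', fun z => (hT' z).symm⟩

/-- Both frequency functions are recentred at `ξ`, one by translation and one by reflection. The
characters `e^{-i x·ξ}` and `e^{i x·ξ}` that this produces cancel, so the pairing is unchanged while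
powers of `z` now measure the distance to `ξ`. -/
theorem ScaleSymbol.fixedFrequency_bound (hδ : 0 ≤ δ) (hR : 0 ≤ R) {M : ℕ}
    (h : ScaleSymbol δ R (2 * M) A₀ φ) (F K : 𝓢(RSpace n, ℂ)) (J : Finset (Fin n)) (ξ : RSpace n) :
    ‖∫ x, φ J x ξ * osc (fun ζ => (locKernel δ R J ξ ζ : ℂ) * F ζ) x * fourierHat K x‖ₑ ≤
      ENNReal.ofReal (2 ^ (2 * M) * A₀ * (2 * Real.pi) ^ n * (n * (2 * M + 1) + 1)) *
      ((∑ q ∈ Finset.range (2 * M + 1), ∫⁻ ζ, ENNReal.ofReal (kernelF δ R J q ξ ζ) * ‖F ζ‖ₑ ^ 2) +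
      ∫⁻ θ, ENNReal.ofReal (kernelK δ R M ξ θ) * ‖K θ‖ₑ ^ 2) := by
  obtain ⟨S, hS⟩ := exists_schwartz_reflect K ξ
  have hmeas : Measurable fun z : RSpace n => (locKernel δ R J ξ (z + ξ) : ℂ) := by
    have h1 : Measurable fun z : RSpace n => (ξ, z + ξ) := by fun_prop
    have h2 := (measurable_locKernel (δ := δ) hR J).comp h1
    have h3 : Measurable fun z : RSpace n => locKernel δ R J ξ (z + ξ) := by
      simpa only [Function.comp_def] using h2
    exact Complex.measurable_ofReal.comp h3
  have hbdd : ∀ z : RSpace n, ‖(locKernel δ R J ξ (z + ξ) : ℂ)‖ ≤ (2 * (n + 1)) ^ n := fun z => by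
    rw [Complex.norm_real]
    exact abs_locKernel_le_const hδ hR J ξ _
  have hT : ∀ i, ∃ T' : 𝓢(RSpace n, ℂ), (fun z => coordMono i z *
      ((locKernel δ R J ξ (z + ξ) : ℂ) * F (z + ξ))) =
      fun z => (locKernel δ R J ξ (z + ξ) : ℂ) * T' z := by
    intro i
    obtain ⟨T', hT'⟩ := coordMono_mul_schwartz i (F.compSubConstCLM ℂ (-ξ))
    refine ⟨T', ?_⟩
    funext z
    rw [← hT', SchwartzMap.compSubConstCLM_apply, sub_neg_eq_add]
    ring
  have key := fixedFrequency_estimate M (scale_pos (δ := δ) hR ξ) J.card (A := fun x => φ J x ξ)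
    (G := fun z => (locKernel δ R J ξ (z + ξ) : ℂ) * F (z + ξ))
    (h.smooth J ξ) (fun x => h.bound₀ J x ξ) (fun j p hp x => h.bound J ξ j p hp x)
    (fun i => ?_) (fun i => ?_) S
  · rw [quadTerms_localized hR M J F K S ξ hS] at key
    refine le_of_eq_of_le (congrArg _ (integral_congr_ae
      (Filter.Eventually.of_forall fun x => ?_))) key
    have e1 : osc (S : RSpace n → ℂ) x = fourierHat K x * expi ξ x := by
      rw [← osc_reflect]
      congr 1
      funext z
      exact hS z
    have e2 : expi x (-ξ) * expi ξ x = 1 := by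
      rw [expi_comm ξ, ← expi_add_right]
      simp [expi]
    simp only
    rw [osc_translate (fun ζ => (locKernel δ R J ξ ζ : ℂ) * F ζ), e1]
    linear_combination (-φ J x ξ * osc (fun ζ => (locKernel δ R J ξ ζ : ℂ) * F ζ) x *
      fourierHat K x) * e2
  · obtain ⟨T', hT'⟩ := hT i
    rw [hT']
    have hTi : Integrable (T' : RSpace n → ℂ) := T'.integrable
    exact hTi.bdd_mul hmeas.aestronglyMeasurable (Filter.Eventually.of_forall hbdd)
  · obtain ⟨T', hT'⟩ := hT i
    rw [hT']
    have hTi : MemLp (T' : RSpace n → ℂ) 2 volume := T'.memLp 2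
    refine hTi.of_le_mul (c := (2 * (n + 1)) ^ n)
      (hmeas.mul T'.continuous.measurable).aestronglyMeasurable
      (Filter.Eventually.of_forall fun z => ?_)
    rw [norm_mul]
    exact mul_le_mul_of_nonneg_right (hbdd z) (norm_nonneg _)

/-- Tonelli. The estimate is already quadratic in `F`, so only the integral of the kernel in `ξ`
matters. -/
theorem lintegral_kernel_le {κ : RSpace n → RSpace n → ℝ}
    (hκ : Measurable fun p : RSpace n × RSpace n => κ p.1 p.2) {C : ℝ}
    (hC : ∀ ζ, ∫⁻ ξ, ENNReal.ofReal (κ ξ ζ) ≤ ENNReal.ofReal C) (F : 𝓢(RSpace n, ℂ)) :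
    ∫⁻ ξ, ∫⁻ ζ, ENNReal.ofReal (κ ξ ζ) * ‖F ζ‖ₑ ^ 2 ≤
      ENNReal.ofReal C * ∫⁻ ζ, ‖F ζ‖ₑ ^ 2 := by
  have hF : Measurable fun ζ => ‖F ζ‖ₑ ^ 2 := F.continuous.measurable.enorm.pow_const 2
  rw [lintegral_lintegral_swap ((hκ.ennreal_ofReal.mul (hF.comp measurable_snd)).aemeasurable),
    ← lintegral_const_mul _ hF]
  refine lintegral_mono fun ζ => ?_
  rw [lintegral_mul_const]
  · exact mul_le_mul_left (hC ζ) _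
  · exact (hκ.comp measurable_prodMk_right).ennreal_ofReal

/-- The quadratic bound of the form of an operator, uniformly in `R`. -/
theorem exists_form_bound (hδ : 0 ≤ δ) (hδ1 : δ ≤ 1) (M : ℕ)
    (hM : (n : ℝ) + 1 ≤ (1 - δ) * (2 * M : ℕ)) :
    ∃ C : ℝ, 0 ≤ C ∧ ∀ (R A₀ : ℝ) (φ : Finset (Fin n) → RSpace n → RSpace n → ℂ), 0 ≤ R →
      ScaleSymbol δ R (2 * M) A₀ φ → ∀ F K : 𝓢(RSpace n, ℂ),
        ‖∫ x, fourierHat K x * ∫ ζ, φ ∅ x ζ * (expi x ζ * F ζ)‖ₑ ≤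
          ENNReal.ofReal (C * A₀) * ((∫⁻ ζ, ‖F ζ‖ₑ ^ 2) + ∫⁻ θ, ‖K θ‖ₑ ^ 2) := by
  choose CF hCF using fun q => exists_schur_locKernel (n := n) hδ hδ1 q
  obtain ⟨CK, hCK⟩ := exists_schur_wgt (n := n) hδ hδ1 M hM
  set D : ℝ := 2 ^ (2 * M) * (2 * Real.pi) ^ n * (n * (2 * M + 1) + 1) with hD
  have hD0 : 0 ≤ D := by positivity
  set E : ℝ := (∑ q ∈ Finset.range (2 * M + 1), |CF q|) + |CK| with hE
  have hE0 : 0 ≤ E := by positivity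
  -- `2^n` counts the subsets `J`, `D` is the constant at fixed frequency, and `E` collects the
  -- constants of the Schur estimates.
  refine ⟨2 ^ n * (D * E), by positivity, fun R A₀ φ hR h F K => ?_⟩
  have hA := h.nonneg hR
  have hk : Integrable (fun x => fourierHat K x) := by
    have : Integrable (fourierHatS K : RSpace n → ℂ) := (fourierHatS K).integrable
    exact this.congr (Filter.Eventually.of_forall fun x => fourierHatS_apply K x)
  rw [h.form_eq_sum hδ hδ1 hR F hk]
  set N := (∫⁻ ζ, ‖F ζ‖ₑ ^ 2) + ∫⁻ θ, ‖K θ‖ₑ ^ 2 with hN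
  have hJ : ∀ J, ‖∫ ξ, ∫ x, φ J x ξ * osc (fun ζ => (locKernel δ R J ξ ζ : ℂ) * F ζ) x *
      fourierHat K x‖ₑ ≤ ENNReal.ofReal (D * A₀ * E) * N := by
    intro J
    have hmF : ∀ q, Measurable fun ξ => ∫⁻ ζ, ENNReal.ofReal (kernelF δ R J q ξ ζ) * ‖F ζ‖ₑ ^ 2 :=
      fun q => Measurable.lintegral_prod_right'
        (f := fun p : RSpace n × RSpace n => ENNReal.ofReal (kernelF δ R J q p.1 p.2) * ‖F p.2‖ₑ ^ 2)
        ((measurable_kernelF hR J q).ennreal_ofReal.mul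
          ((F.continuous.measurable.comp measurable_snd).enorm.pow_const 2))
    refine (enorm_integral_le_lintegral_enorm _).trans
      ((lintegral_mono fun ξ => h.fixedFrequency_bound hδ hR F K J ξ).trans ?_)
    rw [lintegral_const_mul' _ _ ENNReal.ofReal_ne_top,
      lintegral_add_left (Finset.measurable_sum _ fun q _ => hmF q),
      lintegral_finsetSum _ fun q _ => hmF q]
    have e1 : ∑ q ∈ Finset.range (2 * M + 1), ∫⁻ ξ, ∫⁻ ζ,
        ENNReal.ofReal (kernelF δ R J q ξ ζ) * ‖F ζ‖ₑ ^ 2 ≤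
        ENNReal.ofReal (∑ q ∈ Finset.range (2 * M + 1), |CF q|) * N := by
      rw [ENNReal.ofReal_sum_of_nonneg fun _ _ => abs_nonneg _, Finset.sum_mul]
      refine Finset.sum_le_sum fun q _ => ?_
      refine (lintegral_kernel_le (measurable_kernelF hR J q) (fun ζ => hCF q R hR J ζ) F).trans ?_
      exact mul_le_mul' (ENNReal.ofReal_le_ofReal (le_abs_self _)) le_self_add
    have e2 : ∫⁻ ξ, ∫⁻ θ, ENNReal.ofReal (kernelK δ R M ξ θ) * ‖K θ‖ₑ ^ 2 ≤
        ENNReal.ofReal |CK| * N := by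
      refine (lintegral_kernel_le (measurable_kernelK hR M) (fun θ => hCK R hR θ) K).trans ?_
      exact mul_le_mul' (ENNReal.ofReal_le_ofReal (le_abs_self _)) le_add_self
    calc _ ≤ ENNReal.ofReal (D * A₀) *
          (ENNReal.ofReal (∑ q ∈ Finset.range (2 * M + 1), |CF q|) * N +
            ENNReal.ofReal |CK| * N) := by
          refine mul_le_mul' (ENNReal.ofReal_le_ofReal (le_of_eq ?_)) (add_le_add e1 e2)
          rw [hD]
          ring
      _ = _ := by
          rw [← add_mul, ← ENNReal.ofReal_add (by positivity) (by positivity), ← mul_assoc,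
            ← ENNReal.ofReal_mul (by positivity)]
  refine (enorm_sum_le _ _).trans ((Finset.sum_le_sum fun J _ => hJ J).trans (le_of_eq ?_))
  rw [Finset.sum_const, nsmul_eq_mul, Finset.card_univ, Fintype.card_finset, Fintype.card_fin,
    ← mul_assoc, ← ENNReal.ofReal_natCast, ← ENNReal.ofReal_mul (by positivity)]
  congr 2
  push_cast
  ring

end FormBound

/-! ### The operators with a frozen second frequency -/

section FreqOp

variable {n : ℕ} {ρ δ : ℝ} {σ : RSpace n → RSpace n → RSpace n → ℂ}

/-- The indicator of a finite set as a multi-index. -/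
def indIdx {n : ℕ} (J : Finset (Fin n)) : Fin n → ℕ := fun i => if i ∈ J then 1 else 0

theorem order_indIdx (J : Finset (Fin n)) : order (indIdx J) = J.card := by
  simp [order, indIdx]

theorem indIdx_empty : indIdx (∅ : Finset (Fin n)) = 0 := by
  funext i
  simp [indIdx]

theorem indIdx_insert {J : Finset (Fin n)} {i : Fin n} (hi : i ∉ J) :
    indIdx (insert i J) = indIdx J + Pi.single i 1 := by
  funext k
  by_cases h : k = i
  · subst h
    simp [indIdx, hi]
  · simp [indIdx, h]

theorem scale_eq {R : ℝ} (ξ : RSpace n) :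
    (1 + ‖ξ‖ + R) ^ δ = 2 * (n + 1) * scale δ R ξ := by
  unfold scale
  rw [mul_div_cancel₀ _ (by positivity), add_right_comm]

/-- The hypothesis `δ ≤ ρ` replaces the gain `W^{-ρl}` by the weaker `W^{-δl}`, after which only the
scale `W^δ = c w` occurs. -/
theorem symbol_weight_le (hδρ : δ ≤ ρ) {W : ℝ} (hW : 1 ≤ W) {w c : ℝ} (hc : 1 ≤ c) (hw : 0 < w)
    (h : W ^ δ = c * w) {p m l : ℕ} (hp : p ≤ m) :
    W ^ (0 + δ * p - ρ * (l + (0 : ℕ))) ≤ c ^ m * (w⁻¹ ^ l * w ^ p) := by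
  have hW0 : 0 < W := by linarith
  have hl : δ * (l : ℝ) ≤ ρ * l := mul_le_mul_of_nonneg_right hδρ (Nat.cast_nonneg l)
  calc W ^ (0 + δ * p - ρ * (l + (0 : ℕ))) ≤ W ^ (δ * p - δ * l) := by
        refine Real.rpow_le_rpow_of_exponent_le hW ?_
        push_cast
        linarith
    _ = (c * w) ^ p * ((c * w) ^ l)⁻¹ := by
        rw [Real.rpow_sub hW0, Real.rpow_mul hW0.le, Real.rpow_mul hW0.le, h, Real.rpow_natCast,
          Real.rpow_natCast, div_eq_mul_inv]
    _ = c ^ p * (c ^ l)⁻¹ * (w⁻¹ ^ l * w ^ p) := by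
        rw [mul_pow, mul_pow, mul_inv, inv_pow]
        ring
    _ ≤ _ := by
        refine mul_le_mul_of_nonneg_right ?_ (by positivity)
        calc c ^ p * (c ^ l)⁻¹ ≤ c ^ m * 1 :=
              mul_le_mul (pow_le_pow_right₀ hc hp) (inv_le_one_of_one_le₀ (one_le_pow₀ hc))
                (by positivity) (by positivity)
          _ = _ := mul_one _

/-- With `η` frozen, the weight `1 + |ξ| + |η|` is the one that defines the scale for `R = |η|`. The
constants are those of `σ`, hence independent of `η`. -/
theorem exists_scaleSymbol (hδρ : δ ≤ ρ) (hσ : IsBiSymbol 0 ρ δ σ) (m : ℕ) :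
    ∃ A : ℝ, 0 ≤ A ∧ ∀ η : RSpace n,
      ScaleSymbol δ ‖η‖ m A (fun J x ξ => xiD (indIdx J) σ x ξ η) := by
  obtain ⟨A, hA0, hA⟩ := hσ.exists_common_bound m n 0
  have hs := hσ.smooth_unc
  have hsm : ∀ J, ContDiff ℝ ∞ (unc (xiD (indIdx J) σ)) := fun J => mulD_smooth _ _ hs
  have hcard : ∀ J : Finset (Fin n), J.card ≤ n := fun J => by simpa using Finset.card_le_univ J
  refine ⟨A * (2 * (n + 1)) ^ m, by positivity, fun η => ?_⟩
  have hbd : ∀ (J : Finset (Fin n)) (j : Fin n → ℕ) (x ξ : RSpace n), order j ≤ m →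
      ‖bisymD j 0 0 (xiD (indIdx J) σ) x ξ η‖ ≤ A * (2 * (n + 1)) ^ m *
        (scale δ ‖η‖ ξ)⁻¹ ^ J.card * scale δ ‖η‖ ξ ^ order j := by
    intro J j x ξ hp
    rw [bisymD_xiD _ _ _ hs, mul_assoc, mul_assoc]
    refine (hA j (indIdx J) 0 hp (by rw [order_indIdx]; exact hcard J)
      (by rw [order_zero]) x ξ η).trans (mul_le_mul_of_nonneg_left ?_ hA0)
    rw [order_indIdx, order_zero]
    refine symbol_weight_le hδρ ?_ ?_ (scale_pos (norm_nonneg η) ξ) (scale_eq ξ) hp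
    · have := norm_nonneg ξ; have := norm_nonneg η; linarith
    · have : (0 : ℝ) ≤ n := Nat.cast_nonneg n
      linarith
  have hslice : ∀ J ξ, ContDiff ℝ ∞ fun x => xiD (indIdx J) σ x ξ η := fun J ξ =>
    (hsm J).comp (contDiff_id.prodMk (contDiff_const.prodMk contDiff_const))
  refine ⟨fun x J i hi ξ => ?_, fun J => ?_, fun J ξ => (hslice J ξ).smooth_nat m,
    fun J x ξ => ?_, fun J ξ j p hp x => ?_⟩
  · have h1 : ContDiff ℝ ∞ fun ξ => xiD (indIdx J) σ x ξ η :=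
      (hsm J).comp (contDiff_const.prodMk (contDiff_id.prodMk contDiff_const))
    have h2 := ((h1.differentiable (by simp)) ξ).hasFDerivAt.hasLineDerivAt
      (EuclideanSpace.single i 1)
    refine h2.congr_deriv ?_
    have h3 : multiD (Pi.single i 1) (fun ξ => xiD (indIdx J) σ x ξ η) ξ = _ :=
      mulD_slot_xi (Pi.single i 1) (hsm J) x ξ η
    rw [multiD_eq_mulD, mulD_single _ i 1 (h1.smooth_nat 1), mulD_single _ i 1 ((hsm J).smooth_nat 1)]
      at h3
    refine h3.trans ?_
    rw [indIdx_insert hi, Function.iterate_one, unc_xiD, dirD_mulD _ _ _ (hs.smooth_nat _),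
      ← mulD_add_single _ _ _ (hs.smooth_nat _)]
    rfl
  · exact (hsm J).continuous.comp
      (by fun_prop : Continuous fun p : RSpace n × RSpace n => (p.1, p.2, η))
  · have := hbd J 0 x ξ (by rw [order_zero]; omega)
    rwa [bisymD_zero, order_zero, pow_zero, mul_one] at this
  · have := hbd J (Pi.single j p) x ξ (by rwa [order_single])
    rw [order_single] at this
    refine le_of_eq_of_le (congrArg _ ?_) this
    rw [bisymD]
    simp only [multiD_zero]
    rw [multiD_eq_mulD, mulD_single _ j p ((hslice J ξ).smooth_nat p)]
    rfl

/-- The operator with symbol `σ(·, ·, η)`, applied to a function given on the frequency side. -/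
def freqOp (σ : RSpace n → RSpace n → RSpace n → ℂ) (F : RSpace n → ℂ) (x η : RSpace n) : ℂ :=
  ∫ ζ, σ x ζ η * (expi x ζ * F ζ)

theorem IsBiSymbol.exists_norm_le (hσ : IsBiSymbol 0 ρ δ σ) :
    ∃ A : ℝ, 0 ≤ A ∧ ∀ x ξ η, ‖σ x ξ η‖ ≤ A := by
  obtain ⟨A, hA0, hA⟩ := hσ.exists_growth le_rfl le_rfl
  exact ⟨A, hA0, fun x ξ η => by simpa using hA x ξ η⟩

theorem continuous_freqOp (hσ : IsBiSymbol 0 ρ δ σ) (F : 𝓢(RSpace n, ℂ)) :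
    Continuous fun p : RSpace n × RSpace n => freqOp σ F p.1 p.2 := by
  obtain ⟨A, hA0, hA⟩ := hσ.exists_norm_le
  have hF : Integrable (F : RSpace n → ℂ) := F.integrable
  have hFc := F.continuous
  unfold freqOp
  refine continuous_of_dominated (bound := fun ζ => A * ‖F ζ‖) (fun p => ?_)
    (fun p => Filter.Eventually.of_forall fun ζ => ?_) (hF.norm.const_mul A)
    (Filter.Eventually.of_forall fun ζ => ?_)
  · have h1 := hσ.continuous_comp (continuous_const (y := p.1)) continuous_id
      (continuous_const (y := p.2))
    exact (h1.mul (by fun_prop)).aestronglyMeasurable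
  · rw [norm_mul, norm_mul, norm_expi, one_mul]
    exact mul_le_mul_of_nonneg_right (hA _ _ _) (norm_nonneg _)
  · have h1 := hσ.continuous_comp (α := RSpace n × RSpace n) continuous_fst
      (continuous_const (y := ζ)) continuous_snd
    exact h1.mul (by fun_prop)

theorem exists_norm_freqOp_le (hσ : IsBiSymbol 0 ρ δ σ) (F : 𝓢(RSpace n, ℂ)) :
    ∃ B : ℝ, ∀ x η, ‖freqOp σ F x η‖ ≤ B := by
  obtain ⟨A, hA0, hA⟩ := hσ.exists_norm_le
  have hF : Integrable (F : RSpace n → ℂ) := F.integrable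
  refine ⟨∫ ζ, A * ‖F ζ‖, fun x η => norm_integral_le_of_norm_le (hF.norm.const_mul A)
    (Filter.Eventually.of_forall fun ζ => ?_)⟩
  rw [norm_mul, norm_mul, norm_expi, one_mul]
  exact mul_le_mul_of_nonneg_right (hA _ _ _) (norm_nonneg _)

/-- Optimisation in `t` with `t² = b / a`. Adding `ε > 0` to both numbers covers the case that one
of them vanishes. -/
theorem le_two_mul_of_forall_scaling {X D a b : ℝ} (ha : 0 ≤ a) (hb : 0 ≤ b)
    (h : ∀ t : ℝ, 0 < t → X ≤ D * (t ^ 2 * a ^ 2 + (t⁻¹) ^ 2 * b ^ 2)) (hD : 0 ≤ D) :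
    X ≤ 2 * D * (a * b) := by
  have key : ∀ ε : ℝ, 0 < ε → X ≤ 2 * D * ((a + ε) * (b + ε)) := by
    intro ε hε
    have hA : 0 < a + ε := by linarith
    have hB : 0 < b + ε := by linarith
    refine (h (Real.sqrt ((b + ε) / (a + ε))) (by positivity)).trans ?_
    rw [inv_pow, Real.sq_sqrt (by positivity), inv_div, mul_comm 2 D, mul_assoc]
    refine mul_le_mul_of_nonneg_left ?_ hD
    have h1 : (b + ε) / (a + ε) * a ^ 2 ≤ (b + ε) / (a + ε) * (a + ε) ^ 2 := by gcongr; linarith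
    have h2 : (a + ε) / (b + ε) * b ^ 2 ≤ (a + ε) / (b + ε) * (b + ε) ^ 2 := by gcongr; linarith
    have h3 : (b + ε) / (a + ε) * (a + ε) ^ 2 = (a + ε) * (b + ε) := by field_simp
    have h4 : (a + ε) / (b + ε) * (b + ε) ^ 2 = (a + ε) * (b + ε) := by field_simp
    linarith
  have hlim : Filter.Tendsto (fun ε : ℝ => 2 * D * ((a + ε) * (b + ε))) (nhdsWithin 0 (Set.Ioi 0))
      (nhds (2 * D * ((a + 0) * (b + 0)))) := by
    refine Filter.Tendsto.mono_left (Continuous.tendsto ?_ 0) nhdsWithin_le_nhds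
    fun_prop
  rw [add_zero, add_zero] at hlim
  exact ge_of_tendsto hlim (Filter.eventually_of_mem self_mem_nhdsWithin key)

theorem ofReal_norm_toLp_sq (f : 𝓢(RSpace n, ℂ)) :
    ∫⁻ x, ‖f x‖ₑ ^ 2 = ENNReal.ofReal (‖f.toLp 2 (volume : Measure (RSpace n))‖ ^ 2) := by
  have hf : MemLp (f : RSpace n → ℂ) 2 volume := f.memLp 2
  rw [← eLpNorm_two_sq, SchwartzMap.norm_toLp, ENNReal.ofReal_pow ENNReal.toReal_nonneg,
    ENNReal.ofReal_toReal hf.eLpNorm_ne_top]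

theorem one_le_two_pi_pow : (1 : ℝ) ≤ (2 * Real.pi) ^ n :=
  one_le_pow₀ (by linarith [Real.pi_gt_three])

/-- The form is unchanged when `f` is multiplied by `t` and `k` by `1/t`, which upgrades the bound
by a sum of squares to a bound by the product of the norms. -/
theorem exists_freqOp_form_le (hδ : 0 ≤ δ) (hδ1 : δ < 1) (hδρ : δ ≤ ρ) (hσ : IsBiSymbol 0 ρ δ σ) :
    ∃ C : ℝ, 0 ≤ C ∧ ∀ (η : RSpace n) (f k : 𝓢(RSpace n, ℂ)),
      ‖∫ x, k x * freqOp σ (fourierHatS f) x η‖ ≤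
        C * (‖f.toLp 2 (volume : Measure (RSpace n))‖ *
          ‖k.toLp 2 (volume : Measure (RSpace n))‖) := by
  -- Here `δ < 1` enters: the far part of the Schur estimate asks for `2M(1 - δ) ≥ n + 1`.
  obtain ⟨M, hM⟩ := exists_nat_ge (((n : ℝ) + 1) / (1 - δ))
  have hM' : (n : ℝ) + 1 ≤ (1 - δ) * (2 * M : ℕ) := by
    have h1 : 0 < 1 - δ := by linarith
    rw [div_le_iff₀ h1] at hM
    push_cast
    have : 0 ≤ (M : ℝ) * (1 - δ) := by positivity
    linarith
  obtain ⟨A, hA0, hA⟩ := exists_scaleSymbol hδρ hσ (2 * M)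
  obtain ⟨C, hC0, hC⟩ := exists_form_bound (n := n) hδ hδ1.le M hM'
  set c : ℝ := (2 * Real.pi) ^ n with hc
  have hc1 : 1 ≤ c := one_le_two_pi_pow
  refine ⟨2 * (C * A * c), by positivity, fun η f k => ?_⟩
  refine le_two_mul_of_forall_scaling (norm_nonneg _) (norm_nonneg _) (fun t ht => ?_)
    (by positivity)
  obtain ⟨K, hK⟩ := exists_fourierHat_eq (((t : ℂ)⁻¹) • k)
  have h1 := hC ‖η‖ A _ (norm_nonneg η) (hA η) (fourierHatS ((t : ℂ) • f)) K
  simp only [indIdx_empty, xiD_zero] at h1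
  have ht0 : (t : ℂ) ≠ 0 := by exact_mod_cast ht.ne'
  have e1 : ∀ x, fourierHat K x * ∫ ζ, σ x ζ η * (expi x ζ * fourierHatS ((t : ℂ) • f) ζ) =
      k x * freqOp σ (fourierHatS f) x η := by
    intro x
    have e2 : ∀ ζ, fourierHatS ((t : ℂ) • f) ζ = (t : ℂ) * fourierHatS f ζ := fun ζ => by
      rw [fourierHatS_apply, fourierHatS_apply, fourierHat, fourierHat, ← integral_const_mul]
      refine integral_congr_ae (Filter.Eventually.of_forall fun y => ?_)
      simp only [_root_.smul_apply, smul_eq_mul]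
      ring
    rw [← hK, _root_.smul_apply, smul_eq_mul, mul_assoc, mul_left_comm, freqOp,
      ← integral_const_mul]
    congr 1
    refine integral_congr_ae (Filter.Eventually.of_forall fun ζ => ?_)
    simp only [e2]
    field_simp
  simp only [e1] at h1
  have e3 : ∫⁻ ζ, ‖fourierHatS ((t : ℂ) • f) ζ‖ₑ ^ 2 = ENNReal.ofReal (c * (t ^ 2 *
      ‖f.toLp 2 (volume : Measure (RSpace n))‖ ^ 2)) := by
    simp only [fourierHatS_apply]
    rw [lintegral_fourierHat_sq, ofReal_norm_toLp_sq, ← ENNReal.ofReal_mul (by positivity)]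
    congr 2
    have : ((t : ℂ) • f).toLp 2 (volume : Measure (RSpace n)) = (t : ℂ) • f.toLp 2 volume := rfl
    rw [this, norm_smul, Complex.norm_real, Real.norm_of_nonneg ht.le, mul_pow]
  have e4 : ∫⁻ θ, ‖K θ‖ₑ ^ 2 ≤ ENNReal.ofReal (c * ((t⁻¹) ^ 2 *
      ‖k.toLp 2 (volume : Measure (RSpace n))‖ ^ 2)) := by
    have h2 := lintegral_fourierHat_sq K
    simp only [← hK] at h2
    have h3 : ∫⁻ x, ‖(((t : ℂ)⁻¹) • k) x‖ₑ ^ 2 = ENNReal.ofReal ((t⁻¹) ^ 2 *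
      ‖k.toLp 2 (volume : Measure (RSpace n))‖ ^ 2) := by
      rw [ofReal_norm_toLp_sq]
      have : (((t : ℂ)⁻¹) • k).toLp 2 (volume : Measure (RSpace n)) =
        ((t : ℂ)⁻¹) • k.toLp 2 volume := rfl
      rw [this, norm_smul, norm_inv, Complex.norm_real, Real.norm_of_nonneg ht.le, mul_pow]
    rw [h3] at h2
    -- Plancherel gives `(2π)^n ‖K‖² = ‖k/t‖²`; the factor is at least `1` and may be dropped.
    calc ∫⁻ θ, ‖K θ‖ₑ ^ 2 ≤ ENNReal.ofReal c * ∫⁻ θ, ‖K θ‖ₑ ^ 2 := by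
          refine le_mul_of_one_le_left' ?_
          rwa [ENNReal.one_le_ofReal]
      _ = _ := h2.symm
      _ ≤ _ := ENNReal.ofReal_le_ofReal (le_mul_of_one_le_left (by positivity) hc1)
  rw [e3] at h1
  have h5 := h1.trans (mul_le_mul_right (add_le_add_right e4 _) _)
  rw [← ENNReal.ofReal_add (by positivity) (by positivity), ← ENNReal.ofReal_mul (by positivity),
    ← ofReal_norm, ENNReal.ofReal_le_ofReal_iff (by positivity)] at h5
  refine h5.trans (le_of_eq ?_)
  ring

/-- The operators with symbol `σ(·, ·, η)` are bounded on `L²`, uniformly in `η`. -/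
theorem exists_freqOp_eLpNorm_le (hδ : 0 ≤ δ) (hδ1 : δ < 1) (hδρ : δ ≤ ρ)
    (hσ : IsBiSymbol 0 ρ δ σ) :
    ∃ C : ℝ, 0 ≤ C ∧ ∀ (η : RSpace n) (f : 𝓢(RSpace n, ℂ)),
      eLpNorm (fun x => freqOp σ (fourierHatS f) x η) 2 ≤
        ENNReal.ofReal (C * ‖f.toLp 2 (volume : Measure (RSpace n))‖) := by
  obtain ⟨C, hC0, hC⟩ := exists_freqOp_form_le hδ hδ1 hδρ hσ
  refine ⟨C, hC0, fun η f => ?_⟩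
  have hc : Continuous fun x => freqOp σ (fourierHatS f) x η :=
    (continuous_freqOp hσ (fourierHatS f)).comp
      (by fun_prop : Continuous fun x : RSpace n => (x, η))
  obtain ⟨B, hB⟩ := exists_norm_freqOp_le hσ (fourierHatS f)
  refine (eLpNorm_le_of_forall_schwartz (u := fun x => freqOp σ (fourierHatS f) x η)
    hc.locallyIntegrable (fun φ => ?_)
    (C := C * ‖f.toLp 2 (volume : Measure (RSpace n))‖) (by positivity) (fun k => ?_)).2
  · have hφ : Integrable (φ : RSpace n → ℂ) := φ.integrable
    exact hφ.mul_bdd hc.aestronglyMeasurable (Filter.Eventually.of_forall fun x => hB x η)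
  · rw [mul_assoc]
    exact hC η f k

end FreqOp

/-! ### The bilinear operator -/

section BiOp

variable {n : ℕ} {ρ δ : ℝ} {σ : RSpace n → RSpace n → RSpace n → ℂ}

theorem IsBiSymbol.iterate_symDir_eEta (hρ : 0 ≤ ρ) (hσ : IsBiSymbol 0 ρ δ σ) (j : Fin n)
    (i : ℕ) : IsBiSymbol 0 ρ δ ((symDir (eEta j))^[i] σ) := by
  induction i with
  | zero => exact hσ
  | succ i ih =>
    rw [Function.iterate_succ_apply']
    exact (ih.symDir_eEta j).mono (by linarith)

theorem partialD_eta (hσ : ContDiff ℝ ∞ (unc σ)) (j : Fin n) (x ξ η : RSpace n) :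
    partialD j (fun η => σ x ξ η) η = symDir (eEta j) σ x ξ η := by
  have h : multiD (Pi.single j 1) (fun η => σ x ξ η) η = _ :=
    mulD_slot_eta (Pi.single j 1) hσ x ξ η
  rw [multiD_eq_mulD, mulD_single _ j 1 ((contDiff_eta_slice hσ x ξ).smooth_nat 1),
    mulD_single _ j 1 (hσ.smooth_nat 1)] at h
  exact h

theorem iterate_partialD_eta (hσ : ContDiff ℝ ∞ (unc σ)) (j : Fin n) (i : ℕ) (x ξ η : RSpace n) :
    (partialD j)^[i] (fun η => σ x ξ η) η = (symDir (eEta j))^[i] σ x ξ η := by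
  induction i generalizing σ with
  | zero => rfl
  | succ i ih =>
    rw [Function.iterate_succ_apply, Function.iterate_succ_apply, ← ih (symDir_smooth _ hσ)]
    exact congrFun (congrArg _ (funext fun η => partialD_eta hσ j x ξ η)) η

theorem integrable_fourierHat {s : ℕ} (hs : n < s) {g : RSpace n → ℂ} (hg : ContDiff ℝ s g)
    (hgs : HasCompactSupport g) : Integrable (fourierHat g) := by
  obtain ⟨C, hC⟩ := exists_fourierHat_decay hg hgs
  exact integrable_of_decay (r := s)
    (continuous_fourierHat (hg.continuous.integrable_of_hasCompactSupport hgs)).aestronglyMeasurable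
    (by exact_mod_cast hs) hC

theorem integrable_fourierHat_schwartz (f : 𝓢(RSpace n, ℂ)) : Integrable (fourierHat f) := by
  have h : Integrable (fourierHatS f : RSpace n → ℂ) := (fourierHatS f).integrable
  exact h.congr (Filter.Eventually.of_forall fun ξ => fourierHatS_apply f ξ)

theorem continuous_biOpIntegrand (hσ : IsBiSymbol 0 ρ δ σ) {f g : RSpace n → ℂ}
    (hf : Continuous (fourierHat f)) (hg : Continuous (fourierHat g)) :
    Continuous fun q : RSpace n × RSpace n × RSpace n => biOpIntegrand σ f g q.1 q.2.1 q.2.2 := by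
  have h1 : Continuous fun q : RSpace n × RSpace n × RSpace n => σ q.1 q.2.1 q.2.2 :=
    hσ.continuous_comp (by fun_prop) (by fun_prop) (by fun_prop)
  have h2 : Continuous fun q : RSpace n × RSpace n × RSpace n => expi q.1 (q.2.1 + q.2.2) := by
    fun_prop
  unfold biOpIntegrand
  exact ((h1.mul (hf.comp (by fun_prop))).mul (hg.comp (by fun_prop))).mul h2

theorem exists_biOpIntegrand_le (hσ : IsBiSymbol 0 ρ δ σ) {f g : RSpace n → ℂ}
    (hf : Integrable (fourierHat f)) (hg : Integrable (fourierHat g)) :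
    ∃ b : RSpace n × RSpace n → ℝ, Integrable b ∧
      ∀ x p, ‖biOpIntegrand σ f g x p.1 p.2‖ ≤ b p := by
  obtain ⟨A, hA0, hA⟩ := hσ.exists_norm_le
  refine ⟨_, (hf.norm.mul_prod hg.norm).const_mul A, fun x p => ?_⟩
  rw [biOpIntegrand, norm_mul, norm_expi, mul_one, norm_mul, norm_mul, mul_assoc]
  exact mul_le_mul_of_nonneg_right (hA _ _ _) (by positivity)

theorem continuous_fourierHat_schwartz (f : 𝓢(RSpace n, ℂ)) : Continuous (fourierHat f) := by
  have : fourierHat f = fourierHatS f := by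
    funext ξ
    exact (fourierHatS_apply f ξ).symm
  rw [this]
  exact (fourierHatS f).continuous

theorem integrable_biOpIntegrand (hσ : IsBiSymbol 0 ρ δ σ) {s : ℕ} (hs : n < s)
    (f : 𝓢(RSpace n, ℂ)) {g : RSpace n → ℂ} (hg : ContDiff ℝ s g) (hgs : HasCompactSupport g)
    (x : RSpace n) :
    Integrable fun p : RSpace n × RSpace n => biOpIntegrand σ f g x p.1 p.2 := by
  obtain ⟨b, hb, hle⟩ := exists_biOpIntegrand_le hσ (integrable_fourierHat_schwartz f)
    (integrable_fourierHat hs hg hgs)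
  refine hb.mono' ?_ (Filter.Eventually.of_forall fun p => hle x p)
  exact ((continuous_biOpIntegrand hσ (continuous_fourierHat_schwartz f)
    (continuous_fourierHat (hg.continuous.integrable_of_hasCompactSupport hgs))).comp
    (by fun_prop : Continuous fun p : RSpace n × RSpace n => (x, p))).aestronglyMeasurable

theorem continuous_biOp (hσ : IsBiSymbol 0 ρ δ σ) {s : ℕ} (hs : n < s)
    (f : 𝓢(RSpace n, ℂ)) {g : RSpace n → ℂ} (hg : ContDiff ℝ s g) (hgs : HasCompactSupport g) :
    Continuous (biOp σ f g) := by
  obtain ⟨b, hb, hle⟩ := exists_biOpIntegrand_le hσ (integrable_fourierHat_schwartz f)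
    (integrable_fourierHat hs hg hgs)
  refine continuous_of_dominated (fun x =>
    (integrable_biOpIntegrand hσ hs f hg hgs x).aestronglyMeasurable)
    (fun x => Filter.Eventually.of_forall fun p => hle x p) hb
    (Filter.Eventually.of_forall fun p => ?_)
  exact (continuous_biOpIntegrand hσ (continuous_fourierHat_schwartz f)
    (continuous_fourierHat (hg.continuous.integrable_of_hasCompactSupport hgs))).comp
    (by fun_prop : Continuous fun x : RSpace n => (x, p))

/-- The frequency-localised operators that enter the bilinear operator. -/
def etaOp (M : ℕ) (σ : RSpace n → RSpace n → RSpace n → ℂ) (F : RSpace n → ℂ)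
    (x η : RSpace n) : ℂ :=
  freqOp σ F x η + ∑ j, (-1) ^ M * freqOp ((symDir (eEta j))^[2 * M] σ) F x η

theorem continuous_etaOp (hρ : 0 ≤ ρ) (hσ : IsBiSymbol 0 ρ δ σ) (M : ℕ) (F : 𝓢(RSpace n, ℂ)) :
    Continuous fun p : RSpace n × RSpace n => etaOp M σ F p.1 p.2 :=
  (continuous_freqOp hσ F).add (continuous_finsetSum _ fun j _ =>
    continuous_const.mul (continuous_freqOp (hσ.iterate_symDir_eEta hρ j _) F))

theorem exists_eLpNorm_etaOp_le (hδ : 0 ≤ δ) (hδ1 : δ < 1) (hδρ : δ ≤ ρ) (hσ : IsBiSymbol 0 ρ δ σ)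
    (M : ℕ) :
    ∃ C : ℝ, 0 ≤ C ∧ ∀ (η : RSpace n) (f : 𝓢(RSpace n, ℂ)),
      eLpNorm (fun x => etaOp M σ (fourierHatS f) x η) 2 ≤
        ENNReal.ofReal (C * ‖f.toLp 2 (volume : Measure (RSpace n))‖) := by
  have hρ : 0 ≤ ρ := hδ.trans hδρ
  have hj := fun j => hσ.iterate_symDir_eEta hρ j (2 * M)
  obtain ⟨C₀, hC₀, h₀⟩ := exists_freqOp_eLpNorm_le hδ hδ1 hδρ hσ
  choose C hC h using fun j => exists_freqOp_eLpNorm_le hδ hδ1 hδρ (hj j)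
  have hsum : 0 ≤ ∑ j, C j := Finset.sum_nonneg fun j _ => hC j
  refine ⟨C₀ + ∑ j, C j, by positivity, fun η f => ?_⟩
  have hm : ∀ {τ : RSpace n → RSpace n → RSpace n → ℂ}, IsBiSymbol 0 ρ δ τ →
      Continuous fun x => freqOp τ (fourierHatS f) x η := fun hτ =>
    (continuous_freqOp hτ (fourierHatS f)).comp
      (by fun_prop : Continuous fun x : RSpace n => (x, η))
  have e : (fun x => etaOp M σ (fourierHatS f) x η) =
      (fun x => freqOp σ (fourierHatS f) x η) + ∑ j, fun x =>
        (-1) ^ M * freqOp ((symDir (eEta j))^[2 * M] σ) (fourierHatS f) x η := by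
    funext x
    simp [etaOp]
  rw [e, add_mul, Finset.sum_mul, ENNReal.ofReal_add (by positivity)
    (Finset.sum_nonneg fun j _ => mul_nonneg (hC j) (norm_nonneg _)),
    ENNReal.ofReal_sum_of_nonneg fun j _ => mul_nonneg (hC j) (norm_nonneg _)]
  have hmj : ∀ j, AEStronglyMeasurable (fun x =>
      (-1) ^ M * freqOp ((symDir (eEta j))^[2 * M] σ) (fourierHatS f) x η) volume := fun j =>
    (continuous_const.mul (hm (hj j))).aestronglyMeasurable
  refine (eLpNorm_add_le (hm hσ).aestronglyMeasurable
    (Finset.aestronglyMeasurable_sum _ fun j _ => hmj j) (by norm_num)).trans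
    (add_le_add (h₀ η f) ((eLpNorm_sum_le (fun j _ => hmj j) (by norm_num)).trans
      (Finset.sum_le_sum fun j _ => ?_)))
  refine le_trans (eLpNorm_mono fun x => ?_) (h j η f)
  rw [norm_mul, norm_pow, norm_neg, norm_one, one_pow, one_mul]

/-- For fixed `x` and `ξ` the integral in `η` is rewritten with the localised transform of `g`.
Fubini then makes the integral in `ξ` the inner one, which is an operator with `η` as a parameter.
-/
theorem biOp_eq (hρ : 0 ≤ ρ) (hσ : IsBiSymbol 0 ρ δ σ) {s : ℕ} (hs : n < s) (M : ℕ)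
    (f : 𝓢(RSpace n, ℂ)) {g : RSpace n → ℂ} (hg : ContDiff ℝ s g)
    (hgs : HasCompactSupport g) (hloc : ∀ x, Integrable (locTransform M g x)) (x : RSpace n) :
    biOp σ f g x = ∫ η, etaOp M σ (fourierHatS f) x η * locTransform M g x η := by
  set F := fourierHatS f with hF
  have hFi : Integrable (F : RSpace n → ℂ) := F.integrable
  have hj := fun j => hσ.iterate_symDir_eEta hρ j (2 * M)
  have hint : ∀ {τ : RSpace n → RSpace n → RSpace n → ℂ}, IsBiSymbol 0 ρ δ τ →
      Integrable fun p : RSpace n × RSpace n =>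
        τ x p.1 p.2 * (expi x p.1 * F p.1) * locTransform M g x p.2 := by
    intro τ hτ
    obtain ⟨A, hA0, hA⟩ := hτ.exists_norm_le
    have hc : Continuous fun p : RSpace n × RSpace n => τ x p.1 p.2 * expi x p.1 :=
      (hτ.continuous_comp (by fun_prop) (by fun_prop) (by fun_prop)).mul (by fun_prop)
    refine ((hFi.mul_prod (hloc x)).bdd_mul (c := A) hc.aestronglyMeasurable
      (Filter.Eventually.of_forall fun p => ?_)).congr (Filter.Eventually.of_forall fun p => ?_)
    · rw [norm_mul, norm_expi, mul_one]
      exact hA _ _ _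
    · simp only
      ring
  have hfreq : ∀ {τ : RSpace n → RSpace n → RSpace n → ℂ}, IsBiSymbol 0 ρ δ τ →
      ∀ η, Integrable fun ζ => τ x ζ η * (expi x ζ * F ζ) := by
    intro τ hτ η
    obtain ⟨A, hA0, hA⟩ := hτ.exists_norm_le
    have hc : Continuous fun ζ : RSpace n => τ x ζ η * expi x ζ :=
      (hτ.continuous_comp (by fun_prop) (by fun_prop) (by fun_prop)).mul (by fun_prop)
    refine (hFi.bdd_mul (c := A) hc.aestronglyMeasurable
      (Filter.Eventually.of_forall fun p => ?_)).congr (Filter.Eventually.of_forall fun p => ?_)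
    · rw [norm_mul, norm_expi, mul_one]
      exact hA _ _ _
    · simp only
      ring
  have hinner : ∀ ξ, ∫ η, biOpIntegrand σ f g x ξ η = ∫ η,
      (σ x ξ η * (expi x ξ * F ξ) * locTransform M g x η + ∑ j, (-1) ^ M *
        ((symDir (eEta j))^[2 * M] σ x ξ η * (expi x ξ * F ξ) * locTransform M g x η)) := by
    intro ξ
    have hb : ∀ {τ : RSpace n → RSpace n → RSpace n → ℂ}, IsBiSymbol 0 ρ δ τ →
        ∃ C : ℝ, ∀ η : RSpace n, ‖τ x ξ η‖ ≤ C * (1 + ‖η‖) ^ (0 : ℝ) := by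
      intro τ hτ
      obtain ⟨A, hA0, hA⟩ := hτ.exists_norm_le
      exact ⟨A, fun η => by simpa using hA x ξ η⟩
    have key := integral_mul_fourierHat M (κ := 0) (m := s) (by simpa using hs)
      (a := fun η => σ x ξ η) ((contDiff_eta_slice hσ.smooth_unc x ξ).smooth_nat _) (hb hσ)
      (fun j i hi => by
        simp only [iterate_partialD_eta hσ.smooth_unc]
        exact hb (hσ.iterate_symDir_eEta hρ j i)) hg hgs x
    simp only [iterate_partialD_eta hσ.smooth_unc] at key
    calc _ = ∫ η, (expi x ξ * F ξ) * (σ x ξ η * fourierHat g η * expi x η) := by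
          refine integral_congr_ae (Filter.Eventually.of_forall fun η => ?_)
          simp only [biOpIntegrand]
          rw [expi_add_right, hF, fourierHatS_apply]
          ring
      _ = _ := by
          rw [integral_const_mul, key, ← integral_const_mul]
          refine integral_congr_ae (Filter.Eventually.of_forall fun η => ?_)
          simp only
          rw [add_mul, mul_add, Finset.sum_mul, Finset.mul_sum]
          congr 1
          · ring
          · refine Finset.sum_congr rfl fun j _ => ?_
            ring
  have hI : Integrable fun p : RSpace n × RSpace n =>
      σ x p.1 p.2 * (expi x p.1 * F p.1) * locTransform M g x p.2 + ∑ j, (-1) ^ M *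
        ((symDir (eEta j))^[2 * M] σ x p.1 p.2 * (expi x p.1 * F p.1) *
          locTransform M g x p.2) :=
    (hint hσ).add (integrable_finsetSum _ fun j _ => (hint (hj j)).const_mul _)
  rw [biOp, Measure.volume_eq_prod,
    integral_prod _ (integrable_biOpIntegrand hσ hs f hg hgs x)]
  simp only [hinner]
  rw [integral_integral_swap hI]
  refine integral_congr_ae (Filter.Eventually.of_forall fun η => ?_)
  simp only
  have h1 := fun j => (((hfreq (hj j) η).mul_const (locTransform M g x η)).const_mul ((-1) ^ M))
  rw [integral_add ((hfreq hσ η).mul_const _) (integrable_finsetSum _ fun j _ => h1 j),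
    integral_finsetSum _ fun j _ => h1 j, etaOp, add_mul, Finset.sum_mul]
  congr 1
  · rw [integral_mul_const]
    rfl
  · refine Finset.sum_congr rfl fun j _ => ?_
    rw [integral_const_mul, integral_mul_const, mul_assoc]
    rfl

end BiOp

/-! ### The `L²` bound of the bilinear operator -/

section Bounded

variable {n s : ℕ} {ρ δ : ℝ} {σ : RSpace n → RSpace n → RSpace n → ℂ}

theorem lintegral_mul_sq_le {α : Type*} [MeasurableSpace α] {μ : Measure α} {f g : α → ENNReal}
    (hf : AEMeasurable f μ) (hg : AEMeasurable g μ) :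
    (∫⁻ a, f a * g a ∂μ) ^ 2 ≤ (∫⁻ a, f a ^ 2 ∂μ) * ∫⁻ a, g a ^ 2 ∂μ := by
  have h := ENNReal.lintegral_mul_le_Lp_mul_Lq μ Real.HolderConjugate.two_two hf hg
  simp only [Pi.mul_apply, ENNReal.rpow_ofNat] at h
  refine (pow_le_pow_left' h 2).trans (le_of_eq ?_)
  rw [mul_pow, ← ENNReal.rpow_natCast, ← ENNReal.rpow_natCast, ← ENNReal.rpow_mul,
    ← ENNReal.rpow_mul]
  norm_num

theorem CcS.exists_locTransform_le (n s M : ℕ) (hM : n < 2 * M) :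
    ∃ C : ℝ, 0 ≤ C ∧ ∀ (g : CcS n s) (x η : RSpace n),
      ‖locTransform M g x η‖ ≤ C * ‖g‖ * (1 + ‖η‖) ^ (-(s : ℝ)) := by
  obtain ⟨C, hC0, hC⟩ := locTransform_decay (n := n) M hM s
  refine ⟨C, hC0, fun g x η => hC g ‖g‖ g.2.1 (fun z => ?_) (fun j i hi z => ?_) x η⟩
  · have := g.le_norm 0 (by rw [order_zero]; omega) z
    rwa [multiD_zero] at this
  · exact norm_iterate_partialD_le g.2.1 g.le_norm j hi z

/-- Cauchy–Schwarz in `η` against the weight `(1 + |η|)^{-s}`, integrable as `s > n`, followed by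
Tonelli and the `L²` bound of `etaOp`, which is uniform in `η`. -/
theorem exists_biOp_eLpNorm_le (hδ : 0 ≤ δ) (hδ1 : δ < 1) (hδρ : δ ≤ ρ) (hs : n < s)
    (hσ : IsBiSymbol 0 ρ δ σ) :
    ∃ C : ℝ, 0 ≤ C ∧ ∀ (f : 𝓢(RSpace n, ℂ)) (g : CcS n s),
      eLpNorm (biOp σ f g) 2 ≤
        ENNReal.ofReal (C * ‖g‖ * ‖f.toLp 2 (volume : Measure (RSpace n))‖) := by
  have hρ : 0 ≤ ρ := hδ.trans hδρ
  obtain ⟨M, hM⟩ : ∃ M, n < 2 * M := ⟨n / 2 + 1, by omega⟩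
  obtain ⟨K, hK0, hK⟩ := CcS.exists_locTransform_le n s M hM
  obtain ⟨D, hD0, hD⟩ := exists_eLpNorm_etaOp_le hδ hδ1 hδρ hσ M
  have hwi : Integrable fun η : RSpace n => (1 + ‖η‖) ^ (-(s : ℝ)) :=
    integrable_one_add_norm (by simpa using hs)
  set I := ∫ η : RSpace n, (1 + ‖η‖) ^ (-(s : ℝ)) with hI
  have hI0 : 0 ≤ I := integral_nonneg fun η => by positivity
  refine ⟨K * I * D, by positivity, fun f g => ?_⟩
  set F := fourierHatS f with hF
  -- The square root of the weight: one copy stays with `etaOp`, the other is integrated out.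
  set v : RSpace n → ENNReal := fun η => ENNReal.ofReal ((1 + ‖η‖) ^ (-(s : ℝ) / 2)) with hv
  have hvm : Measurable v := by
    have : Continuous fun η : RSpace n => (1 + ‖η‖) ^ (-(s : ℝ) / 2) :=
      Continuous.rpow_const (by fun_prop) fun η => Or.inl (by positivity)
    exact this.measurable.ennreal_ofReal
  have hv2 : ∀ η, v η ^ 2 = ENNReal.ofReal ((1 + ‖η‖) ^ (-(s : ℝ))) := fun η => by
    rw [hv]
    simp only
    rw [← ENNReal.ofReal_pow (by positivity), ← Real.rpow_natCast, ← Real.rpow_mul (by positivity)]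
    congr 2
    push_cast
    ring
  have hvI : ∫⁻ η, v η ^ 2 = ENNReal.ofReal I := by
    simp only [hv2]
    exact (ofReal_integral_eq_lintegral_ofReal hwi
      (Filter.Eventually.of_forall fun η => by positivity)).symm
  have hG : Continuous fun p : RSpace n × RSpace n => etaOp M σ F p.1 p.2 :=
    continuous_etaOp hρ hσ M F
  have hGe : Measurable fun p : RSpace n × RSpace n => ‖etaOp M σ F p.1 p.2‖ₑ :=
    hG.measurable.enorm
  have hG₁ : ∀ η, Measurable fun x => ‖etaOp M σ F x η‖ₑ := fun η => by
    have h1 : Measurable fun x : RSpace n => (x, η) := by fun_prop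
    simpa only [Function.comp_def] using hGe.comp h1
  have hG₂ : ∀ x, Measurable fun η => ‖etaOp M σ F x η‖ₑ := fun x => by
    have h1 : Measurable fun η : RSpace n => (x, η) := by fun_prop
    simpa only [Function.comp_def] using hGe.comp h1
  have hloc : ∀ x, Integrable (locTransform M g x) := fun x =>
    integrable_of_decay (continuous_locTransform M g.2.1.continuous g.2.2 x).aestronglyMeasurable
      (by exact_mod_cast hs) (hK g x)
  have hpt : ∀ x, ‖biOp σ f g x‖ₑ ^ 2 ≤ ENNReal.ofReal ((K * ‖g‖) ^ 2 * I) *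
      ∫⁻ η, ‖etaOp M σ F x η‖ₑ ^ 2 * v η ^ 2 := by
    intro x
    have h1 : ‖biOp σ f g x‖ₑ ≤ ENNReal.ofReal (K * ‖g‖) *
        ∫⁻ η, (‖etaOp M σ F x η‖ₑ * v η) * v η := by
      rw [biOp_eq hρ hσ hs M f g.2.1 g.2.2 hloc x, ← lintegral_const_mul' _ _ ENNReal.ofReal_ne_top]
      refine (enorm_integral_le_lintegral_enorm _).trans (lintegral_mono fun η => ?_)
      simp only
      rw [enorm_mul, mul_assoc, ← sq, hv2, mul_left_comm, ← ENNReal.ofReal_mul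
        (mul_nonneg hK0 (norm_nonneg g)), ← ofReal_norm (locTransform M g x η)]
      exact mul_le_mul_right (ENNReal.ofReal_le_ofReal (hK g x η)) _
    have h2 := lintegral_mul_sq_le (μ := volume) ((hG₂ x).mul hvm).aemeasurable hvm.aemeasurable
    simp only [Pi.mul_apply, mul_pow] at h2
    rw [hvI] at h2
    calc _ ≤ (ENNReal.ofReal (K * ‖g‖) * ∫⁻ η, (‖etaOp M σ F x η‖ₑ * v η) * v η) ^ 2 :=
          pow_le_pow_left' h1 2
      _ ≤ ENNReal.ofReal (K * ‖g‖) ^ 2 *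
          ((∫⁻ η, ‖etaOp M σ F x η‖ₑ ^ 2 * v η ^ 2) * ENNReal.ofReal I) := by
          rw [mul_pow]
          exact mul_le_mul_right h2 _
      _ = _ := by
          have := mul_nonneg hK0 (norm_nonneg g)
          rw [ENNReal.ofReal_mul (sq_nonneg (K * ‖g‖)), ENNReal.ofReal_pow this]
          ring
  have hprod : Measurable fun p : RSpace n × RSpace n => ‖etaOp M σ F p.1 p.2‖ₑ ^ 2 * v p.2 ^ 2 :=
    (hGe.pow_const 2).mul ((hvm.comp measurable_snd).pow_const 2)
  have hfin : eLpNorm (biOp σ f g) 2 ^ 2 ≤ ENNReal.ofReal (K * I * D * ‖g‖ *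
      ‖f.toLp 2 (volume : Measure (RSpace n))‖) ^ 2 := by
    rw [eLpNorm_two_sq]
    refine (lintegral_mono hpt).trans ?_
    rw [lintegral_const_mul' _ _ ENNReal.ofReal_ne_top,
      lintegral_lintegral_swap hprod.aemeasurable]
    have h3 : ∀ η, ∫⁻ x, ‖etaOp M σ F x η‖ₑ ^ 2 * v η ^ 2 ≤
        ENNReal.ofReal (D * ‖f.toLp 2 (volume : Measure (RSpace n))‖) ^ 2 * v η ^ 2 := by
      intro η
      rw [lintegral_mul_const _ ((hG₁ η).pow_const 2)]
      refine mul_le_mul_left ?_ _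
      have h4 := pow_le_pow_left' (hD η f) 2
      rwa [eLpNorm_two_sq] at h4
    refine (mul_le_mul_right (lintegral_mono h3) _).trans (le_of_eq ?_)
    have hg0 := norm_nonneg g
    have hf0 := norm_nonneg (f.toLp 2 (volume : Measure (RSpace n)))
    rw [lintegral_const_mul _ (hvm.pow_const 2), hvI, ← ENNReal.ofReal_pow (by positivity),
      ← ENNReal.ofReal_pow (by positivity), ← ENNReal.ofReal_mul (by positivity),
      ← ENNReal.ofReal_mul (by positivity)]
    congr 1
    ring
  refine ((ENNReal.pow_le_pow_left_iff two_ne_zero).mp hfin).trans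
    (ENNReal.ofReal_le_ofReal (le_of_eq ?_))
  ring

end Bounded

/-! ### Extension by density -/

section Extension

/-- A bounded bilinear map on a dense subspace times a normed space extends uniquely to the
completions. -/
theorem existsUnique_bilinear_extension {S E G H : Type*} [AddCommGroup S] [Module ℂ S]
    [NormedAddCommGroup E] [NormedSpace ℂ E] [NormedAddCommGroup G] [NormedSpace ℂ G]
    [NormedAddCommGroup H] [NormedSpace ℂ H] [CompleteSpace H] {e : S →ₗ[ℂ] E}
    (he : DenseRange e) (T : S →ₗ[ℂ] G →ₗ[ℂ] H) {C : ℝ} (hC : 0 ≤ C)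
    (hT : ∀ x y, ‖T x y‖ ≤ C * ‖y‖ * ‖e x‖) :
    ∃! B : E →L[ℂ] UniformSpace.Completion G →L[ℂ] H, ∀ x (y : G), B (e x) y = T x y := by
  set c : G →ₗ[ℂ] UniformSpace.Completion G :=
    (UniformSpace.Completion.toComplL (𝕜 := ℂ) (E := G)).toLinearMap with hc
  have hcd : DenseRange c := UniformSpace.Completion.denseRange_coe
  have hcn : ∀ y, ‖c y‖ = ‖y‖ := fun y => UniformSpace.Completion.norm_coe y
  have hb : ∀ x y, ‖T x y‖ ≤ (C * ‖e x‖) * ‖c y‖ := fun x y => by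
    rw [hcn, mul_right_comm]
    exact hT x y
  have heq : ∀ x y, (T x).extendOfNorm c (c y) = T x y := fun x y =>
    LinearMap.extendOfNorm_eq hcd ⟨_, hb x⟩ y
  have hext : ∀ {u v : UniformSpace.Completion G →L[ℂ] H}, (∀ y, u (c y) = v (c y)) → u = v := by
    intro u v h
    refine ContinuousLinearMap.ext fun z => ?_
    exact congrFun (hcd.equalizer u.continuous v.continuous (funext h)) z
  -- The second variable is extended first, for each fixed `x`; linearity in `x` follows from
  -- agreement on the dense image of `G`, and then the first variable is extended.
  let L : S →ₗ[ℂ] UniformSpace.Completion G →L[ℂ] H :=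
    { toFun := fun x => (T x).extendOfNorm c
      map_add' := fun x x' => hext fun y => by
        rw [_root_.add_apply, heq, heq, heq, map_add, LinearMap.add_apply]
      map_smul' := fun a x => hext fun y => by
        rw [_root_.smul_apply, heq, RingHom.id_apply, heq, map_smul,
          LinearMap.smul_apply] }
  have hL : ∀ x, ‖L x‖ ≤ C * ‖e x‖ := fun x =>
    LinearMap.opNorm_extendOfNorm_le hcd (by positivity) (hb x)
  have hLe : ∀ x, L.extendOfNorm e (e x) = L x := fun x =>
    LinearMap.extendOfNorm_eq he ⟨C, hL⟩ x
  refine ⟨L.extendOfNorm e, fun x y => ?_, fun B hB => ?_⟩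
  · rw [hLe]
    exact heq x y
  · refine ContinuousLinearMap.ext fun z => ?_
    refine congrFun (he.equalizer B.continuous (L.extendOfNorm e).continuous (funext fun x => ?_)) z
    refine hext fun y => ?_
    simp only [Function.comp_apply]
    rw [hLe]
    exact (hB x y).trans (heq x y).symm

end Extension

/-! ### The bounded extension of the bilinear operator -/

section BiOpExtension

variable {n s : ℕ} {ρ δ : ℝ} {σ : RSpace n → RSpace n → RSpace n → ℂ}

theorem fourierHat_add {f g : RSpace n → ℂ} (hf : Integrable f) (hg : Integrable g) :
    fourierHat (f + g) = fourierHat f + fourierHat g := by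
  have h : ∀ {f : RSpace n → ℂ}, Integrable f → ∀ ξ, Integrable fun y => f y * expi (-y) ξ := by
    intro f hf ξ
    have hc : Continuous fun y : RSpace n => expi (-y) ξ := by fun_prop
    exact hf.mul_bdd (c := 1) hc.aestronglyMeasurable
      (Filter.Eventually.of_forall fun y => (norm_expi _ _).le)
  funext ξ
  simp only [fourierHat, Pi.add_apply, add_mul]
  exact integral_add (h hf ξ) (h hg ξ)

theorem fourierHat_smul (c : ℂ) (f : RSpace n → ℂ) : fourierHat (c • f) = c • fourierHat f := by
  funext ξ
  simp only [fourierHat, Pi.smul_apply, smul_eq_mul, mul_assoc]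
  exact integral_const_mul _ _

theorem CcS.integrable (g : CcS n s) : Integrable (g : RSpace n → ℂ) :=
  g.2.1.continuous.integrable_of_hasCompactSupport g.2.2

/-- Bilinearity of `T_σ` on Schwartz functions times `C_c^s` holds pointwise, thanks to absolute
convergence. Agreement almost everywhere is equality in `L²`, so the abstract extension theorem
applies. -/
theorem existsUnique_biOp_extension (hδ : 0 ≤ δ) (hδ1 : δ < 1) (hδρ : δ ≤ ρ) (hs : n < s)
    (hσ : IsBiSymbol 0 ρ δ σ) :
    ∃! B : LTwo n →L[ℂ] W0 n s →L[ℂ] LTwo n, ∀ (f : 𝓢(RSpace n, ℂ)) (g : CcS n s),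
      (B (f.toLp 2) (g : W0 n s) : RSpace n → ℂ) =ᵐ[volume] biOp σ f g := by
  obtain ⟨C, hC0, hC⟩ := exists_biOp_eLpNorm_le hδ hδ1 hδρ hs hσ
  have hint : ∀ (f : 𝓢(RSpace n, ℂ)) (g : CcS n s) (x : RSpace n),
      Integrable fun p : RSpace n × RSpace n => biOpIntegrand σ f g x p.1 p.2 := fun f g x =>
    integrable_biOpIntegrand hσ hs f g.2.1 g.2.2 x
  have hmem : ∀ (f : 𝓢(RSpace n, ℂ)) (g : CcS n s), MemLp (biOp σ f g) 2 := fun f g =>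
    ⟨(continuous_biOp hσ hs f g.2.1 g.2.2).aestronglyMeasurable,
      (hC f g).trans_lt ENNReal.ofReal_lt_top⟩
  have hfi : ∀ f : 𝓢(RSpace n, ℂ), Integrable (f : RSpace n → ℂ) := fun f => f.integrable
  have hadd₁ : ∀ (f f' : 𝓢(RSpace n, ℂ)) (g : CcS n s),
      biOp σ (f + f' : 𝓢(RSpace n, ℂ)) g = biOp σ f g + biOp σ f' g := by
    intro f f' g
    funext x
    have e : fourierHat (f + f' : 𝓢(RSpace n, ℂ)) = fourierHat f + fourierHat f' :=
      fourierHat_add (hfi f) (hfi f')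
    rw [Pi.add_apply, biOp, biOp, biOp, ← integral_add (hint f g x) (hint f' g x)]
    refine integral_congr_ae (Filter.Eventually.of_forall fun p => ?_)
    simp only [biOpIntegrand, e, Pi.add_apply]
    ring
  have hsmul₁ : ∀ (c : ℂ) (f : 𝓢(RSpace n, ℂ)) (g : CcS n s),
      biOp σ (c • f : 𝓢(RSpace n, ℂ)) g = c • biOp σ f g := by
    intro c f g
    funext x
    have e : fourierHat (c • f : 𝓢(RSpace n, ℂ)) = c • fourierHat f := fourierHat_smul c f
    rw [Pi.smul_apply, smul_eq_mul, biOp, biOp, ← integral_const_mul]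
    refine integral_congr_ae (Filter.Eventually.of_forall fun p => ?_)
    simp only [biOpIntegrand, e, Pi.smul_apply, smul_eq_mul]
    ring
  have hadd₂ : ∀ (f : 𝓢(RSpace n, ℂ)) (g g' : CcS n s),
      biOp σ f (g + g' : CcS n s) = biOp σ f g + biOp σ f g' := by
    intro f g g'
    funext x
    have e : fourierHat (g + g' : CcS n s) = fourierHat g + fourierHat g' := by
      rw [CcS.add_coe]
      exact fourierHat_add g.integrable g'.integrable
    rw [Pi.add_apply, biOp, biOp, biOp, ← integral_add (hint f g x) (hint f g' x)]
    refine integral_congr_ae (Filter.Eventually.of_forall fun p => ?_)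
    simp only [biOpIntegrand, e, Pi.add_apply]
    ring
  have hsmul₂ : ∀ (c : ℂ) (f : 𝓢(RSpace n, ℂ)) (g : CcS n s),
      biOp σ f (c • g : CcS n s) = c • biOp σ f g := by
    intro c f g
    funext x
    have e : fourierHat (c • g : CcS n s) = c • fourierHat g := by
      rw [CcS.smul_coe]
      exact fourierHat_smul c g
    rw [Pi.smul_apply, smul_eq_mul, biOp, biOp, ← integral_const_mul]
    refine integral_congr_ae (Filter.Eventually.of_forall fun p => ?_)
    simp only [biOpIntegrand, e, Pi.smul_apply, smul_eq_mul]
    ring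
  have hcongr : ∀ {u v : RSpace n → ℂ} (hu : MemLp u 2) (hv : MemLp v 2), u = v →
      hu.toLp u = hv.toLp v := by
    intro u v hu hv h
    subst h
    rfl
  let T : 𝓢(RSpace n, ℂ) →ₗ[ℂ] CcS n s →ₗ[ℂ] LTwo n :=
    LinearMap.mk₂ ℂ (fun f g => (hmem f g).toLp (biOp σ f g))
      (fun f f' g => (hcongr _ ((hmem f g).add (hmem f' g)) (hadd₁ f f' g)).trans
        (MemLp.toLp_add _ _))
      (fun c f g => (hcongr _ ((hmem f g).const_smul c) (hsmul₁ c f g)).trans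
        (MemLp.toLp_const_smul _ _))
      (fun f g g' => (hcongr _ ((hmem f g).add (hmem f g')) (hadd₂ f g g')).trans
        (MemLp.toLp_add _ _))
      (fun c f g => (hcongr _ ((hmem f g).const_smul c) (hsmul₂ c f g)).trans
        (MemLp.toLp_const_smul _ _))
  have hTa : ∀ f g, T f g = (hmem f g).toLp (biOp σ f g) := fun f g => rfl
  have he : DenseRange (SchwartzMap.toLpCLM ℂ ℂ 2 (volume : Measure (RSpace n))).toLinearMap :=
    SchwartzMap.denseRange_toLpCLM (F := ℂ) (p := 2) (μ := (volume : Measure (RSpace n)))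
      (by norm_num)
  obtain ⟨B, hB, huniq⟩ := existsUnique_bilinear_extension he T hC0 (fun f g => by
    rw [hTa, Lp.norm_toLp]
    exact ENNReal.toReal_le_of_le_ofReal (by positivity) (hC f g))
  refine ⟨B, fun f g => ?_, fun B' hB' => huniq B' fun f g => ?_⟩
  · have h := hB f g
    rw [hTa] at h
    have h' : B (f.toLp 2) (g : W0 n s) = (hmem f g).toLp (biOp σ f g) := h
    rw [h']
    exact (hmem f g).coeFn_toLp
  · rw [hTa]
    exact Lp.ext ((hB' f g).trans (hmem f g).coeFn_toLp.symm)

end BiOpExtension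

end

/-! ### The theorem -/

theorem mainTheorem4 (n s : ℕ) (ρ δ : ℝ) (hδ : 0 ≤ δ) (hδρ : δ ≤ ρ) (hρ : ρ ≤ 1) (hδ1 : δ < 1)
    (hs : (((n / 2 : ℕ) : ℝ) + 1) / (1 - δ) + (n : ℝ) < (s : ℝ)) :
    -- `T_σ` extends uniquely to a bounded bilinear map `L² × W_0^{s,∞} → L²`
    (∀ σ : RSpace n → RSpace n → RSpace n → ℂ, IsBiSymbol 0 ρ δ σ →
      (∀ (f : 𝓢(RSpace n, ℂ)) (g : CcS n s) (x : RSpace n),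
        Integrable (fun p : RSpace n × RSpace n => biOpIntegrand σ f g x p.1 p.2)) ∧
      ∃! B : LTwo n →L[ℂ] W0 n s →L[ℂ] LTwo n,
        ∀ (f : 𝓢(RSpace n, ℂ)) (g : CcS n s),
          (B (f.toLp 2) (g : W0 n s) : RSpace n → ℂ) =ᵐ[volume] biOp σ f g) ∧
    -- the frozen symbol, for `g` in `C_c^s` and for `g` in `C_c^∞`
    (∀ σ : RSpace n → RSpace n → RSpace n → ℂ, IsBiSymbol 0 ρ δ σ →
      (∀ g : CcS n s,
        (∀ x ξ : RSpace n, Integrable (fun η => frozenIntegrand σ g x ξ η)) ∧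
        IsSymbolUpTo 0 ρ δ (n / 2 + 1) (frozenSymbol σ g)) ∧
      (∀ g : RSpace n → ℂ, ContDiff ℝ ∞ g → HasCompactSupport g →
        IsSymbol 0 ρ δ (frozenSymbol σ g))) ∧
    -- the seminorm estimate, with a constant depending on `σ` only through its norm
    (∃ C : ℝ, ∀ σ : RSpace n → RSpace n → RSpace n → ℂ, IsBiSymbol 0 ρ δ σ → ∀ g : CcS n s,
      symbolNorm ρ δ (n / 2 + 1) (frozenSymbol σ g) ≤ C * biSymbolNorm ρ δ (n + 2) σ * ‖g‖) := by
  have hN : n + (n / 2 + 1) < s := add_half_lt_of_lt hδ hδ1 hs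
  refine ⟨?_, fun σ hσ => ⟨fun g => ⟨fun x ξ => ?_, ?_⟩, fun g hg hgs => ?_⟩, ?_⟩
  · exact fun σ hσ => ⟨fun f g x => integrable_biOpIntegrand hσ (by omega) f g.2.1 g.2.2 x,
      existsUnique_biOp_extension hδ hδ1 hδρ (by omega) hσ⟩
  · exact integrable_frozenIntegrand hσ le_rfl le_rfl
      (by have : n < s := by omega
          simpa using this) g.2.1 g.2.2 x ξ
  · exact isSymbolUpTo_frozenSymbol hδ hδ1.le (hδ.trans hδρ) hσ (by omega) hN g.2.1 g.2.2
  · exact isSymbol_frozenSymbol hδ hδ1.le (hδ.trans hδρ) hσ hg hgs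
  -- With `M = n / 2 + 1` one has `n < 2M ≤ n + 2`, so the order `n + 2` suffices for `σ`.
  · exact exists_symbolNorm_frozenSymbol_le hδ hδ1.le (hδ.trans hδρ) _ _ _
      ⟨n / 2 + 1, by omega, by omega⟩ (by omega) (by omega) hN
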